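/- **Setting.** Let $\sigma_x,\rho_2\in\mathbb R$ and $m\ge 0$. On one probability space let $\{x^{(i)}_{j,n}: 1\le i\le m,\ n\ge 1,\ j\in\mathbb Z\}$ be real random variables such that, for each $i$: $\mathbf E[x^{(i)}_{j,n}]=0$ and $\mathbf E[(x^{(i)}_{j,n})^2]=\sigma_x^2$ for all $n\ge1$, $j\in\mathbb Z$; for each $n$ the pairs $(x^{(i)}_{j,n},x^{(i)}_{-j,n})$, $j\ge 0$, are independent; $\mathbf E[x^{(i)}_{j,n}x^{(i)}_{-j,n}]=\rho_2$ for all $n,j\ge 1$; and $\sup_{j,n}\mathbf E|x^{(i)}_{j,n}|^k<\infty$ for all $k\ge1$. Suppose that for each $n$ the $m$ sequences $(x^{(i)}_{j,n})_{j\in\mathbb Z}$, $1\le i\le m$, are independent. Let $H^{(i)}_{n,s}=\big(x^{(i)}_{n+1-r-s,\,n}\big)_{r,s=1}^n$, the symmetric Hankel matrix $P_nT_n^{(i)}$, where $T_n^{(i)}=(x^{(i)}_{r-s,n})_{r,s=1}^n$ and $P_n$ is the backward identity permutation matrix. Put $\varphi_n(B)=\frac1n\mathbf E[\mathrm{Tr}\,B]$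 for a random $n\times n$ matrix $B$. For $p\ge 0$ let $\mathcal P_2(p)$ be the set of pair partitions of $\{1,\dots,p\}$ (empty if $p$ is odd). Let $\nu_t=(-1)^t$; for $\pi=\{(r_1,s_1),\dots,(r_k,s_k)\}\in\mathcal P_2(2k)$ with $r_t<s_t$, let $\pi'(r_t)=\pi'(s_t)=t$, $\eta_\pi(r_t)=1$ and $\eta_\pi(s_t)=(-1)^{\delta_{\nu_{r_t},\nu_{s_t}}}$. For $\tau\in\{1,\dots,m\}^p$ let $\beta(\tau)=0$ if $p$ is odd and, if $p=2k$, $$\beta(\tau)=\sum_{\pi\in\mathcal P_2(2k)}\int_0^1\!\int_{[-1,1]^k}\ \prod_{(r,s)\in\pi}\delta_{\tau_r,\tau_s}\big[\sigma_x^2(1-\delta_{\nu_r,\nu_s})+\rho_2\,\delta_{\nu_r,\nu_s}\big]\ \prod_{t=1}^{2k}\chi_{[0,1]}\Big(z_0+\sum_{\ell=t}^{2k}(-1)^\ell\eta_\pi(\ell)z_{\pi'(\ell)}\Big)\prod_{i=0}^k dz_i .$$ **(a)** The matrices $\{n^{-1/2}H^{(i)}_{n,s};1\le i\le m\}$ converge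 jointly in $*$-distribution: there are a $*$-probability space $(\mathcal A,\varphi)$ (a unital complex $*$-algebra with a linear functional $\varphi$ such that $\varphi(1)=1$ and $\varphi(bb^*)\ge0$ for all $b$) and $a_1,\dots,a_m\in\mathcal A$ such that, for all $p$, $\tau\in\{1,\dots,m\}^p$ and $\epsilon\in\{1,*\}^p$, $$\lim_{n\to\infty}\varphi_n\Big(\frac{H_{n,s}^{(\tau_1)\epsilon_1}}{n^{1/2}}\cdots\frac{H_{n,s}^{(\tau_p)\epsilon_p}}{n^{1/2}}\Big)=\varphi(a_{\tau_1}^{\epsilon_1}\cdots a_{\tau_p}^{\epsilon_p})=\beta(\tau).$$ **(b)** Let $Q$ be a noncommutative polynomial with complex coefficients in $m$ variables and their adjoints such that $Q_n=Q(n^{-1/2}H^{(1)}_{n,s},\dots,n^{-1/2}H^{(m)}_{n,s})$ is self-adjoint. Then there is a probability measure $F$ on $\mathbb R$ such that the expected empirical spectral distribution of $Q_n$ converges weakly to $F$ and the empirical spectral distribution (ESD) of $Q_n$ converges weakly to $F$ almost surely. All moments of $F$ are finite, $\int t^k\,dF=\varphi(Q(a_1,\dots,a_m)^k)$ for all $k\ge0$,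 and they are bounded by moments of a Gaussian distribution: with $d=\max(1,\deg Q)$ there is a centred Gaussian variable $G$ such that $\big|\int t^k\,dF\big|\le\mathbf E|G|^{dk}$ for all $k\ge 0$. In particular, for each $i$ the ESD of $n^{-1/2}H^{(i)}_{n,s}$ converges weakly, almost surely, to a probability distribution on $\mathbb R$ that is symmetric about $0$, has all moments finite, and whose $k$-th moment is $\beta(i,\dots,i)$ ($k$ entries) for every $k\ge0$. -/

import Mathlib

open MeasureTheory ProbabilityTheory Filter Topology
open scoped ComplexOrder BoundedContinuousFunction NNReal ENNReal

noncomputable section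

namespace HankelLSD

/-! ### Real symmetric Hankel matrices -/

/-- The `n × n` Toeplitz matrix `((a_{i-j}))` of a real input sequence, as a complex matrix. -/
def toeplitz (n : ℕ) (a : ℤ → ℝ) : Matrix (Fin n) (Fin n) ℂ :=
  Matrix.of fun i j => ((a ((i : ℤ) - (j : ℤ)) : ℝ) : ℂ)

/-- The `n × n` backward identity permutation matrix. -/
def backwardIdentity (n : ℕ) : Matrix (Fin n) (Fin n) ℂ :=
  Matrix.of fun i j => if j = Fin.rev i then 1 else 0

/-- The symmetric Hankel matrix `P_n T_n`; with indices `1 ≤ i, j ≤ n` its `(i,j)` entry is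
`a_{n+1-i-j}`. -/
def hankel (n : ℕ) (a : ℤ → ℝ) : Matrix (Fin n) (Fin n) ℂ :=
  backwardIdentity n * toeplitz n a

/-- `n^{-1/2} H_n`. -/
def scaledHankel (n : ℕ) (a : ℤ → ℝ) : Matrix (Fin n) (Fin n) ℂ :=
  (((Real.sqrt n)⁻¹ : ℝ) : ℂ) • hankel n a

/-! ### The assumption on the input -/

/-- A real pair-correlated triangular input `x n j`, `n ≥ 1`, `j ∈ ℤ`: centred variables of variance
`σ ^ 2`, such that for each `n` the pairs `(x n j, x n (-j))`, `j ≥ 0`, are independent,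
`E[x n j * x n (-j)] = ρ₂` for `j ≥ 1`, and all absolute moments are bounded uniformly in `n, j`. -/
structure PairCorrelatedInput {Ω : Type*} [MeasurableSpace Ω] (P : Measure Ω)
    (x : ℕ → ℤ → Ω → ℝ) (σ ρ₂ : ℝ) : Prop where
  measurable : ∀ n, 1 ≤ n → ∀ j, Measurable (x n j)
  mean_zero : ∀ n, 1 ≤ n → ∀ j, ∫ ω, x n j ω ∂P = 0
  indep : ∀ n, 1 ≤ n → iIndepFun (fun (j : ℕ) (ω : Ω) => (x n j ω, x n (-(j : ℤ)) ω)) P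
  variance : ∀ n, 1 ≤ n → ∀ j, ∫ ω, x n j ω ^ 2 ∂P = σ ^ 2
  correlation : ∀ n, 1 ≤ n → ∀ j : ℕ, 1 ≤ j → ∫ ω, x n j ω * x n (-(j : ℤ)) ω ∂P = ρ₂
  moments : ∀ k : ℕ, ∃ c : ℝ, ∀ n, 1 ≤ n → ∀ j,
    Integrable (fun ω => |x n j ω| ^ k) P ∧ ∫ ω, |x n j ω| ^ k ∂P ≤ c

/-! ### Star-probability spaces and convergence in `*`-distribution -/

/-- A state on a unital complex `*`-algebra; together with it the algebra is a
`*`-probability space. -/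
structure State (A : Type*) [Ring A] [StarRing A] [Algebra ℂ A] [StarModule ℂ A] where
  toLinearMap : A →ₗ[ℂ] ℂ
  map_one : toLinearMap 1 = 1
  nonneg : ∀ b : A, 0 ≤ toLinearMap (b * star b)

/-- `b^ε`, where `false` stands for `ε = 1` and `true` for `ε = *`. -/
def starPow {A : Type*} [Star A] (b : A) (ε : Bool) : A := if ε then star b else b

/-- The monomial `a_{τ_1}^{ε_1} ⋯ a_{τ_p}^{ε_p}`. -/
def monomial {A : Type*} [Monoid A] [Star A] {m p : ℕ} (a : Fin m → A)
    (τ : Fin p → Fin m) (ε : Fin p → Bool) : A :=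
  (List.ofFn fun t => starPow (a (τ t)) (ε t)).prod

/-- Evaluation of a noncommutative polynomial in `m` variables and their adjoints; the letter
`(i, false)` is sent to `a i` and the letter `(i, true)` to `star (a i)`. -/
def evalPoly {A : Type*} [Ring A] [Algebra ℂ A] [Star A] {m : ℕ} (a : Fin m → A) :
    FreeAlgebra ℂ (Fin m × Bool) →ₐ[ℂ] A :=
  FreeAlgebra.lift ℂ fun l => starPow (a l.1) l.2

/-- The degree of a noncommutative polynomial: the largest length of a word occurring in it. -/
def polyDegree {m : ℕ} (Q : FreeAlgebra ℂ (Fin m × Bool)) : ℕ :=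
  (FreeAlgebra.equivMonoidAlgebraFreeMonoid Q).coeff.support.sup FreeMonoid.length

/-- `φ_n(B) = n⁻¹ E[Tr B]` for a random `n × n` matrix `B`. -/
def expectedTrace {Ω : Type*} [MeasurableSpace Ω] (P : Measure Ω) {n : ℕ}
    (B : Ω → Matrix (Fin n) (Fin n) ℂ) : ℂ :=
  (n : ℂ)⁻¹ * ∫ ω, (B ω).trace ∂P

/-- Joint convergence in `*`-distribution of `m` sequences of random matrices to elements
`a 1, …, a m` of a `*`-probability space. -/
def ConvergesInStarDist {Ω : Type*} [MeasurableSpace Ω] (P : Measure Ω) {m : ℕ}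
    (M : (n : ℕ) → Ω → Fin m → Matrix (Fin n) (Fin n) ℂ)
    {A : Type*} [Ring A] [StarRing A] [Algebra ℂ A] [StarModule ℂ A]
    (φ : State A) (a : Fin m → A) : Prop :=
  ∀ (p : ℕ) (τ : Fin p → Fin m) (ε : Fin p → Bool),
    Tendsto (fun n => expectedTrace P fun ω => monomial (M n ω) τ ε) atTop
      (𝓝 (φ.toLinearMap (monomial a τ ε)))

/-! ### The limit moments

Positions `1, …, p` are represented by `Fin p`, so `t : Fin p` is the position `t + 1`. -/

/-- The pair partitions of `{1, …, p}`; there are none if `p` is odd. -/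
def pairPartitions (p : ℕ) : Finset (Finpartition (Finset.univ : Finset (Fin p))) :=
  Finset.univ.filter fun π => ∀ V ∈ π.parts, V.card = 2

/-- `ν = 1` at even positions and `ν = -1` at odd positions. -/
def nu {p : ℕ} (t : Fin p) : ℝ := (-1) ^ ((t : ℕ) + 1)

/-- The weight `θ_{r,s} = σ²(1 - δ_{ν_r,ν_s}) + ρ₂ δ_{ν_r,ν_s}`. -/
def theta (σ ρ₂ : ℝ) {p : ℕ} (r s : Fin p) : ℝ :=
  σ ^ 2 * (1 - if nu r = nu s then 1 else 0) + ρ₂ * (if nu r = nu s then 1 else 0)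

/-- The elements of the block of `s` that precede `s`. For a block `{r < s}` of a pair partition
this is `{r}` at `s` and empty at `r`. -/
def earlier {p : ℕ} (π : Finpartition (Finset.univ : Finset (Fin p))) (s : Fin p) :
    Finset (Fin p) :=
  (π.part s).filter (· < s)

/-- The sign `η_π`: for a block `{r < s}`, `η_π(r) = 1` and `η_π(s) = (-1)^{δ_{ν_r,ν_s}}`. -/
def eta {p : ℕ} (π : Finpartition (Finset.univ : Finset (Fin p))) (s : Fin p) : ℝ :=
  ∏ r ∈ earlier π s, if nu r = nu s then -1 else 1

/-- The block containing `t`, as an index of the block variables. -/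
def blockOf {p : ℕ} (π : Finpartition (Finset.univ : Finset (Fin p))) (t : Fin p) :
    {V // V ∈ π.parts} :=
  ⟨π.part t, π.part_mem.2 (Finset.mem_univ t)⟩

/-- The product over the blocks `{r < s}` of `π` of `δ_{τ_r,τ_s} θ_{r,s}`. -/
def blockWeight (σ ρ₂ : ℝ) {m p : ℕ} (τ : Fin p → Fin m)
    (π : Finpartition (Finset.univ : Finset (Fin p))) : ℝ :=
  ∏ s, ∏ r ∈ earlier π s, (if τ r = τ s then 1 else 0) * theta σ ρ₂ r s

/-- `∫_0^1 ∫_{[-1,1]^k} ∏_t χ_{[0,1]}(z₀ + ∑_{l ≥ t} (-1)^l η_π(l) z_{π'(l)}) dz dz₀`, with one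
variable `z_V` for each block `V` of `π`. -/
def blockIntegral {p : ℕ} (π : Finpartition (Finset.univ : Finset (Fin p))) : ℝ :=
  ∫ z₀ in Set.Icc (0 : ℝ) 1,
    ∫ z in (Set.Icc (fun _ => -1) (fun _ => 1) : Set ({V // V ∈ π.parts} → ℝ)),
      ∏ t : Fin p, (Set.Icc (0 : ℝ) 1).indicator (fun _ => (1 : ℝ))
        (z₀ + ∑ l ∈ Finset.Ici t, nu l * eta π l * z (blockOf π l))

/-- The limit moment of a monomial with indices `τ_1, …, τ_p`. It is `0` for odd `p`, as there is
then no pair partition. -/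
def limitMoment (σ ρ₂ : ℝ) {m p : ℕ} (τ : Fin p → Fin m) : ℝ :=
  ∑ π ∈ pairPartitions p, blockWeight σ ρ₂ τ π * blockIntegral π

/-! ### Spectral distributions -/

/-- The empirical spectral distribution of a matrix with real spectrum: mass `1/n` at each
eigenvalue, counted with algebraic multiplicity. It is only applied to Hermitian matrices, whose
eigenvalues coincide with their real parts. -/
def esd {n : ℕ} (B : Matrix (Fin n) (Fin n) ℂ) : Measure ℝ :=
  (n : ℝ≥0∞)⁻¹ • (B.charpoly.roots.map fun z => Measure.dirac z.re).sum

/-- The expected empirical spectral distribution of a random matrix: the measure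
`S ↦ E[esd(B)(S)]`. -/
def expectedESD {Ω : Type*} [MeasurableSpace Ω] (P : Measure Ω) {n : ℕ}
    (B : Ω → Matrix (Fin n) (Fin n) ℂ) : Measure ℝ :=
  P.bind fun ω => esd (B ω)

/-- Weak convergence of measures on the real line. -/
def WeaklyConverges (F : ℕ → Measure ℝ) (F' : Measure ℝ) : Prop :=
  ∀ f : ℝ →ᵇ ℝ, Tendsto (fun n => ∫ t, f t ∂(F n)) atTop (𝓝 (∫ t, f t ∂F'))

end HankelLSD

end

/-! Moments alone do not suffice: for a polynomial of degree at least three, the Gaussian-type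
bounds on its limit moments are too weak to determine a law. The proof therefore combines moment
convergence for words in the matrices with a truncation of the matrices themselves.

Traces of words. The normalized trace of a word is a sum over circuits, and the input variables are
independent across sites, a site being a colour together with an absolute index. A circuit with a
site met only once has expectation zero. Along a circuit the alternating sum of the indices is fixed
by the starting point. This costs a degree of freedom unless all sites are met exactly twice, with
the index repeated at positions of opposite parity and negated at positions of equal parity.
Circuits of this kind are lattice points of a polytope whose volume is `blockIntegral`, which gives
the limit of the mean (`tendsto_card_isPaired`, `tendsto_integral_scaledTrace`). The fourth centred
moment is `O(n⁻²)` (`exists_integral_centred_pow_four_le`), so almost surely all words converge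
simultaneously.

From words to spectra (`conv_integral_esd_evalPoly`). The `p`-th limit moments are at most `2 (C √p)
^ p`, so cosines, and with them a bounded triangle wave `h`, are mean square limits of polynomials
in the spectral distribution of each matrix. By Cauchy–Schwarz, traces of words in the truncated
matrices `h(X_k)` converge as well. These have bounded norm, so the spectral averages of a
polynomial in them converge by Weierstrass approximation. Replacing `X_k` by `h(X_k)` changes the
polynomial by a matrix of small relative rank, by Chebyshev's inequality, and this is negligible for
test functions `f` such that `f(A) - f(B)` has rank `O(rank (A - B))`. Such functions separate
points, and with tightness they yield weak convergence (`exists_limit_spectral_distribution`). The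
limit depends on the limit moments alone, hence is the same for almost every outcome. Applied to the
negated matrices, the same fact gives symmetry.

The state is the limit of normalized traces on the algebra generated by the matrix sequences of one
good outcome (`exists_limit_state`). The moment bounds follow by comparing `(C √q) ^ q` with
absolute Gaussian moments. -/

noncomputable section

namespace HankelLSD

/-! ### Finite-dimensional tools: spectral calculus, Hilbert–Schmidt and rank estimates,
noncommutative polynomials. -/

section

open scoped Matrix.Norms.L2Operator

variable {n m : ℕ}

/-- The normalized trace of an `n × n` matrix. -/
def ntr (B : Matrix (Fin n) (Fin n) ℂ) : ℂ := (n : ℂ)⁻¹ * B.trace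

lemma ntr_add (A B : Matrix (Fin n) (Fin n) ℂ) : ntr (A + B) = ntr A + ntr B := by
  simp [ntr, Matrix.trace_add, mul_add]

lemma ntr_sub (A B : Matrix (Fin n) (Fin n) ℂ) : ntr (A - B) = ntr A - ntr B := by
  simp [ntr, Matrix.trace_sub, mul_sub]

lemma ntr_smul (c : ℂ) (A : Matrix (Fin n) (Fin n) ℂ) : ntr (c • A) = c * ntr A := by
  simp [ntr, Matrix.trace_smul]; ring

lemma ntr_sum {ι : Type*} (s : Finset ι) (A : ι → Matrix (Fin n) (Fin n) ℂ) :
    ntr (∑ i ∈ s, A i) = ∑ i ∈ s, ntr (A i) := by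
  simp [ntr, Matrix.trace_sum, Finset.mul_sum]

lemma ntr_mul_comm (A B : Matrix (Fin n) (Fin n) ℂ) : ntr (A * B) = ntr (B * A) := by
  rw [ntr, ntr, Matrix.trace_mul_comm]

/-! ### Functional calculus of Hermitian matrices -/

section Calculus

variable {A B : Matrix (Fin n) (Fin n) ℂ}

lemma cfc_mul_cfc (hA : A.IsHermitian) (f g : ℝ → ℝ) :
    hA.cfc f * hA.cfc g = hA.cfc (fun x => f x * g x) := by
  simp only [Matrix.IsHermitian.cfc, ← map_mul, Matrix.diagonal_mul_diagonal]
  congr 2; ext i; simp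

lemma cfc_add_cfc (hA : A.IsHermitian) (f g : ℝ → ℝ) :
    hA.cfc f + hA.cfc g = hA.cfc (fun x => f x + g x) := by
  simp only [Matrix.IsHermitian.cfc, ← map_add, Matrix.diagonal_add]
  congr 2; ext i; simp

lemma cfc_sub_cfc (hA : A.IsHermitian) (f g : ℝ → ℝ) :
    hA.cfc f - hA.cfc g = hA.cfc (fun x => f x - g x) := by
  simp only [Matrix.IsHermitian.cfc, ← map_sub, Matrix.diagonal_sub]
  congr 2; ext i; simp

lemma smul_cfc (hA : A.IsHermitian) (c : ℝ) (f : ℝ → ℝ) :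
    (c : ℂ) • hA.cfc f = hA.cfc (fun x => c * f x) := by
  simp only [Matrix.IsHermitian.cfc, ← map_smul]
  congr 1
  rw [← Matrix.diagonal_smul]
  congr 1; ext i; simp

lemma cfc_one' (hA : A.IsHermitian) : hA.cfc (fun _ => 1) = 1 := by
  have : (Matrix.diagonal (RCLike.ofReal ∘ (fun _ : ℝ => (1 : ℝ)) ∘ hA.eigenvalues) :
      Matrix (Fin n) (Fin n) ℂ) = 1 := by
    simp [← Matrix.diagonal_one, Function.comp_def]
  simp only [Matrix.IsHermitian.cfc, this, map_one]

lemma cfc_id' (hA : A.IsHermitian) : hA.cfc (fun x => x) = A :=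
  hA.spectral_theorem.symm

lemma cfc_pow' (hA : A.IsHermitian) (k : ℕ) : hA.cfc (fun x => x ^ k) = A ^ k := by
  induction k with
  | zero => simpa using cfc_one' hA
  | succ k ih =>
    have h := cfc_mul_cfc hA (fun x => x ^ k) (fun x => x)
    rw [cfc_id', ih] at h
    rw [pow_succ, h]
    simp [pow_succ]

lemma cfc_const (hA : A.IsHermitian) (c : ℝ) : hA.cfc (fun _ => c) = (c : ℂ) • 1 := by
  rw [← cfc_one' hA, smul_cfc]; simp

lemma cfc_sum (hA : A.IsHermitian) {ι : Type*} (s : Finset ι) (f : ι → ℝ → ℝ) :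
    ∑ i ∈ s, hA.cfc (f i) = hA.cfc (fun x => ∑ i ∈ s, f i x) := by
  classical
  induction s using Finset.induction_on with
  | empty => simp [cfc_const]
  | insert a s ha ih => simp only [Finset.sum_insert ha, ih, cfc_add_cfc]

lemma isHermitian_cfc (hA : A.IsHermitian) (f : ℝ → ℝ) : (hA.cfc f).IsHermitian := by
  unfold Matrix.IsHermitian
  rw [← Matrix.star_eq_conjTranspose, Matrix.IsHermitian.cfc, ← map_star]
  congr 1
  rw [Matrix.star_eq_conjTranspose, Matrix.diagonal_conjTranspose]
  congr 1; ext i; simp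

lemma trace_cfc (hA : A.IsHermitian) (f : ℝ → ℝ) :
    (hA.cfc f).trace = ∑ i, (f (hA.eigenvalues i) : ℂ) := by
  rw [Matrix.IsHermitian.cfc, Unitary.conjStarAlgAut_apply, Matrix.trace_mul_comm, ← mul_assoc]
  simp [Matrix.trace]

lemma norm_cfc_le (hA : A.IsHermitian) {f : ℝ → ℝ} {c : ℝ} (hc : 0 ≤ c) (hf : ∀ x, |f x| ≤ c) :
    ‖hA.cfc f‖ ≤ c := by
  rw [Matrix.IsHermitian.cfc, Unitary.conjStarAlgAut_apply]
  rw [CStarRing.norm_mul_mem_unitary _ (Unitary.star_mem hA.eigenvectorUnitary.2),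
    CStarRing.norm_coe_unitary_mul, Matrix.l2_opNorm_diagonal, pi_norm_le_iff_of_nonneg hc]
  intro i
  simpa using hf _

lemma rank_cfc (hA : A.IsHermitian) (f : ℝ → ℝ) :
    (hA.cfc f).rank = Fintype.card {i // f (hA.eigenvalues i) ≠ 0} := by
  rw [Matrix.IsHermitian.cfc, Unitary.conjStarAlgAut_apply]
  rw [Matrix.rank_mul_eq_left_of_isUnit_det, Matrix.rank_mul_eq_right_of_isUnit_det,
    Matrix.rank_diagonal]
  · simp
  · exact Matrix.UnitaryGroup.det_isUnit _
  · exact Matrix.UnitaryGroup.det_isUnit (star hA.eigenvectorUnitary)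

end Calculus

/-! ### Empirical spectral distributions -/

section ESD

variable {A B : Matrix (Fin n) (Fin n) ℂ}

lemma esd_eq (hA : A.IsHermitian) :
    esd A = (n : ℝ≥0∞)⁻¹ • ∑ i, Measure.dirac (hA.eigenvalues i) := by
  rw [esd, hA.roots_charpoly_eq_eigenvalues, Multiset.map_map]
  simp [Finset.sum]

lemma isProbabilityMeasure_esd (hn : n ≠ 0) (hA : A.IsHermitian) :
    IsProbabilityMeasure (esd A) := by
  constructor
  rw [esd_eq hA]
  simp
  exact ENNReal.inv_mul_cancel (by simpa using hn) (by simp)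

lemma integrable_esd (hA : A.IsHermitian) (f : ℝ → ℝ) : Integrable f (esd A) := by
  rcases eq_or_ne n 0 with rfl | hn
  · rw [esd_eq hA]; simp
  rw [esd_eq hA]
  refine Integrable.smul_measure ?_ (by simpa using hn)
  rw [integrable_finsetSum_measure]
  intro i _
  exact integrable_dirac (by simp)

lemma integral_esd (hA : A.IsHermitian) (f : ℝ → ℝ) :
    ∫ t, f t ∂(esd A) = (n : ℝ)⁻¹ * ∑ i, f (hA.eigenvalues i) := by
  rw [esd_eq hA, integral_smul_measure, integral_finsetSum_measure]
  · simp
  · intro i _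
    exact integrable_dirac (by simp)

lemma ofReal_integral_esd (hA : A.IsHermitian) (f : ℝ → ℝ) :
    ((∫ t, f t ∂(esd A) : ℝ) : ℂ) = ntr (hA.cfc f) := by
  rw [integral_esd hA, ntr, trace_cfc]
  push_cast
  rfl

lemma integral_esd_eq_re (hA : A.IsHermitian) (f : ℝ → ℝ) :
    ∫ t, f t ∂(esd A) = (ntr (hA.cfc f)).re := by
  rw [← ofReal_integral_esd, Complex.ofReal_re]

lemma abs_eigenvalues_le_norm (hA : A.IsHermitian) (i : Fin n) : |hA.eigenvalues i| ≤ ‖A‖ := by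
  have : Nonempty (Fin n) := ⟨i⟩
  have := spectrum.norm_le_norm_of_mem (hA.eigenvalues_mem_spectrum_real i)
  simpa using this

/-- Only the nonzero eigenvalues contribute to the trace; their number is the rank and each is
bounded by the norm. This makes perturbations of small relative rank invisible to normalized traces.
-/
lemma norm_trace_le_rank_mul_norm (hA : A.IsHermitian) : ‖A.trace‖ ≤ A.rank * ‖A‖ := by
  rw [hA.trace_eq_sum_eigenvalues, hA.rank_eq_card_non_zero_eigs]
  refine (norm_sum_le _ _).trans ?_
  rw [Fintype.card_subtype, ← nsmul_eq_mul, ← Finset.sum_const, Finset.sum_filter]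
  refine Finset.sum_le_sum fun i _ => ?_
  split_ifs with h
  · simpa using abs_eigenvalues_le_norm hA i
  · push Not at h; simp [h]

/-- The spectral averages of `f` at two Hermitian matrices differ by at most the relative rank of
the difference of the functional calculi. -/
lemma abs_integral_esd_sub_le (hA : A.IsHermitian) (hB : B.IsHermitian) {f : ℝ → ℝ} {c : ℝ}
    (hc : 0 ≤ c) (hf : ∀ x, |f x| ≤ c) :
    |∫ t, f t ∂(esd A) - ∫ t, f t ∂(esd B)| ≤
      2 * c * ((n : ℝ)⁻¹ * (hA.cfc f - hB.cfc f).rank) := by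
  have h1 : ((∫ t, f t ∂(esd A) - ∫ t, f t ∂(esd B) : ℝ) : ℂ) =
      (n : ℂ)⁻¹ * (hA.cfc f - hB.cfc f).trace := by
    push_cast
    rw [ofReal_integral_esd hA, ofReal_integral_esd hB, ← ntr_sub, ntr]
  have h2 := norm_trace_le_rank_mul_norm ((isHermitian_cfc hA f).sub (isHermitian_cfc hB f))
  have h3 : ‖hA.cfc f - hB.cfc f‖ ≤ 2 * c := by
    refine (norm_sub_le _ _).trans ?_
    linarith [norm_cfc_le hA hc hf, norm_cfc_le hB hc hf]
  rw [← Real.norm_eq_abs, ← Complex.norm_real, h1, norm_mul, norm_inv, Complex.norm_natCast]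
  calc (n : ℝ)⁻¹ * ‖(hA.cfc f - hB.cfc f).trace‖
      ≤ (n : ℝ)⁻¹ * ((hA.cfc f - hB.cfc f).rank * (2 * c)) := by
        gcongr
        exact h2.trans (by gcongr)
    _ = _ := by ring

end ESD

/-! ### The normalized Hilbert--Schmidt norm -/

/-- The square of the normalized Hilbert--Schmidt norm. -/
def hsq (A : Matrix (Fin n) (Fin n) ℂ) : ℝ := (n : ℝ)⁻¹ * ∑ i, ∑ j, ‖A i j‖ ^ 2

lemma hsq_nonneg (A : Matrix (Fin n) (Fin n) ℂ) : 0 ≤ hsq A := by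
  unfold hsq; positivity

lemma ofReal_hsq (A : Matrix (Fin n) (Fin n) ℂ) : (hsq A : ℂ) = ntr (A * A.conjTranspose) := by
  simp only [hsq, ntr, Matrix.trace, Matrix.diag, Matrix.mul_apply, Matrix.conjTranspose_apply]
  push_cast
  congr 1
  refine Finset.sum_congr rfl fun i _ => Finset.sum_congr rfl fun j _ => ?_
  rw [← Complex.mul_conj']; rfl

/-- Cauchy–Schwarz for the normalized Hilbert–Schmidt inner product. -/
lemma norm_ntr_mul_le (A B : Matrix (Fin n) (Fin n) ℂ) :
    ‖ntr (A * B)‖ ≤ √(hsq A) * √(hsq B) := by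
  rw [← Real.sqrt_mul (hsq_nonneg A)]
  apply Real.le_sqrt_of_sq_le
  rw [ntr, norm_mul, norm_inv, Complex.norm_natCast, mul_pow]
  have h1 : ‖(A * B).trace‖ ≤ ∑ x : Fin n × Fin n, ‖A x.1 x.2‖ * ‖B x.2 x.1‖ := by
    simp only [Matrix.trace, Matrix.diag, Matrix.mul_apply]
    rw [← Finset.sum_product']
    refine (norm_sum_le _ _).trans (le_of_eq ?_)
    simp
  have h2 := Finset.sum_mul_sq_le_sq_mul_sq Finset.univ
    (fun x : Fin n × Fin n => ‖A x.1 x.2‖) (fun x => ‖B x.2 x.1‖)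
  have h3 : ∑ x : Fin n × Fin n, ‖A x.1 x.2‖ ^ 2 = ∑ i, ∑ j, ‖A i j‖ ^ 2 := by
    rw [← Finset.univ_product_univ, Finset.sum_product]
  have h4 : ∑ x : Fin n × Fin n, ‖B x.2 x.1‖ ^ 2 = ∑ i, ∑ j, ‖B i j‖ ^ 2 := by
    rw [← Finset.univ_product_univ, Finset.sum_product_right]
  rw [h3, h4] at h2
  calc _ ≤ (n : ℝ)⁻¹ ^ 2 * ((∑ i, ∑ j, ‖A i j‖ ^ 2) * ∑ i, ∑ j, ‖B i j‖ ^ 2) := by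
        gcongr
        refine le_trans ?_ h2
        gcongr
    _ = _ := by unfold hsq; ring

lemma hsq_mul_le (V B : Matrix (Fin n) (Fin n) ℂ) : hsq (V * B) ≤ ‖V‖ ^ 2 * hsq B := by
  unfold hsq
  rw [mul_left_comm]
  gcongr (n : ℝ)⁻¹ * ?_
  rw [Finset.sum_comm, Finset.sum_comm (f := fun i j => ‖B i j‖ ^ 2), Finset.mul_sum]
  refine Finset.sum_le_sum fun j _ => ?_
  have h := Matrix.l2_opNorm_mulVec V (WithLp.toLp 2 (fun i => B i j))
  have h' := pow_le_pow_left₀ (norm_nonneg _) h 2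
  rw [mul_pow, EuclideanSpace.norm_sq_eq, EuclideanSpace.norm_sq_eq] at h'
  simpa [Matrix.mulVec, dotProduct, Matrix.mul_apply] using h'

/-- Translates mean square approximation in the spectral distribution into Hilbert–Schmidt
approximation of matrices. -/
lemma hsq_cfc {A : Matrix (Fin n) (Fin n) ℂ} (hA : A.IsHermitian) (f : ℝ → ℝ) :
    hsq (hA.cfc f) = ∫ t, f t ^ 2 ∂(esd A) := by
  have h : (hsq (hA.cfc f) : ℂ) = ((∫ t, f t ^ 2 ∂(esd A) : ℝ) : ℂ) := by
    rw [ofReal_hsq, (isHermitian_cfc hA f).eq, cfc_mul_cfc, ofReal_integral_esd hA]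
    simp [pow_two]
  exact_mod_cast h

/-! ### Rank estimates -/

lemma rank_add_le (A B : Matrix (Fin n) (Fin n) ℂ) : (A + B).rank ≤ A.rank + B.rank := by
  unfold Matrix.rank
  refine le_trans (Submodule.finrank_mono ?_)
    (Submodule.finrank_add_le_finrank_add_finrank A.mulVecLin.range B.mulVecLin.range)
  rintro _ ⟨v, rfl⟩
  rw [Matrix.mulVecLin_add]
  exact Submodule.add_mem_sup ⟨v, rfl⟩ ⟨v, rfl⟩

lemma rank_smul_le (c : ℂ) (A : Matrix (Fin n) (Fin n) ℂ) : (c • A).rank ≤ A.rank := by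
  rw [show c • A = (c • 1) * A by simp]
  exact Matrix.rank_mul_le_right _ _

lemma rank_sub_comm (A B : Matrix (Fin n) (Fin n) ℂ) : (A - B).rank = (B - A).rank := by
  have key : ∀ A B : Matrix (Fin n) (Fin n) ℂ, (A - B).rank ≤ (B - A).rank := fun A B => by
    rw [← neg_sub B A, ← neg_one_smul ℂ (B - A)]
    exact rank_smul_le _ _
  exact le_antisymm (key A B) (key B A)

lemma rank_mul_sub_mul_le (A A' B B' : Matrix (Fin n) (Fin n) ℂ) :
    (A * B - A' * B').rank ≤ (A - A').rank + (B - B').rank := by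
  have : A * B - A' * B' = (A - A') * B + A' * (B - B') := by noncomm_ring
  rw [this]
  refine (rank_add_le _ _).trans ?_
  gcongr
  · exact Matrix.rank_mul_le_left _ _
  · exact Matrix.rank_mul_le_right _ _

/-- Functions `f` for which `f(A) - f(B)` has rank at most a constant times that of `A - B`. -/
def RankLipschitz (f : ℝ → ℝ) : Prop :=
  ∃ C : ℕ, ∀ (n : ℕ) (A B : Matrix (Fin n) (Fin n) ℂ) (hA : A.IsHermitian) (hB : B.IsHermitian),
    (hA.cfc f - hB.cfc f).rank ≤ C * (A - B).rank

lemma RankLipschitz.const (c : ℝ) : RankLipschitz fun _ => c :=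
  ⟨0, fun n A B hA hB => by simp [cfc_const]⟩

lemma RankLipschitz.id : RankLipschitz fun x => x :=
  ⟨1, fun n A B hA hB => by simp [cfc_id']⟩

lemma RankLipschitz.add {f g : ℝ → ℝ} (hf : RankLipschitz f) (hg : RankLipschitz g) :
    RankLipschitz fun x => f x + g x := by
  obtain ⟨C, hC⟩ := hf
  obtain ⟨D, hD⟩ := hg
  refine ⟨C + D, fun n A B hA hB => ?_⟩
  rw [← cfc_add_cfc, ← cfc_add_cfc, add_sub_add_comm, add_mul]
  exact (rank_add_le _ _).trans (add_le_add (hC ..) (hD ..))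

lemma RankLipschitz.mul {f g : ℝ → ℝ} (hf : RankLipschitz f) (hg : RankLipschitz g) :
    RankLipschitz fun x => f x * g x := by
  obtain ⟨C, hC⟩ := hf
  obtain ⟨D, hD⟩ := hg
  refine ⟨C + D, fun n A B hA hB => ?_⟩
  rw [← cfc_mul_cfc, ← cfc_mul_cfc, add_mul]
  exact (rank_mul_sub_mul_le _ _ _ _).trans (add_le_add (hC ..) (hD ..))

/-- The resolvent identity `A⁻¹ - B⁻¹ = A⁻¹ (B - A) B⁻¹`. Together with sums and products it makes
rational functions without real poles available as test functions. -/
lemma RankLipschitz.inv {f : ℝ → ℝ} (hf : RankLipschitz f) (h0 : ∀ x, f x ≠ 0) :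
    RankLipschitz fun x => (f x)⁻¹ := by
  obtain ⟨C, hC⟩ := hf
  refine ⟨C, fun n A B hA hB => ?_⟩
  have key : ∀ {A : Matrix (Fin n) (Fin n) ℂ} (hA : A.IsHermitian),
      hA.cfc (fun x => (f x)⁻¹) * hA.cfc f = 1 ∧ hA.cfc f * hA.cfc (fun x => (f x)⁻¹) = 1 := by
    intro A hA
    simp [cfc_mul_cfc, h0, cfc_one']
  have : hA.cfc (fun x => (f x)⁻¹) - hB.cfc (fun x => (f x)⁻¹) =
      hA.cfc (fun x => (f x)⁻¹) * (hB.cfc f - hA.cfc f) * hB.cfc (fun x => (f x)⁻¹) := by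
    rw [mul_sub, sub_mul, mul_assoc, (key hB).2, (key hA).1, mul_one, one_mul]
  rw [this]
  refine (Matrix.rank_mul_le_left _ _).trans ((Matrix.rank_mul_le_right _ _).trans ?_)
  rw [rank_sub_comm A B]
  exact hC n B A hB hA

/-! ### Noncommutative polynomials -/

lemma evalPoly_ι {A : Type*} [Ring A] [Algebra ℂ A] [Star A] (a : Fin m → A) (l : Fin m × Bool) :
    evalPoly a (FreeAlgebra.ι ℂ l) = starPow (a l.1) l.2 := by
  simp [evalPoly]

/-- Unlike a norm estimate, the rank estimate has a constant independent of the dimension and of the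
size of the matrices, so it applies to the unbounded tuple. -/
lemma exists_rank_evalPoly_sub_le (Q : FreeAlgebra ℂ (Fin m × Bool)) :
    ∃ C : ℕ, ∀ (n : ℕ) (X Y : Fin m → Matrix (Fin n) (Fin n) ℂ),
      (evalPoly X Q - evalPoly Y Q).rank ≤ C * ∑ i, (X i - Y i).rank := by
  induction Q using FreeAlgebra.induction with
  | grade0 r => exact ⟨0, fun n X Y => by simp⟩
  | grade1 l =>
    refine ⟨1, fun n X Y => ?_⟩
    have h1 : (X l.1 - Y l.1).rank ≤ ∑ i, (X i - Y i).rank :=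
      Finset.single_le_sum (f := fun i => (X i - Y i).rank) (fun _ _ => Nat.zero_le _)
        (Finset.mem_univ l.1)
    rw [evalPoly_ι, evalPoly_ι, one_mul]
    refine le_trans (le_of_eq ?_) h1
    cases l.2
    · simp [starPow]
    · simp only [starPow, if_true, ← star_sub]
      rw [Matrix.star_eq_conjTranspose, Matrix.rank_conjTranspose]
  | mul a b ha hb =>
    obtain ⟨C, hC⟩ := ha
    obtain ⟨D, hD⟩ := hb
    refine ⟨C + D, fun n X Y => ?_⟩
    rw [map_mul, map_mul, add_mul]
    exact (rank_mul_sub_mul_le _ _ _ _).trans (add_le_add (hC ..) (hD ..))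
  | add a b ha hb =>
    obtain ⟨C, hC⟩ := ha
    obtain ⟨D, hD⟩ := hb
    refine ⟨C + D, fun n X Y => ?_⟩
    rw [map_add, map_add, add_mul, add_sub_add_comm]
    exact (rank_add_le _ _).trans (add_le_add (hC ..) (hD ..))

lemma exists_norm_evalPoly_le (Q : FreeAlgebra ℂ (Fin m × Bool)) (L : ℝ) :
    ∃ C : ℝ, 0 ≤ C ∧ ∀ (n : ℕ) (X : Fin m → Matrix (Fin n) (Fin n) ℂ), (∀ i, ‖X i‖ ≤ L) →
      ‖evalPoly X Q‖ ≤ C := by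
  induction Q using FreeAlgebra.induction with
  | grade0 r =>
    refine ⟨‖r‖, norm_nonneg _, fun n X _ => ?_⟩
    rw [AlgHom.commutes, Algebra.algebraMap_eq_smul_one]
    refine (norm_smul_le _ _).trans ?_
    refine mul_le_of_le_one_right (norm_nonneg _) ?_
    rw [← Matrix.diagonal_one, Matrix.l2_opNorm_diagonal, pi_norm_le_iff_of_nonneg zero_le_one]
    simp
  | grade1 l =>
    refine ⟨max L 0, le_max_right _ _, fun n X hX => ?_⟩
    rw [evalPoly_ι]
    refine le_trans (le_of_eq ?_) ((hX l.1).trans (le_max_left _ _))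
    cases l.2
    · simp [starPow]
    · simp [starPow]
  | mul a b ha hb =>
    obtain ⟨C, hC0, hC⟩ := ha
    obtain ⟨D, hD0, hD⟩ := hb
    refine ⟨C * D, by positivity, fun n X hX => ?_⟩
    rw [map_mul]
    exact (norm_mul_le _ _).trans (mul_le_mul (hC n X hX) (hD n X hX) (norm_nonneg _) hC0)
  | add a b ha hb =>
    obtain ⟨C, hC0, hC⟩ := ha
    obtain ⟨D, hD0, hD⟩ := hb
    refine ⟨C + D, by positivity, fun n X hX => ?_⟩
    rw [map_add]
    exact (norm_add_le _ _).trans (add_le_add (hC n X hX) (hD n X hX))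

/-- The word `a_{w_1} ⋯ a_{w_p}`. -/
def word {A : Type*} [Monoid A] (a : Fin m → A) (w : List (Fin m)) : A := (w.map a).prod

lemma word_append {A : Type*} [Monoid A] (a : Fin m → A) (u w : List (Fin m)) :
    word a (u ++ w) = word a u * word a w := by
  simp [word]

lemma word_cons {A : Type*} [Monoid A] (a : Fin m → A) (i : Fin m) (w : List (Fin m)) :
    word a (i :: w) = a i * word a w := by
  simp [word]

lemma word_replicate {A : Type*} [Monoid A] (a : Fin m → A) (i : Fin m) (k : ℕ) :
    word a (List.replicate k i) = a i ^ k := by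
  simp [word]

lemma star_word {A : Type*} [Monoid A] [StarMul A] (a : Fin m → A) (ha : ∀ i, star (a i) = a i)
    (w : List (Fin m)) : star (word a w) = word a w.reverse := by
  induction w with
  | nil => simp [word]
  | cons i w ih => rw [List.reverse_cons, word_append, ← ih, word_cons, star_mul, ha]; simp [word]

/-- On self-adjoint tuples every noncommutative polynomial is a fixed linear combination of
words. -/
lemma exists_evalPoly_eq_sum_word (Q : FreeAlgebra ℂ (Fin m × Bool)) :
    ∃ c : List (ℂ × List (Fin m)), ∀ {A : Type} [Ring A] [Algebra ℂ A] [Star A] (a : Fin m → A),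
      (∀ i, star (a i) = a i) →
      evalPoly a Q = (c.map fun x => x.1 • word a x.2).sum := by
  induction Q using FreeAlgebra.induction with
  | grade0 r =>
    exact ⟨[(r, [])], fun a _ => by simp [word, Algebra.algebraMap_eq_smul_one]⟩
  | grade1 l =>
    refine ⟨[(1, [l.1])], fun a ha => ?_⟩
    rw [evalPoly_ι]
    cases l.2 <;> simp [starPow, word, ha]
  | mul a b ha hb =>
    obtain ⟨c, hc⟩ := ha
    obtain ⟨d, hd⟩ := hb
    refine ⟨c.flatMap fun x => d.map fun y => (x.1 * y.1, x.2 ++ y.2), fun a ha => ?_⟩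
    rw [map_mul, hc a ha, hd a ha]
    clear hc hd
    induction c with
    | nil => simp
    | cons x c ih =>
      simp only [List.map_cons, List.sum_cons, add_mul, ih, List.flatMap_cons, List.map_append,
        List.sum_append, List.map_map]
      congr 1
      rw [← List.sum_map_mul_left]
      congr 1
      refine List.map_congr_left fun y _ => ?_
      simp [word_append, mul_smul, smul_comm x.1 y.1]
  | add a b ha hb =>
    obtain ⟨c, hc⟩ := ha
    obtain ⟨d, hd⟩ := hb
    exact ⟨c ++ d, fun a ha => by rw [map_add, hc a ha, hd a ha]; simp⟩

/-- The formal adjoint of a polynomial, on self-adjoint tuples. -/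
lemma exists_star_evalPoly_eq (Q : FreeAlgebra ℂ (Fin m × Bool)) :
    ∃ Q' : FreeAlgebra ℂ (Fin m × Bool), ∀ {A : Type} [Ring A] [StarRing A] [Algebra ℂ A]
      [StarModule ℂ A] (a : Fin m → A), star (evalPoly a Q) = evalPoly a Q' := by
  induction Q using FreeAlgebra.induction with
  | grade0 r =>
    refine ⟨algebraMap ℂ _ (star r), fun a => ?_⟩
    rw [AlgHom.commutes, AlgHom.commutes, algebraMap_star_comm]
  | grade1 l =>
    refine ⟨FreeAlgebra.ι ℂ (l.1, !l.2), fun a => ?_⟩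
    rw [evalPoly_ι, evalPoly_ι]
    cases l.2 <;> simp [starPow]
  | mul a b ha hb =>
    obtain ⟨c, hc⟩ := ha
    obtain ⟨d, hd⟩ := hb
    exact ⟨d * c, fun a => by rw [map_mul, star_mul, hc, hd, map_mul]⟩
  | add a b ha hb =>
    obtain ⟨c, hc⟩ := ha
    obtain ⟨d, hd⟩ := hb
    exact ⟨c + d, fun a => by rw [map_add, star_add, hc, hd, map_add]⟩

end

/-! ### From convergent word moments to convergent spectral averages of polynomials. -/

section

open scoped Matrix.Norms.L2Operator Nat

/-! ### Convergence along a filter -/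

section Conv

variable {ι : Type*} {l : Filter ι}

/-- `g` has a limit along `l`. -/
def Conv (l : Filter ι) (g : ι → ℂ) : Prop := ∃ c, Tendsto g l (𝓝 c)

lemma Conv.add {g h : ι → ℂ} (hg : Conv l g) (hh : Conv l h) : Conv l fun i => g i + h i := by
  obtain ⟨c, hc⟩ := hg
  obtain ⟨d, hd⟩ := hh
  exact ⟨c + d, hc.add hd⟩

lemma Conv.const_mul {g : ι → ℂ} (a : ℂ) (hg : Conv l g) : Conv l fun i => a * g i := by
  obtain ⟨c, hc⟩ := hg
  exact ⟨a * c, hc.const_mul a⟩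

lemma Conv.const (a : ℂ) : Conv l fun _ => a := ⟨a, tendsto_const_nhds⟩

lemma Conv.sum {κ : Type*} (s : Finset κ) {g : κ → ι → ℂ} (hg : ∀ k ∈ s, Conv l (g k)) :
    Conv l fun i => ∑ k ∈ s, g k i := by
  choose! c hc using hg
  exact ⟨∑ k ∈ s, c k, tendsto_finsetSum s fun k hk => hc k hk⟩

/-- Completeness of `ℂ`: the image filter is Cauchy. Limits can thus be shown to exist without being
identified. -/
lemma Conv.of_approx {g : ι → ℂ}
    (h : ∀ ε > 0, ∃ g' : ι → ℂ, Conv l g' ∧ ∀ᶠ i in l, ‖g i - g' i‖ ≤ ε) : Conv l g := by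
  rcases eq_or_neBot l with rfl | _
  · exact ⟨0, tendsto_bot⟩
  have : Cauchy (map g l) := by
    rw [Metric.cauchy_iff]
    refine ⟨inferInstance, fun ε hε => ?_⟩
    obtain ⟨g', ⟨c, hc⟩, hg'⟩ := h (ε / 8) (by positivity)
    have h1 : ∀ᶠ i in l, dist (g i) c < ε / 4 := by
      filter_upwards [hg', Metric.tendsto_nhds.1 hc (ε / 8) (by positivity)] with i h1 h2
      have := dist_triangle (g i) (g' i) c
      rw [dist_eq_norm (g i) (g' i)] at this
      linarith
    refine ⟨Metric.ball c (ε / 4), h1, fun x hx y hy => ?_⟩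
    have := dist_triangle_right x y c
    rw [Metric.mem_ball] at hx hy
    linarith
  exact cauchy_iff_exists_le_nhds.1 this

end Conv

/-! ### A Taylor estimate -/

lemma norm_exp_mul_I_sub_sum_le_of_nonneg (N : ℕ) {y : ℝ} (hy : 0 ≤ y) :
    ‖Complex.exp (y * Complex.I) - ∑ k ∈ Finset.range N, ((y : ℂ) * Complex.I) ^ k / (k ! : ℂ)‖ ≤
      y ^ N / N ! := by
  induction N generalizing y with
  | zero => simp [Complex.norm_exp_ofReal_mul_I]
  | succ N ih =>
    -- The derivative of the Taylor remainder of order `N + 1` is `I` times that of order `N`, so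
    -- the bound follows by integrating the induction hypothesis from `0`, where the remainder
    -- vanishes.
    have hder : ∀ x : ℝ, HasDerivAt (fun x : ℝ => Complex.exp (x * Complex.I) -
        ∑ k ∈ Finset.range (N + 1), ((x : ℂ) * Complex.I) ^ k / k !)
        (Complex.I * (Complex.exp (x * Complex.I) -
          ∑ k ∈ Finset.range N, ((x : ℂ) * Complex.I) ^ k / k !)) x := by
      intro x
      have h0 : HasDerivAt (fun x : ℝ => (x : ℂ) * Complex.I) Complex.I x := by
        simpa using (Complex.ofRealCLM.hasDerivAt (x := x)).mul_const Complex.I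
      have h1 := h0.cexp
      have h2 : HasDerivAt (fun x : ℝ => ∑ k ∈ Finset.range (N + 1),
          ((x : ℂ) * Complex.I) ^ k / k !)
          (Complex.I * ∑ k ∈ Finset.range N, ((x : ℂ) * Complex.I) ^ k / k !) x := by
        have : ∀ k ∈ Finset.range (N + 1), HasDerivAt (fun x : ℝ => ((x : ℂ) * Complex.I) ^ k / k !)
          ((k * ((x : ℂ) * Complex.I) ^ (k - 1) * Complex.I) / k !) x := fun k _ =>
            (h0.pow k).div_const _
        refine (HasDerivAt.fun_sum this).congr_deriv ?_
        symm
        rw [Finset.sum_range_succ', Finset.mul_sum]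
        simp only [Nat.add_sub_cancel, Nat.cast_zero, zero_mul, zero_div, add_zero]
        refine Finset.sum_congr rfl fun k _ => ?_
        rw [Nat.factorial_succ]
        push_cast
        have : (k : ℂ) + 1 ≠ 0 := by exact_mod_cast Nat.succ_ne_zero k
        have : (k ! : ℂ) ≠ 0 := by exact_mod_cast Nat.factorial_ne_zero k
        field_simp
      exact (h1.sub h2).congr_deriv (by ring)
    have hint : (∫ x in (0 : ℝ)..y, Complex.I * (Complex.exp (x * Complex.I) -
          ∑ k ∈ Finset.range N, ((x : ℂ) * Complex.I) ^ k / k !)) =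
        Complex.exp (y * Complex.I) -
          ∑ k ∈ Finset.range (N + 1), ((y : ℂ) * Complex.I) ^ k / k ! := by
      rw [intervalIntegral.integral_eq_sub_of_hasDerivAt (fun x _ => hder x)
        (Continuous.intervalIntegrable (by fun_prop) _ _)]
      simp [Finset.sum_range_succ']
    rw [← hint]
    have hb : ∀ x ∈ Set.Ioc (0 : ℝ) y, ‖Complex.I * (Complex.exp (x * Complex.I) -
        ∑ k ∈ Finset.range N, ((x : ℂ) * Complex.I) ^ k / (k ! : ℂ))‖ ≤ x ^ N / N ! := by
      intro x hx
      rw [norm_mul, Complex.norm_I, one_mul]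
      exact ih hx.1.le
    refine (intervalIntegral.norm_integral_le_of_norm_le hy (ae_of_all _ hb)
      (Continuous.intervalIntegrable (by fun_prop) _ _)).trans (le_of_eq ?_)
    rw [intervalIntegral.integral_div, integral_pow, Nat.factorial_succ]
    push_cast
    field_simp
    simp

lemma norm_exp_mul_I_sub_sum_le (N : ℕ) (y : ℝ) :
    ‖Complex.exp (y * Complex.I) - ∑ k ∈ Finset.range N, ((y : ℂ) * Complex.I) ^ k / (k ! : ℂ)‖ ≤
      |y| ^ N / N ! := by
  rcases le_total 0 y with hy | hy
  · rw [abs_of_nonneg hy]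
    exact norm_exp_mul_I_sub_sum_le_of_nonneg N hy
  · rw [abs_of_nonpos hy]
    refine le_trans (le_of_eq ?_)
      (norm_exp_mul_I_sub_sum_le_of_nonneg N (y := -y) (by linarith))
    rw [← Complex.norm_conj]
    congr 1
    simp [← Complex.exp_conj]

/-- Polynomial approximation of `cos (a t + b)`. -/
lemma exists_polynomial_cos_sub_le (a b : ℝ) (N : ℕ) :
    ∃ q : Polynomial ℝ, ∀ t : ℝ, |Real.cos (a * t + b) - q.eval t| ≤ |a * t| ^ N / N ! := by
  refine ⟨∑ k ∈ Finset.range N, Polynomial.C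
    ((Complex.exp (b * Complex.I) * Complex.I ^ k / k !).re * a ^ k) * Polynomial.X ^ k,
    fun t => ?_⟩
  have h1 : Real.cos (a * t + b) =
      (Complex.exp (b * Complex.I) * Complex.exp ((a * t : ℝ) * Complex.I)).re := by
    rw [← Complex.exp_add, ← add_mul, ← Complex.ofReal_add, add_comm,
      Complex.exp_ofReal_mul_I_re]
  have h2 : Polynomial.eval t (∑ k ∈ Finset.range N, Polynomial.C
      ((Complex.exp (b * Complex.I) * Complex.I ^ k / k !).re * a ^ k) * Polynomial.X ^ k) =
      (Complex.exp (b * Complex.I) *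
        ∑ k ∈ Finset.range N, (((a * t : ℝ) : ℂ) * Complex.I) ^ k / k !).re := by
    rw [Polynomial.eval_finsetSum, Finset.mul_sum, Complex.re_sum]
    refine Finset.sum_congr rfl fun k _ => ?_
    simp only [Polynomial.eval_mul, Polynomial.eval_C, Polynomial.eval_pow, Polynomial.eval_X]
    rw [mul_assoc, ← mul_pow, ← Complex.re_mul_ofReal]
    congr 1
    push_cast
    ring
  rw [h1, h2, ← Complex.sub_re, ← mul_sub]
  refine (Complex.abs_re_le_norm _).trans ?_
  rw [norm_mul, Complex.norm_exp_ofReal_mul_I, one_mul]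
  exact norm_exp_mul_I_sub_sum_le N _

/-! ### The triangle wave -/

/-- The triangle wave of amplitude `L`, which is the identity on `[-L, L]`. -/
def triangleWave (L t : ℝ) : ℝ :=
  2 * L / Real.pi * Real.arcsin (Real.sin (Real.pi / (2 * L) * t))

lemma abs_triangleWave_le {L : ℝ} (hL : 0 < L) (t : ℝ) : |triangleWave L t| ≤ L := by
  have h := abs_le.2 ⟨(by linarith [Real.neg_pi_div_two_le_arcsin (Real.sin (Real.pi / (2 * L) * t))]),
    Real.arcsin_le_pi_div_two (Real.sin (Real.pi / (2 * L) * t))⟩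
  have hpi := Real.pi_pos
  rw [triangleWave, abs_mul, abs_of_pos (by positivity)]
  calc _ ≤ 2 * L / Real.pi * (Real.pi / 2) := by gcongr
    _ = L := by field_simp

lemma triangleWave_eq {L t : ℝ} (hL : 0 < L) (ht : |t| ≤ L) : triangleWave L t = t := by
  have hpi := Real.pi_pos
  obtain ⟨h1, h2⟩ := abs_le.1 ht
  rw [triangleWave, Real.arcsin_sin]
  · field_simp
  · rw [div_mul_eq_mul_div, le_div_iff₀ (by positivity)]
    nlinarith
  · rw [div_mul_eq_mul_div, div_le_iff₀ (by positivity)]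
    nlinarith

/-! ### Polynomial approximation in the limit spectral distributions -/

section Deterministic

variable {m : ℕ} {ι : Type*} {l : Filter ι} {d : ι → ℕ}
  {X : (i : ι) → Fin m → Matrix (Fin (d i)) (Fin (d i)) ℂ} {β : List (Fin m) → ℂ}

lemma integral_esd_mono {n : ℕ} {A : Matrix (Fin n) (Fin n) ℂ} (hA : A.IsHermitian)
    {f g : ℝ → ℝ} (h : ∀ t, f t ≤ g t) : ∫ t, f t ∂(esd A) ≤ ∫ t, g t ∂(esd A) :=
  integral_mono (integrable_esd hA f) (integrable_esd hA g) h

lemma integral_esd_const_le {n : ℕ} {A : Matrix (Fin n) (Fin n) ℂ} (hA : A.IsHermitian)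
    {c : ℝ} (hc : 0 ≤ c) : ∫ _, c ∂(esd A) ≤ c := by
  rw [integral_esd hA]
  rcases eq_or_ne n 0 with rfl | hn
  · simpa
  · simp [hn]

/-- `h` can be approximated by polynomials, in mean square with respect to the spectral
distributions of the matrices `X i k`, eventually along `l`. -/
def PolyApprox (l : Filter ι) (X : (i : ι) → Fin m → Matrix (Fin (d i)) (Fin (d i)) ℂ)
    (k : Fin m) (h : ℝ → ℝ) : Prop :=
  ∀ ε > 0, ∃ q : Polynomial ℝ, ∀ᶠ i in l, ∫ t, (h t - q.eval t) ^ 2 ∂(esd (X i k)) ≤ ε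

lemma PolyApprox.add (hX : ∀ i k, (X i k).IsHermitian) {k : Fin m} {f g : ℝ → ℝ}
    (hf : PolyApprox l X k f) (hg : PolyApprox l X k g) :
    PolyApprox l X k fun t => f t + g t := by
  intro ε hε
  obtain ⟨p, hp⟩ := hf (ε / 4) (by positivity)
  obtain ⟨q, hq⟩ := hg (ε / 4) (by positivity)
  refine ⟨p + q, ?_⟩
  filter_upwards [hp, hq] with i h1 h2
  calc _ ≤ ∫ t, (2 * (f t - p.eval t) ^ 2 + 2 * (g t - q.eval t) ^ 2) ∂(esd (X i k)) := by
        refine integral_esd_mono (hX i k) fun t => ?_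
        rw [Polynomial.eval_add]
        nlinarith [sq_nonneg ((f t - p.eval t) - (g t - q.eval t))]
    _ ≤ ε := by
        rw [integral_add (integrable_esd (hX i k) _) (integrable_esd (hX i k) _),
          integral_const_mul, integral_const_mul]
        linarith

lemma PolyApprox.const_mul {k : Fin m} {f : ℝ → ℝ} (c : ℝ) (hf : PolyApprox l X k f) :
    PolyApprox l X k fun t => c * f t := by
  intro ε hε
  obtain ⟨p, hp⟩ := hf (ε / (c ^ 2 + 1)) (by positivity)
  refine ⟨Polynomial.C c * p, ?_⟩
  filter_upwards [hp] with i h1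
  have : ∀ t, (c * f t - (Polynomial.C c * p).eval t) ^ 2 = c ^ 2 * (f t - p.eval t) ^ 2 := by
    intro t; simp; ring
  simp only [this]
  rw [integral_const_mul]
  calc _ ≤ c ^ 2 * (ε / (c ^ 2 + 1)) := by gcongr
    _ ≤ ε := by
      rw [mul_div_assoc', div_le_iff₀ (by positivity)]
      nlinarith

lemma PolyApprox.of_uniform (hX : ∀ i k, (X i k).IsHermitian) {k : Fin m} {f : ℝ → ℝ}
    (h : ∀ ε > 0, ∃ g, PolyApprox l X k g ∧ ∀ t, |f t - g t| ≤ ε) : PolyApprox l X k f := by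
  intro ε hε
  obtain ⟨g, hg, hfg⟩ := h (√(ε / 4)) (by positivity)
  obtain ⟨q, hq⟩ := hg (ε / 4) (by positivity)
  refine ⟨q, ?_⟩
  filter_upwards [hq] with i h2
  calc _ ≤ ∫ t, (ε / 2 + 2 * (g t - q.eval t) ^ 2) ∂(esd (X i k)) := by
        refine integral_esd_mono (hX i k) fun t => ?_
        have h1 : (f t - g t) ^ 2 ≤ ε / 4 := by
          rw [← sq_abs]
          calc _ ≤ √(ε / 4) ^ 2 := by gcongr; exact hfg t
            _ = ε / 4 := Real.sq_sqrt (by positivity)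
        nlinarith [sq_nonneg ((f t - g t) - (g t - q.eval t))]
    _ ≤ ε := by
        rw [integral_add (integrable_esd (hX i k) _) (integrable_esd (hX i k) _),
          integral_const_mul]
        linarith [integral_esd_const_le (hX i k) (c := ε / 2) (by positivity)]

lemma ofReal_integral_pow_esd (hX : ∀ i k, (X i k).IsHermitian) (i : ι) (k : Fin m) (N : ℕ) :
    ((∫ t, t ^ N ∂(esd (X i k)) : ℝ) : ℂ) = ntr (word (X i) (List.replicate N k)) := by
  rw [ofReal_integral_esd (hX i k), cfc_pow', word_replicate]

/-- The squared Taylor error is at most `(a t) ^ (2 N) / (N !) ^ 2`, and its spectral integral is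
controlled by the moment of order `2 N`. The growth hypothesis `hβ` is exactly what makes this small
for some `N`. -/
lemma polyApprox_cos (hX : ∀ i k, (X i k).IsHermitian)
    (hconv : ∀ w, Tendsto (fun i => ntr (word (X i) w)) l (𝓝 (β w)))
    (hβ : ∀ k (s : ℝ), Tendsto (fun N : ℕ => s ^ N / (N ! : ℝ) ^ 2 *
      ‖β (List.replicate (2 * N) k)‖) atTop (𝓝 0)) (k : Fin m) (a b : ℝ) :
    PolyApprox l X k fun t => Real.cos (a * t + b) := by
  intro ε hε
  have h1 : Tendsto (fun N : ℕ => (a ^ 2) ^ N / (N ! : ℝ) ^ 2 *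
      (‖β (List.replicate (2 * N) k)‖ + 1)) atTop (𝓝 0) := by
    have h2 : Tendsto (fun N : ℕ => (a ^ 2) ^ N / (N ! : ℝ) ^ 2) atTop (𝓝 0) := by
      refine squeeze_zero (fun N => by positivity) (fun N => ?_)
        (FloorSemiring.tendsto_pow_div_factorial_atTop (a ^ 2))
      have : (1 : ℝ) ≤ N ! := by exact_mod_cast Nat.factorial_pos N
      gcongr
      nlinarith
    simpa [mul_add] using (hβ k (a ^ 2)).add h2
  obtain ⟨N, hN⟩ := (h1.eventually (gt_mem_nhds hε)).exists
  obtain ⟨q, hq⟩ := exists_polynomial_cos_sub_le a b N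
  refine ⟨q, ?_⟩
  have h3 : ∀ᶠ i in l, ‖ntr (word (X i) (List.replicate (2 * N) k))‖ <
      ‖β (List.replicate (2 * N) k)‖ + 1 :=
    (hconv _).norm.eventually (gt_mem_nhds (by linarith))
  filter_upwards [h3] with i hi
  calc _ ≤ ∫ t, (a ^ 2) ^ N / (N ! : ℝ) ^ 2 * t ^ (2 * N) ∂(esd (X i k)) := by
        refine integral_esd_mono (hX i k) fun t => ?_
        rw [← sq_abs]
        calc _ ≤ (|a * t| ^ N / N !) ^ 2 := by gcongr; exact hq t
          _ = _ := by
            rw [div_pow, ← pow_mul, mul_comm N 2, pow_mul, sq_abs, mul_pow, mul_pow, pow_mul]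
            ring
    _ ≤ (a ^ 2) ^ N / (N ! : ℝ) ^ 2 * (‖β (List.replicate (2 * N) k)‖ + 1) := by
        rw [integral_const_mul]
        gcongr
        refine le_trans (le_abs_self _) ?_
        rw [← Real.norm_eq_abs, ← Complex.norm_real, ofReal_integral_pow_esd hX]
        exact hi.le
    _ ≤ ε := hN.le

/-- The product-to-sum formula, with phase shifts by `π / 2`, linearizes powers of the sine into
cosines of arbitrary frequency and phase. -/
lemma polyApprox_sin_pow_mul_cos (hX : ∀ i k, (X i k).IsHermitian) {k : Fin m}
    (hcos : ∀ a b : ℝ, PolyApprox l X k fun t => Real.cos (a * t + b)) (s : ℝ) (j : ℕ) (a b : ℝ) :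
    PolyApprox l X k fun t => Real.sin (s * t) ^ j * Real.cos (a * t + b) := by
  induction j generalizing a b with
  | zero => simpa using hcos a b
  | succ j ih =>
    have := ((ih (s + a) (b - Real.pi / 2)).const_mul (1 / 2)).add hX
      ((ih (s - a) (-b - Real.pi / 2)).const_mul (1 / 2))
    refine (iff_of_eq (congrArg _ (funext fun t => ?_))).1 this
    have h1 : Real.cos ((s + a) * t + (b - Real.pi / 2)) = Real.sin (s * t + (a * t + b)) := by
      rw [← Real.cos_sub_pi_div_two]; ring_nf
    have h2 : Real.cos ((s - a) * t + (-b - Real.pi / 2)) = Real.sin (s * t - (a * t + b)) := by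
      rw [← Real.cos_sub_pi_div_two]; ring_nf
    rw [h1, h2, Real.sin_add, Real.sin_sub]
    ring

/-- The triangle wave is a continuous function of a sine, hence by Weierstrass a uniform limit of
polynomials in that sine. This is why the truncation is periodic rather than a cut-off. -/
lemma polyApprox_triangleWave (hX : ∀ i k, (X i k).IsHermitian) {k : Fin m}
    (hcos : ∀ a b : ℝ, PolyApprox l X k fun t => Real.cos (a * t + b)) (L : ℝ) :
    PolyApprox l X k (triangleWave L) := by
  refine PolyApprox.const_mul (f := fun t => Real.arcsin (Real.sin (Real.pi / (2 * L) * t))) _ ?_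
  refine PolyApprox.of_uniform hX fun ε hε => ?_
  obtain ⟨p, hp⟩ := exists_polynomial_near_of_continuousOn (-1) 1 Real.arcsin
    Real.continuous_arcsin.continuousOn ε hε
  refine ⟨fun t => p.eval (Real.sin (Real.pi / (2 * L) * t)), ?_, fun t => ?_⟩
  · have hpow : ∀ j, PolyApprox l X k fun t => Real.sin (Real.pi / (2 * L) * t) ^ j := by
      intro j
      simpa using polyApprox_sin_pow_mul_cos hX hcos (Real.pi / (2 * L)) j 0 0
    clear hp
    induction p using Polynomial.induction_on' with
    | add p q hp hq => simpa using hp.add hX hq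
    | monomial j c => simpa using (hpow j).const_mul c
  · rw [abs_sub_comm]
    exact (hp _ ⟨Real.neg_one_le_sin _, Real.sin_le_one _⟩).le

/-- The functional calculus of a polynomial. -/
lemma cfc_eval {n : ℕ} {A : Matrix (Fin n) (Fin n) ℂ} (hA : A.IsHermitian) (q : Polynomial ℝ) :
    hA.cfc (fun t => q.eval t) = ∑ j ∈ Finset.range (q.natDegree + 1), (q.coeff j : ℂ) • A ^ j := by
  simp only [Polynomial.eval_eq_sum_range, ← cfc_sum, ← smul_cfc, cfc_pow']

lemma norm_word_le {n : ℕ} {Y : Fin m → Matrix (Fin n) (Fin n) ℂ} {L : ℝ} (hL : 0 ≤ L)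
    (hY : ∀ k, ‖Y k‖ ≤ L) (w : List (Fin m)) : ‖word Y w‖ ≤ L ^ w.length := by
  induction w with
  | nil =>
    simp only [word, List.map_nil, List.prod_nil, List.length_nil, pow_zero]
    rw [← Matrix.diagonal_one, Matrix.l2_opNorm_diagonal, pi_norm_le_iff_of_nonneg zero_le_one]
    simp
  | cons k w ih =>
    rw [word_cons, List.length_cons, pow_succ']
    exact (norm_mul_le _ _).trans (mul_le_mul (hY k) ih (norm_nonneg _) hL)

/-- Truncated letters are replaced one at a time, each by a polynomial in the untruncated matrix;
the resulting powers join the prefix `u`, so the induction must be over all prefixes. -/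
lemma conv_ntr_word_mul_word (hX : ∀ i k, (X i k).IsHermitian)
    (hconv : ∀ w, Tendsto (fun i => ntr (word (X i) w)) l (𝓝 (β w)))
    {h : ℝ → ℝ} {L : ℝ} (hL : 0 ≤ L) (hh : ∀ t, |h t| ≤ L) (happ : ∀ k, PolyApprox l X k h)
    (u w : List (Fin m)) :
    Conv l fun i => ntr (word (X i) u * word (fun k => (hX i k).cfc h) w) := by
  induction w generalizing u with
  | nil => exact ⟨β u, by simpa [word] using hconv u⟩
  | cons k w ih =>
    refine Conv.of_approx fun ε hε => ?_
    -- `K` bounds the Hilbert–Schmidt square of the cofactor of the replaced letter: the truncated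
    -- part has norm at most `L ^ w.length`, and that of the prefix is the moment of `u` followed by
    -- its reverse.
    set K : ℝ := (L ^ w.length) ^ 2 * (‖β (u ++ u.reverse)‖ + 1) with hK
    have hK0 : 0 ≤ K := by positivity
    have hhs : ∀ᶠ i in l, hsq (word (fun k => (hX i k).cfc h) w * word (X i) u) ≤ K := by
      have h3 : ∀ᶠ i in l, ‖ntr (word (X i) (u ++ u.reverse))‖ < ‖β (u ++ u.reverse)‖ + 1 :=
        (hconv _).norm.eventually (gt_mem_nhds (by linarith))
      filter_upwards [h3] with i hi
      refine (hsq_mul_le _ _).trans ?_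
      have h1 : ‖word (fun k => (hX i k).cfc h) w‖ ≤ L ^ w.length :=
        norm_word_le hL (fun k => norm_cfc_le (hX i k) hL hh) w
      have h2 : hsq (word (X i) u) ≤ ‖β (u ++ u.reverse)‖ + 1 := by
        refine le_trans (le_abs_self _) ?_
        rw [← Real.norm_eq_abs, ← Complex.norm_real, ofReal_hsq, ← Matrix.star_eq_conjTranspose,
          star_word _ (fun k => hX i k), ← word_append]
        exact hi.le
      rw [hK]
      gcongr
      exact hsq_nonneg _
    obtain ⟨q, hq⟩ := happ k (ε ^ 2 / (K + 1)) (by positivity)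
    refine ⟨fun i => ntr (word (X i) u * ((hX i k).cfc (fun t => q.eval t) *
      word (fun k => (hX i k).cfc h) w)), ?_, ?_⟩
    · have : ∀ i, ntr (word (X i) u * ((hX i k).cfc (fun t => q.eval t) *
          word (fun k => (hX i k).cfc h) w)) = ∑ j ∈ Finset.range (q.natDegree + 1),
          (q.coeff j : ℂ) * ntr (word (X i) (u ++ List.replicate j k) *
            word (fun k => (hX i k).cfc h) w) := by
        intro i
        simp only [cfc_eval, Finset.sum_mul, Finset.mul_sum, ntr_sum, Matrix.smul_mul,
          Matrix.mul_smul, ntr_smul, word_append, word_replicate, mul_assoc]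
      simp only [this]
      exact Conv.sum _ fun j _ => (ih _).const_mul _
    · filter_upwards [hhs, hq] with i h1 h2
      rw [word_cons, ← ntr_sub, ← mul_sub, ← sub_mul, cfc_sub_cfc, ntr_mul_comm, mul_assoc]
      refine (norm_ntr_mul_le _ _).trans ?_
      rw [hsq_cfc, ← Real.sqrt_mul (integral_nonneg fun t => sq_nonneg _)]
      refine Real.sqrt_le_iff.2 ⟨hε.le, ?_⟩
      calc _ ≤ ε ^ 2 / (K + 1) * K := by
            gcongr
            exact hsq_nonneg _
        _ ≤ ε ^ 2 := by
            rw [div_mul_eq_mul_div, div_le_iff₀ (by positivity)]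
            nlinarith [sq_nonneg ε]

lemma conv_ntr_evalPoly_cfc (hX : ∀ i k, (X i k).IsHermitian)
    (hconv : ∀ w, Tendsto (fun i => ntr (word (X i) w)) l (𝓝 (β w)))
    {h : ℝ → ℝ} {L : ℝ} (hL : 0 ≤ L) (hh : ∀ t, |h t| ≤ L) (happ : ∀ k, PolyApprox l X k h)
    (R : FreeAlgebra ℂ (Fin m × Bool)) :
    Conv l fun i => ntr (evalPoly (fun k => (hX i k).cfc h) R) := by
  obtain ⟨c, hc⟩ := exists_evalPoly_eq_sum_word R
  have : ∀ i, ntr (evalPoly (fun k => (hX i k).cfc h) R) =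
      (c.map fun x => x.1 * ntr (word (X i) [] * word (fun k => (hX i k).cfc h) x.2)).sum := by
    intro i
    rw [hc _ fun k => isHermitian_cfc (hX i k) h]
    clear hc
    induction c with
    | nil => simp [ntr]
    | cons x c ih =>
      simp only [List.map_cons, List.sum_cons, ntr_add, ntr_smul, ih]
      simp [word]
  simp only [this]
  clear hc this
  induction c with
  | nil => simpa using Conv.const 0
  | cons x c ih =>
    simp only [List.map_cons, List.sum_cons]
    exact ((conv_ntr_word_mul_word hX hconv hL hh happ [] x.2).const_mul _).add ih

/-- Chebyshev's inequality: the rank counts the eigenvalues moved by the truncation, all of which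
exceed `L` in absolute value. -/
lemma rank_sub_cfc_triangleWave_le {n : ℕ} {A : Matrix (Fin n) (Fin n) ℂ} (hA : A.IsHermitian)
    {L : ℝ} (hL : 0 < L) :
    (n : ℝ)⁻¹ * (A - hA.cfc (triangleWave L)).rank ≤ (∫ t, t ^ 2 ∂(esd A)) / L ^ 2 := by
  have h1 : (A - hA.cfc (triangleWave L)).rank =
      Fintype.card {i // hA.eigenvalues i - triangleWave L (hA.eigenvalues i) ≠ 0} := by
    rw [← rank_cfc hA (fun t => t - triangleWave L t), ← cfc_sub_cfc, cfc_id']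
  rw [h1, integral_esd hA, mul_div_assoc]
  gcongr
  rw [Fintype.card_subtype, Finset.card_filter, Finset.sum_div]
  push_cast
  refine Finset.sum_le_sum fun i _ => ?_
  split_ifs with h
  · rw [le_div_iff₀ (by positivity), one_mul, ← sq_abs (hA.eigenvalues i)]
    gcongr
    by_contra! h'
    exact h (by rw [triangleWave_eq hL h'.le, sub_self])
  · positivity

lemma conv_integral_esd_of_norm_le {K : ℝ}
    {B : (i : ι) → Matrix (Fin (d i)) (Fin (d i)) ℂ} (hB : ∀ i, (B i).IsHermitian)
    (hK : ∀ i, ‖B i‖ ≤ K) (hc : ∀ j, Conv l fun i => ntr (B i ^ j)) {f : ℝ → ℝ}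
    (hf : Continuous f) : Conv l fun i => ((∫ t, f t ∂(esd (B i)) : ℝ) : ℂ) := by
  refine Conv.of_approx fun ε hε => ?_
  obtain ⟨p, hp⟩ := exists_polynomial_near_of_continuousOn (-K) K f hf.continuousOn ε hε
  refine ⟨fun i => ((∫ t, p.eval t ∂(esd (B i)) : ℝ) : ℂ), ?_, Eventually.of_forall fun i => ?_⟩
  · simp only [ofReal_integral_esd (hB _), cfc_eval, ntr_sum, ntr_smul]
    exact Conv.sum _ fun j _ => (hc j).const_mul _
  · rw [← Complex.ofReal_sub, Complex.norm_real, integral_esd (hB i), integral_esd (hB i),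
      ← mul_sub, ← Finset.sum_sub_distrib, norm_mul, norm_inv, Real.norm_natCast]
    have h1 : ‖∑ x, (f ((hB i).eigenvalues x) - p.eval ((hB i).eigenvalues x))‖ ≤ d i * ε := by
      refine (norm_sum_le _ _).trans ?_
      have : ∀ x ∈ Finset.univ, ‖f ((hB i).eigenvalues x) - p.eval ((hB i).eigenvalues x)‖ ≤ ε := by
        intro x _
        rw [Real.norm_eq_abs, abs_sub_comm]
        exact (hp _ (abs_le.1 ((abs_eigenvalues_le_norm (hB i) x).trans (hK i)))).le
      simpa using Finset.sum_le_sum this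
    rcases eq_or_ne (d i) 0 with h0 | h0
    · simp [h0, hε.le]
    · rw [inv_mul_le_iff₀ (by positivity)]
      exact h1

/-- If the moments of the words in the Hermitian matrices `X i k` converge and the even moments of
each variable do not grow too fast, then the spectral averages of a self-adjoint polynomial in the
matrices converge, for every bounded continuous rank-Lipschitz function. -/
theorem conv_integral_esd_evalPoly (hX : ∀ i k, (X i k).IsHermitian)
    (hconv : ∀ w, Tendsto (fun i => ntr (word (X i) w)) l (𝓝 (β w)))
    (hβ : ∀ k (s : ℝ), Tendsto (fun N : ℕ => s ^ N / (N ! : ℝ) ^ 2 *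
      ‖β (List.replicate (2 * N) k)‖) atTop (𝓝 0))
    (Q : FreeAlgebra ℂ (Fin m × Bool)) (hQ : ∀ i, (evalPoly (X i) Q).IsHermitian)
    {f : ℝ → ℝ} (hf : RankLipschitz f) (hfc : Continuous f) {c : ℝ} (hc : 0 ≤ c)
    (hfb : ∀ x, |f x| ≤ c) :
    Conv l fun i => ((∫ t, f t ∂(esd (evalPoly (X i) Q)) : ℝ) : ℂ) := by
  obtain ⟨Q', hQ'⟩ := exists_star_evalPoly_eq Q
  -- `Q` is assumed Hermitian at the matrices `X i` only, not at their truncations. Its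
  -- symmetrization `R` is Hermitian at every tuple and agrees with `Q` at `X i`.
  set R : FreeAlgebra ℂ (Fin m × Bool) := (1 / 2 : ℂ) • (Q + Q') with hR
  have hRH : ∀ {n : ℕ} (Y : Fin m → Matrix (Fin n) (Fin n) ℂ), (evalPoly Y R).IsHermitian := by
    intro n Y
    rw [hR, map_smul, map_add, ← hQ', Matrix.IsHermitian, ← Matrix.star_eq_conjTranspose,
      star_smul, star_add, star_star, add_comm]
    simp
  have hRX : ∀ i, evalPoly (X i) R = evalPoly (X i) Q := by
    intro i
    rw [hR, map_smul, map_add, ← hQ', Matrix.star_eq_conjTranspose, (hQ i).eq, ← two_smul ℂ,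
      smul_smul]
    simp
  simp only [← hRX]
  obtain ⟨CR, hCR⟩ := exists_rank_evalPoly_sub_le R
  obtain ⟨Cf, hCf⟩ := hf
  have hcos := fun k => polyApprox_cos hX hconv hβ k
  refine Conv.of_approx fun ε hε => ?_
  set S : ℝ := ∑ k, (‖β (List.replicate 2 k)‖ + 1) with hS
  have hS0 : 0 ≤ S := Finset.sum_nonneg fun k _ => by positivity
  -- `D / L ^ 2` is the total cost of truncating at level `L`: `2 c` from the trace bound, `Cf` and
  -- `CR` from the rank estimates for `f` and `R`, and `S / L ^ 2` from Chebyshev's inequality.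
  set D : ℝ := 2 * c * (Cf * (CR * S)) with hD
  have hD0 : 0 ≤ D := by positivity
  obtain ⟨L, hL, hLD⟩ : ∃ L : ℝ, 0 < L ∧ D / L ^ 2 ≤ ε := by
    refine ⟨√(D / ε) + 1, by positivity, ?_⟩
    rw [div_le_iff₀ (by positivity)]
    have := Real.sq_sqrt (show 0 ≤ D / ε by positivity)
    have h2 : D / ε ≤ (√(D / ε) + 1) ^ 2 := by
      nlinarith [Real.sqrt_nonneg (D / ε)]
    rw [div_le_iff₀ hε] at h2
    linarith
  have htri := abs_triangleWave_le hL
  have happ := fun k => polyApprox_triangleWave hX (hcos k) L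
  obtain ⟨K, -, hK⟩ := exists_norm_evalPoly_le R L
  refine ⟨fun i => ((∫ t, f t ∂(esd (evalPoly (fun k => (hX i k).cfc (triangleWave L)) R)) : ℝ) :
    ℂ), ?_, ?_⟩
  · refine conv_integral_esd_of_norm_le (K := K) (fun i => hRH _)
      (fun i => hK _ _ fun k => norm_cfc_le (hX i k) hL.le htri) (fun j => ?_) hfc
    simp only [← map_pow]
    exact conv_ntr_evalPoly_cfc hX hconv hL.le htri happ _
  · have h2 : ∀ᶠ i in l, ∀ k, ∫ t, t ^ 2 ∂(esd (X i k)) ≤ ‖β (List.replicate 2 k)‖ + 1 := by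
      rw [eventually_all]
      intro k
      have h3 : ∀ᶠ i in l, ‖ntr (word (X i) (List.replicate 2 k))‖ <
          ‖β (List.replicate 2 k)‖ + 1 :=
        (hconv _).norm.eventually (gt_mem_nhds (by linarith))
      filter_upwards [h3] with i hi
      refine le_trans (le_abs_self _) ?_
      rw [← Real.norm_eq_abs, ← Complex.norm_real, ofReal_integral_pow_esd hX]
      exact hi.le
    filter_upwards [h2] with i hi
    rw [← Complex.ofReal_sub, Complex.norm_real, Real.norm_eq_abs]
    refine (abs_integral_esd_sub_le (hRH (X i)) (hRH _) hc hfb).trans ?_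
    refine le_trans ?_ hLD
    rw [hD, mul_div_assoc]
    gcongr
    have h5 : ((d i : ℝ))⁻¹ * ∑ k, ((X i k - (hX i k).cfc (triangleWave L)).rank : ℝ) ≤
        S / L ^ 2 := by
      rw [Finset.mul_sum, hS, Finset.sum_div]
      refine Finset.sum_le_sum fun k _ => (rank_sub_cfc_triangleWave_le (hX i k) hL).trans ?_
      gcongr
      exact hi k
    calc _ ≤ ((d i : ℝ))⁻¹ * (Cf * (CR *
          ∑ k, ((X i k - (hX i k).cfc (triangleWave L)).rank : ℝ))) := by
          gcongr
          have h6 := (hCf _ _ _ (hRH (X i)) (hRH fun k => (hX i k).cfc (triangleWave L))).trans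
            (Nat.mul_le_mul_left Cf (hCR _ (X i) fun k => (hX i k).cfc (triangleWave L)))
          exact_mod_cast h6
      _ = Cf * (CR * (((d i : ℝ))⁻¹ *
          ∑ k, ((X i k - (hX i k).cfc (triangleWave L)).rank : ℝ))) := by ring
      _ ≤ Cf * (CR * (S / L ^ 2)) := by gcongr
      _ = _ := by ring

end Deterministic

end

/-! ### Weak convergence, moments and measurability of spectral distributions. -/

section

/-! ### The separating algebra of rank-Lipschitz functions -/

/-- The bounded continuous functions that are rank-Lipschitz. -/
def rankLipschitzAlgebra : StarSubalgebra ℝ (ℝ →ᵇ ℝ) where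
  carrier := {f | RankLipschitz f}
  mul_mem' hf hg := hf.mul hg
  add_mem' hf hg := hf.add hg
  algebraMap_mem' r := RankLipschitz.const r
  star_mem' hf := by simpa using hf

lemma mem_rankLipschitzAlgebra {f : ℝ →ᵇ ℝ} : f ∈ rankLipschitzAlgebra ↔ RankLipschitz f := Iff.rfl

lemma one_add_mul_self_ne_zero (x : ℝ) : 1 + x * x ≠ 0 := by nlinarith [mul_self_nonneg x]

lemma rankLipschitz_inv_one_add_sq : RankLipschitz fun x => (1 + x * x)⁻¹ :=
  ((RankLipschitz.const 1).add (RankLipschitz.id.mul RankLipschitz.id)).inv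
    one_add_mul_self_ne_zero

/-- The functions `1 / (1 + x²)` and `x / (1 + x²)` suffice: equality of the first determines `|x|`,
and then the second determines `x`. -/
lemma rankLipschitzAlgebra_separatesPoints :
    (rankLipschitzAlgebra.map (BoundedContinuousFunction.toContinuousMapStarₐ ℝ)).SeparatesPoints := by
  have hpos := one_add_mul_self_ne_zero
  have hpos' : ∀ x : ℝ, 0 < 1 + x * x := fun x => by nlinarith [mul_self_nonneg x]
  let f : ℝ →ᵇ ℝ := BoundedContinuousFunction.ofNormedAddCommGroup (fun x => (1 + x * x)⁻¹)
    (by fun_prop (disch := exact hpos _)) 1 (fun x => by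
      rw [norm_inv, Real.norm_eq_abs, abs_of_pos (hpos' x)]
      exact inv_le_one_of_one_le₀ (by nlinarith [mul_self_nonneg x]))
  let g : ℝ →ᵇ ℝ := BoundedContinuousFunction.ofNormedAddCommGroup (fun x => x * (1 + x * x)⁻¹)
    (by fun_prop (disch := exact hpos _)) 1 (fun x => by
      rw [norm_mul, norm_inv, Real.norm_eq_abs, Real.norm_eq_abs, abs_of_pos (a := 1 + x * x)
        (hpos' x), ← div_eq_mul_inv, div_le_one (hpos' x), abs_le]
      constructor <;> nlinarith [sq_nonneg (x - 1), sq_nonneg (x + 1)])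
  have hf : f ∈ rankLipschitzAlgebra := rankLipschitz_inv_one_add_sq
  have hg : g ∈ rankLipschitzAlgebra := RankLipschitz.id.mul rankLipschitz_inv_one_add_sq
  intro x y hxy
  by_cases h : (1 + x * x)⁻¹ = (1 + y * y)⁻¹
  · refine ⟨g, ⟨g, ⟨g, hg, rfl⟩, rfl⟩, fun h' => hxy ?_⟩
    have h' : x * (1 + x * x)⁻¹ = y * (1 + y * y)⁻¹ := h'
    rw [h] at h'
    exact mul_right_cancel₀ (inv_ne_zero (hpos y)) h'
  · exact ⟨f, ⟨f, ⟨f, hf, rfl⟩, rfl⟩, h⟩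

/-! ### Weak convergence of spectral distributions -/

lemma isTightMeasureSet_of_integral_sq_le {κ : Type*} {μ : κ → Measure ℝ} {M : ℝ}
    [∀ k, IsProbabilityMeasure (μ k)] (hi : ∀ k, Integrable (fun t => t ^ 2) (μ k))
    (hM : ∀ k, ∫ t, t ^ 2 ∂(μ k) ≤ M) :
    IsTightMeasureSet (Set.range μ) := by
  rw [isTightMeasureSet_iff_exists_isCompact_measure_compl_le]
  intro ε hε
  obtain ⟨r, hr, hrε⟩ : ∃ r : ℝ, 0 < r ∧ ENNReal.ofReal (M / r ^ 2) ≤ ε := by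
    have h1 : Tendsto (fun r : ℝ => ENNReal.ofReal (M / r ^ 2)) atTop (𝓝 0) := by
      rw [← ENNReal.ofReal_zero]
      exact (ENNReal.continuous_ofReal.tendsto _).comp
        (tendsto_const_nhds.div_atTop (tendsto_pow_atTop two_ne_zero))
    exact ((eventually_gt_atTop 0).and (h1.eventually (Iic_mem_nhds hε))).exists
  refine ⟨Set.Icc (-r) r, isCompact_Icc, ?_⟩
  rintro _ ⟨k, rfl⟩
  refine le_trans ?_ hrε
  have h2 := mul_meas_ge_le_integral_of_nonneg (μ := μ k) (f := fun t => t ^ 2)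
    (ae_of_all _ fun t => sq_nonneg t) (hi k) (r ^ 2)
  have hsub : (Set.Icc (-r) r)ᶜ ⊆ {t : ℝ | r ^ 2 ≤ t ^ 2} := by
    intro t ht
    rw [Set.mem_compl_iff, Set.mem_Icc, ← abs_le, not_le] at ht
    rw [Set.mem_ofPred_eq, ← sq_abs t]
    gcongr
  refine (measure_mono hsub).trans ?_
  rw [← ENNReal.ofReal_toReal (measure_ne_top _ _)]
  apply ENNReal.ofReal_le_ofReal
  rw [le_div_iff₀ (by positivity), mul_comm]
  exact h2.trans (hM k)

/-- The truncated power `(max (-K) (min t K)) ^ k`. -/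
def clampPow (K : ℝ) (k : ℕ) : ℝ →ᵇ ℝ :=
  BoundedContinuousFunction.ofNormedAddCommGroup (fun t => max (-K) (min t K) ^ k)
    (by fun_prop) (|K| ^ k) (fun t => by
      rw [norm_pow, Real.norm_eq_abs]
      refine pow_le_pow_left₀ (abs_nonneg _) ?_ _
      rw [abs_le]
      constructor
      · rcases le_total 0 K with h | h
        · rw [abs_of_nonneg h]; exact le_max_left _ _
        · rw [abs_of_nonpos h]; exact le_max_of_le_left (by linarith)
      · refine max_le (neg_le_abs K) ((min_le_right _ _).trans (le_abs_self K)))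

lemma clampPow_apply (K : ℝ) (k : ℕ) (t : ℝ) : clampPow K k t = max (-K) (min t K) ^ k := rfl

lemma clampPow_eq {K t : ℝ} (k : ℕ) (h : |t| ≤ K) : clampPow K k t = t ^ k := by
  obtain ⟨h1, h2⟩ := abs_le.1 h
  rw [clampPow_apply, min_eq_left h2, max_eq_right h1]

lemma abs_clamp_le {K : ℝ} (hK : 0 ≤ K) (t : ℝ) : |max (-K) (min t K)| ≤ |t| := by
  rcases le_total |t| K with h | h
  · obtain ⟨h1, h2⟩ := abs_le.1 h
    rw [min_eq_left h2, max_eq_right h1]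
  · refine le_trans (abs_le.2 ⟨le_max_left _ _, max_le (by linarith) (min_le_right _ _)⟩) h

lemma clampPow_two_mul_le {K : ℝ} (hK : 0 ≤ K) (j : ℕ) (t : ℝ) :
    clampPow K (2 * j) t ≤ t ^ (2 * j) := by
  rw [clampPow_apply, pow_mul, pow_mul t, ← sq_abs, ← sq_abs t]
  exact pow_le_pow_left₀ (by positivity)
    (pow_le_pow_left₀ (abs_nonneg _) (abs_clamp_le hK t) _) _

lemma abs_pow_sub_clampPow_le {K : ℝ} (hK : 0 < K) (k : ℕ) (t : ℝ) :
    |t ^ k - clampPow K k t| ≤ 2 / K ^ k * t ^ (2 * k) := by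
  have h0 : 0 ≤ t ^ (2 * k) := by rw [pow_mul]; positivity
  rcases le_total |t| K with h | h
  · rw [clampPow_eq k h, sub_self, abs_zero]
    positivity
  · have h1 : |t ^ k| ≤ |t| ^ k := (abs_pow t k).le
    have h2 : |clampPow K k t| ≤ |t| ^ k := by
      rw [clampPow_apply, abs_pow]
      exact pow_le_pow_left₀ (abs_nonneg _) (abs_clamp_le hK.le t) _
    have h3 : |t| ^ k * K ^ k ≤ t ^ (2 * k) := by
      rw [pow_mul, ← sq_abs, ← pow_mul, two_mul, pow_add]
      gcongr
    calc _ ≤ |t ^ k| + |clampPow K k t| := abs_sub _ _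
      _ ≤ 2 * |t| ^ k := by linarith
      _ ≤ _ := by
        rw [div_mul_eq_mul_div, le_div_iff₀ (by positivity)]
        linarith

/-- Fatou's lemma along truncated even powers gives finite moments of the limit. Convergent moments
of order `2 k` then control the truncation error of order `k` uniformly in `n`, so limit and
integral may be exchanged. -/
lemma integrable_and_integral_pow_eq_of_weaklyConverges {μ : ℕ → Measure ℝ} {F : Measure ℝ}
    [∀ n, IsProbabilityMeasure (μ n)] [IsProbabilityMeasure F] (h : WeaklyConverges μ F)
    (hi : ∀ n k, Integrable (fun t : ℝ => t ^ k) (μ n)) {c : ℕ → ℝ}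
    (hc : ∀ k, Tendsto (fun n => ∫ t, t ^ k ∂(μ n)) atTop (𝓝 (c k))) (k : ℕ) :
    Integrable (fun t : ℝ => t ^ k) F ∧ ∫ t, t ^ k ∂F = c k := by
  have heven : ∀ j : ℕ, Integrable (fun t : ℝ => t ^ (2 * j)) F := by
    intro j
    have hle : ∀ N : ℕ, ∫ t, clampPow N (2 * j) t ∂F ≤ c (2 * j) := by
      intro N
      refine le_of_tendsto_of_tendsto' (h _) (hc (2 * j)) fun n => ?_
      exact integral_mono ((clampPow N (2 * j)).integrable _) (hi n _)
        fun t => clampPow_two_mul_le (Nat.cast_nonneg N) j t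
    have hnn : ∀ (N : ℕ) t, 0 ≤ clampPow N (2 * j) t := fun N t => by
      rw [clampPow_apply, pow_mul]; positivity
    have hlim : ∀ t : ℝ, Tendsto (fun N : ℕ => ENNReal.ofReal (clampPow N (2 * j) t)) atTop
        (𝓝 (ENNReal.ofReal (t ^ (2 * j)))) := by
      intro t
      refine tendsto_const_nhds.congr' ?_
      filter_upwards [eventually_ge_atTop ⌈|t|⌉₊] with N hN
      rw [clampPow_eq _ ((Nat.le_ceil _).trans (by exact_mod_cast hN))]
    have hfatou : ∫⁻ t, ENNReal.ofReal (t ^ (2 * j)) ∂F ≤ ENNReal.ofReal (c (2 * j)) := by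
      calc _ = ∫⁻ t, liminf (fun N : ℕ => ENNReal.ofReal (clampPow N (2 * j) t)) atTop ∂F := by
            refine lintegral_congr fun t => ?_
            rw [(hlim t).liminf_eq]
        _ ≤ liminf (fun N : ℕ => ∫⁻ t, ENNReal.ofReal (clampPow N (2 * j) t) ∂F) atTop :=
            lintegral_liminf_le fun N =>
              ((clampPow N (2 * j)).continuous.measurable).ennreal_ofReal
        _ ≤ ENNReal.ofReal (c (2 * j)) := by
            refine liminf_le_of_le (by isBoundedDefault) fun b hb => ?_
            obtain ⟨N, hN⟩ := hb.exists
            refine hN.trans ?_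
            rw [← ofReal_integral_eq_lintegral_ofReal ((clampPow N (2 * j)).integrable _)
              (ae_of_all _ (hnn N))]
            exact ENNReal.ofReal_le_ofReal (hle N)
    refine ⟨by fun_prop, ?_⟩
    rw [hasFiniteIntegral_iff_ofReal (ae_of_all _ fun t => by rw [pow_mul]; positivity)]
    exact hfatou.trans_lt ENNReal.ofReal_lt_top
  have hint : ∀ k : ℕ, Integrable (fun t : ℝ => t ^ k) F := by
    intro k
    refine ((integrable_const (1 : ℝ)).add (heven k)).mono' (by fun_prop) (ae_of_all _ fun t => ?_)
    simp only [Pi.add_apply, norm_pow, Real.norm_eq_abs, pow_mul]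
    rw [← sq_abs t, ← pow_mul, mul_comm 2 k, pow_mul]
    nlinarith [sq_nonneg (|t| ^ k - 1), pow_nonneg (abs_nonneg t) k]
  refine ⟨hint k, ?_⟩
  -- The error factor `2 / K ^ k` tends to zero only for positive `k`.
  rcases Nat.eq_zero_or_pos k with rfl | hk
  · refine tendsto_nhds_unique ?_ (hc 0)
    simp
  have hdiff : ∀ (ν : Measure ℝ) [IsProbabilityMeasure ν],
      (∀ k, Integrable (fun t : ℝ => t ^ k) ν) → ∀ K : ℝ, 0 < K →
      |∫ t, t ^ k ∂ν - ∫ t, clampPow K k t ∂ν| ≤ 2 / K ^ k * ∫ t, t ^ (2 * k) ∂ν := by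
    intro ν _ hν K hK
    rw [← integral_sub (hν k) ((clampPow K k).integrable _), ← integral_const_mul]
    refine (abs_integral_le_integral_abs).trans (integral_mono ?_ ((hν _).const_mul _)
      fun t => abs_pow_sub_clampPow_le hK k t)
    exact ((hν k).sub ((clampPow K k).integrable _)).abs
  have hK : ∀ K : ℝ, 0 < K →
      |∫ t, t ^ k ∂F - c k| ≤ 2 / K ^ k * (∫ t, t ^ (2 * k) ∂F + c (2 * k)) := by
    intro K hK
    have h1 := hdiff F hint K hK
    have h2 : |c k - ∫ t, clampPow K k t ∂F| ≤ 2 / K ^ k * c (2 * k) :=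
      le_of_tendsto_of_tendsto' (((hc k).sub (h (clampPow K k))).abs) ((hc (2 * k)).const_mul _)
        fun n => hdiff (μ n) (hi n) K hK
    rw [mul_add]
    have := abs_sub_le (∫ t, t ^ k ∂F) (∫ t, clampPow K k t ∂F) (c k)
    rw [abs_sub_comm (∫ t, clampPow K k t ∂F) (c k)] at this
    linarith
  have hlim : Tendsto (fun K : ℝ => 2 / K ^ k * (∫ t, t ^ (2 * k) ∂F + c (2 * k))) atTop (𝓝 0) := by
    simpa using (tendsto_const_nhds.div_atTop (tendsto_pow_atTop hk.ne')).mul_const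
      (∫ t, t ^ (2 * k) ∂F + c (2 * k))
  have h0 : |∫ t, t ^ k ∂F - c k| ≤ 0 :=
    ge_of_tendsto hlim ((eventually_gt_atTop 0).mono fun K hK' => hK K hK')
  exact sub_eq_zero.1 (abs_nonpos_iff.1 h0)

/-! ### Measurability of the empirical spectral distribution -/

section Measurability

variable {Ω : Type*} [MeasurableSpace Ω] {n : ℕ} {B : Ω → Matrix (Fin n) (Fin n) ℂ}

lemma measurable_matrix_mul {A C : Ω → Matrix (Fin n) (Fin n) ℂ}
    (hA : ∀ i j, Measurable fun ω => A ω i j) (hC : ∀ i j, Measurable fun ω => C ω i j)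
    (i j : Fin n) : Measurable fun ω => (A ω * C ω) i j := by
  simp only [Matrix.mul_apply]
  exact Finset.measurable_sum _ fun k _ => (hA i k).mul (hC k j)

lemma measurable_matrix_pow (hB : ∀ i j, Measurable fun ω => B ω i j) (k : ℕ) (i j : Fin n) :
    Measurable fun ω => (B ω ^ k) i j := by
  induction k generalizing i j with
  | zero => simp
  | succ k ih =>
    simp only [pow_succ]
    exact measurable_matrix_mul ih hB i j

lemma measurable_ntr (hB : ∀ i j, Measurable fun ω => B ω i j) :
    Measurable fun ω => ntr (B ω) := by
  simp only [ntr, Matrix.trace, Matrix.diag]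
  exact (Finset.measurable_sum _ fun k _ => hB k k).const_mul _

/-- Polynomial averages are traces of matrix powers, so they are measurable in the entries;
continuous averages are their pointwise limits. No measurable choice of eigenvalues is needed. -/
lemma measurable_integral_esd (hB : ∀ i j, Measurable fun ω => B ω i j)
    (hH : ∀ ω, (B ω).IsHermitian) {f : ℝ → ℝ} (hf : Continuous f) :
    Measurable fun ω => ∫ t, f t ∂(esd (B ω)) := by
  have hex : ∀ N : ℕ, ∃ p : Polynomial ℝ, ∀ x ∈ Set.Icc (-(N : ℝ)) N,
      |p.eval x - f x| < 1 / ((N : ℝ) + 1) := fun N =>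
    exists_polynomial_near_of_continuousOn _ _ f hf.continuousOn _ (by positivity)
  choose p hp using hex
  refine measurable_of_tendsto_metrizable (f := fun N ω => ∫ t, (p N).eval t ∂(esd (B ω))) ?_ ?_
  · intro N
    simp only [integral_esd_eq_re (hH _), cfc_eval, ntr_sum, ntr_smul, Complex.re_sum]
    exact Finset.measurable_sum _ fun k _ =>
      ((measurable_ntr (measurable_matrix_pow hB k)).const_mul _).re
  · rw [tendsto_pi_nhds]
    intro ω
    simp only [integral_esd (hH ω)]
    refine (tendsto_finsetSum _ fun i _ => ?_).const_mul _
    rw [tendsto_iff_dist_tendsto_zero]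
    refine squeeze_zero' (Eventually.of_forall fun N => dist_nonneg) ?_
      (tendsto_one_div_add_atTop_nhds_zero_nat (𝕜 := ℝ))
    filter_upwards [eventually_ge_atTop ⌈|(hH ω).eigenvalues i|⌉₊] with N hN
    exact (hp N _ (abs_le.1 ((Nat.le_ceil _).trans (by exact_mod_cast hN)))).le

lemma measurable_esd (hn : n ≠ 0) (hB : ∀ i j, Measurable fun ω => B ω i j)
    (hH : ∀ ω, (B ω).IsHermitian) : Measurable fun ω => esd (B ω) := by
  have : ∀ ω, IsProbabilityMeasure (esd (B ω)) := fun ω => isProbabilityMeasure_esd hn (hH ω)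
  refine Measurable.measure_of_isPiSystem_of_isProbabilityMeasure
    (BorelSpace.measurable_eq.trans borel_eq_generateFrom_isClosed) isPiSystem_isClosed ?_
  intro s hs
  have hpos : ∀ N : ℕ, (0 : ℝ) < 1 / ((N : ℝ) + 1) := fun N => by positivity
  refine measurable_of_tendsto_metrizable (f := fun N ω =>
    ∫⁻ t, (thickenedIndicator (hpos N) s t : ℝ≥0∞) ∂(esd (B ω))) (fun N => ?_) ?_
  · have : ∀ ω, ∫⁻ t, (thickenedIndicator (hpos N) s t : ℝ≥0∞) ∂(esd (B ω)) =
        ENNReal.ofReal (∫ t, (thickenedIndicator (hpos N) s t : ℝ) ∂(esd (B ω))) := by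
      intro ω
      rw [ofReal_integral_eq_lintegral_ofReal (integrable_esd (hH ω) _)
        (ae_of_all _ fun t => NNReal.coe_nonneg _)]
      simp
    simp only [this]
    exact (measurable_integral_esd hB hH (by fun_prop)).ennreal_ofReal
  · rw [tendsto_pi_nhds]
    intro ω
    exact tendsto_lintegral_thickenedIndicator_of_isClosed _ hs hpos
      tendsto_one_div_add_atTop_nhds_zero_nat

lemma integral_expectedESD {P : Measure Ω} [IsProbabilityMeasure P] (hn : n ≠ 0)
    (hB : ∀ i j, Measurable fun ω => B ω i j) (hH : ∀ ω, (B ω).IsHermitian) (f : ℝ →ᵇ ℝ) :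
    ∫ t, f t ∂(expectedESD P B) = ∫ ω, ∫ t, f t ∂(esd (B ω)) ∂P := by
  have : ∀ ω, IsProbabilityMeasure (esd (B ω)) := fun ω => isProbabilityMeasure_esd hn (hH ω)
  let κ : Kernel Ω ℝ := ⟨fun ω => esd (B ω), measurable_esd hn hB hH⟩
  have : IsMarkovKernel κ := ⟨this⟩
  have h := Kernel.integral_comp (κ := Kernel.const Unit P) (η := κ) (a := ()) (f := f)
    (f.integrable _)
  rw [Kernel.comp_apply, Kernel.const_apply] at h
  exact h

end Measurability

/-! ### The limit spectral distribution of a self-adjoint polynomial -/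

section Limit

open scoped Nat

variable {m : ℕ} {β : List (Fin m) → ℂ}

lemma tendsto_ntr_evalPoly {ι : Type*} {l : Filter ι} {d : ι → ℕ}
    {X : (i : ι) → Fin m → Matrix (Fin (d i)) (Fin (d i)) ℂ} (hX : ∀ i k, (X i k).IsHermitian)
    (hconv : ∀ w, Tendsto (fun i => ntr (word (X i) w)) l (𝓝 (β w)))
    (R : FreeAlgebra ℂ (Fin m × Bool)) : Conv l fun i => ntr (evalPoly (X i) R) := by
  obtain ⟨c, hc⟩ := exists_evalPoly_eq_sum_word R
  have : ∀ i, ntr (evalPoly (X i) R) = (c.map fun x => x.1 * ntr (word (X i) x.2)).sum := by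
    intro i
    rw [hc _ fun k => hX i k]
    clear hc
    induction c with
    | nil => simp [ntr]
    | cons x c ih => simp only [List.map_cons, List.sum_cons, ntr_add, ntr_smul, ih]
  simp only [this]
  clear hc this
  induction c with
  | nil => simpa using Conv.const 0
  | cons x c ih =>
    simp only [List.map_cons, List.sum_cons]
    exact (Conv.const_mul x.1 ⟨_, hconv x.2⟩).add ih

lemma isTightMeasureSet_esd {B : (n : ℕ) → Matrix (Fin n) (Fin n) ℂ} (hB : ∀ n, (B n).IsHermitian)
    (hc : Conv atTop fun n => ntr (B n ^ 2)) :
    IsTightMeasureSet (Set.range fun n => esd (B (n + 1))) := by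
  have : ∀ n, IsProbabilityMeasure (esd (B (n + 1))) := fun n =>
    isProbabilityMeasure_esd n.succ_ne_zero (hB _)
  obtain ⟨c, hc⟩ := hc
  obtain ⟨M, hM⟩ := hc.norm.bddAbove_range
  refine isTightMeasureSet_of_integral_sq_le (M := M) (fun n => integrable_esd (hB _) _) fun n => ?_
  refine le_trans (le_abs_self _) ?_
  rw [← Real.norm_eq_abs, ← Complex.norm_real, ofReal_integral_esd (hB _), cfc_pow']
  exact hM ⟨n + 1, rfl⟩

lemma ProbabilityMeasure.tendsto_iff_weaklyConverges {μ : ℕ → ProbabilityMeasure ℝ}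
    {F : ProbabilityMeasure ℝ} :
    Tendsto μ atTop (𝓝 F) ↔ WeaklyConverges (fun n => (μ n : Measure ℝ)) F :=
  ProbabilityMeasure.tendsto_iff_forall_integral_tendsto

lemma weaklyConverges_of_tight {μ : ℕ → Measure ℝ} {F : Measure ℝ}
    [hμ : ∀ n, IsProbabilityMeasure (μ n)] [hF : IsProbabilityMeasure F]
    (ht : IsTightMeasureSet (Set.range μ))
    (hc : ∀ f ∈ rankLipschitzAlgebra, Tendsto (fun n => ∫ t, f t ∂(μ n)) atTop (𝓝 (∫ t, f t ∂F))) :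
    WeaklyConverges μ F := by
  let μ' : ℕ → ProbabilityMeasure ℝ := fun n => ⟨μ n, hμ n⟩
  have ht' : IsTightMeasureSet {(μ' n : Measure ℝ) | n} := ht
  have h : Tendsto μ' atTop (𝓝 ⟨F, hF⟩) := by
    refine ProbabilityMeasure.tendsto_of_tight_of_separatesPoints ℝ ht'
      rankLipschitzAlgebra_separatesPoints fun f hf => ?_
    exact hc f hf
  exact ProbabilityMeasure.tendsto_iff_weaklyConverges.1 h

/-- By Prokhorov there is a limit along a non-principal ultrafilter. Its integrals against a
separating algebra equal the limits along the whole sequence, so the whole sequence converges to it.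
-/
lemma exists_limit_of_tight {μ : ℕ → ProbabilityMeasure ℝ}
    (ht : IsTightMeasureSet (Set.range fun n => (μ n : Measure ℝ)))
    (hc : ∀ f ∈ rankLipschitzAlgebra, ∃ c,
      Tendsto (fun n => ∫ t, f t ∂(μ n : Measure ℝ)) atTop (𝓝 c)) :
    ∃ F : ProbabilityMeasure ℝ, Tendsto μ atTop (𝓝 F) := by
  have h_compact : IsCompact (closure (Set.range μ)) := by
    refine isCompact_closure_of_isTightMeasureSet ?_
    convert ht using 1
    ext ν
    simp
  obtain ⟨F, -, hF⟩ := h_compact.ultrafilter_le_nhds ((hyperfilter ℕ).map μ)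
    (le_principal_iff.2 (Filter.mem_map.2 (Filter.univ_mem' fun n =>
      subset_closure (Set.mem_range_self n))))
  have hF : Tendsto μ (hyperfilter ℕ) (𝓝 F) := hF
  refine ⟨F, ProbabilityMeasure.tendsto_of_tight_of_separatesPoints ℝ ht
    rankLipschitzAlgebra_separatesPoints fun f hf => ?_⟩
  obtain ⟨c, hc⟩ := hc f hf
  have h1 := ProbabilityMeasure.tendsto_iff_forall_integral_tendsto.1 hF f
  have h2 := hc.mono_left (Nat.hyperfilter_le_atTop)
  rwa [tendsto_nhds_unique h1 h2]

/-- The limits of the spectral averages depend only on the limit moments `β`. -/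
lemma exists_limit_integral_esd
    {X : (n : ℕ) → Fin m → Matrix (Fin n) (Fin n) ℂ} (hX : ∀ n k, (X n k).IsHermitian)
    (hconv : ∀ w, Tendsto (fun n => ntr (word (X n) w)) atTop (𝓝 (β w)))
    (hβ : ∀ k (s : ℝ), Tendsto (fun N : ℕ => s ^ N / (N ! : ℝ) ^ 2 *
      ‖β (List.replicate (2 * N) k)‖) atTop (𝓝 0))
    (Q : FreeAlgebra ℂ (Fin m × Bool)) (hQ : ∀ n, (evalPoly (X n) Q).IsHermitian)
    {f : ℝ →ᵇ ℝ} (hf : f ∈ rankLipschitzAlgebra) :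
    ∃ c : ℝ, ∀ X' : (n : ℕ) → Fin m → Matrix (Fin n) (Fin n) ℂ, (∀ n k, (X' n k).IsHermitian) →
      (∀ w, Tendsto (fun n => ntr (word (X' n) w)) atTop (𝓝 (β w))) →
      (∀ n, (evalPoly (X' n) Q).IsHermitian) →
      Tendsto (fun n => ∫ t, f t ∂(esd (evalPoly (X' n) Q))) atTop (𝓝 c) := by
  rw [mem_rankLipschitzAlgebra] at hf
  have hbd : ∀ x, |f x| ≤ ‖f‖ := fun x => f.norm_coe_le_norm x
  have hfc := f.continuous
  obtain ⟨c, hc⟩ := conv_integral_esd_evalPoly hX hconv hβ Q hQ hf hfc (norm_nonneg f) hbd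
  refine ⟨c.re, fun X' hX' hconv' hQ' => ?_⟩
  -- The two sequences are merged into one family indexed by `Bool × ℕ`. Convergence of its averages
  -- along `⊤ ×ˢ atTop` forces both sequences to have the same limit.
  let Z : (i : Bool × ℕ) → Fin m → Matrix (Fin i.2) (Fin i.2) ℂ :=
    fun i => if i.1 then X i.2 else X' i.2
  have hZ : ∀ i k, (Z i k).IsHermitian := by
    rintro ⟨b, n⟩ k
    cases b
    · exact hX' n k
    · exact hX n k
  have hZQ : ∀ i, (evalPoly (Z i) Q).IsHermitian := by
    rintro ⟨b, n⟩
    cases b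
    · exact hQ' n
    · exact hQ n
  have hZconv : ∀ w, Tendsto (fun i => ntr (word (Z i) w)) (⊤ ×ˢ atTop) (𝓝 (β w)) := by
    intro w
    rw [tendsto_def]
    intro s hs
    have h1 := hconv w hs
    have h2 := hconv' w hs
    rw [Filter.mem_map] at h1 h2
    refine Filter.mem_prod_iff.2 ⟨Set.univ, Filter.univ_mem, _, Filter.inter_mem h1 h2, ?_⟩
    rintro ⟨b, n⟩ ⟨-, hn⟩
    cases b
    · exact hn.2
    · exact hn.1
  obtain ⟨e, he⟩ := conv_integral_esd_evalPoly hZ hZconv hβ Q hZQ hf hfc (norm_nonneg f) hbd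
  have hb : ∀ b : Bool, Tendsto (fun n : ℕ => (b, n)) atTop (⊤ ×ˢ atTop) := fun b =>
    tendsto_top.prodMk tendsto_id
  have h1 := he.comp (hb true)
  have h2 := he.comp (hb false)
  have hce : c = e := tendsto_nhds_unique hc h1
  rw [hce]
  exact (Complex.continuous_re.tendsto _).comp h2

/-- Existence and uniqueness of the limit spectral distribution of a self-adjoint polynomial: it
depends only on the limit moments `β`. -/
theorem exists_limit_spectral_distribution
    {X : (n : ℕ) → Fin m → Matrix (Fin n) (Fin n) ℂ} (hX : ∀ n k, (X n k).IsHermitian)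
    (hconv : ∀ w, Tendsto (fun n => ntr (word (X n) w)) atTop (𝓝 (β w)))
    (hβ : ∀ k (s : ℝ), Tendsto (fun N : ℕ => s ^ N / (N ! : ℝ) ^ 2 *
      ‖β (List.replicate (2 * N) k)‖) atTop (𝓝 0))
    (Q : FreeAlgebra ℂ (Fin m × Bool)) (hQ : ∀ n, (evalPoly (X n) Q).IsHermitian) :
    ∃ F : Measure ℝ, IsProbabilityMeasure F ∧
      (∀ k : ℕ, Integrable (fun t : ℝ => t ^ k) F ∧
        Tendsto (fun n => ntr (evalPoly (X n) Q ^ k)) atTop (𝓝 ((∫ t, t ^ k ∂F : ℝ) : ℂ))) ∧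
      ∀ X' : (n : ℕ) → Fin m → Matrix (Fin n) (Fin n) ℂ, (∀ n k, (X' n k).IsHermitian) →
        (∀ w, Tendsto (fun n => ntr (word (X' n) w)) atTop (𝓝 (β w))) →
        (∀ n, (evalPoly (X' n) Q).IsHermitian) →
        WeaklyConverges (fun n => esd (evalPoly (X' n) Q)) F := by
  -- The spectral distribution of a `0 × 0` matrix is the zero measure, so the compactness argument
  -- uses the sizes `n + 1`.
  have hprob : ∀ {X : (n : ℕ) → Fin m → Matrix (Fin n) (Fin n) ℂ},
      (∀ n, (evalPoly (X n) Q).IsHermitian) → ∀ n,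
      IsProbabilityMeasure (esd (evalPoly (X (n + 1)) Q)) := fun hQ n =>
    isProbabilityMeasure_esd n.succ_ne_zero (hQ _)
  have htight : ∀ {X : (n : ℕ) → Fin m → Matrix (Fin n) (Fin n) ℂ},
      (∀ n k, (X n k).IsHermitian) →
      (∀ w, Tendsto (fun n => ntr (word (X n) w)) atTop (𝓝 (β w))) →
      (∀ n, (evalPoly (X n) Q).IsHermitian) →
      IsTightMeasureSet (Set.range fun n => esd (evalPoly (X (n + 1)) Q)) := by
    intro X hX hconv hQ
    refine isTightMeasureSet_esd (B := fun n => evalPoly (X n) Q) hQ ?_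
    simp only [← map_pow]
    exact tendsto_ntr_evalPoly hX hconv _
  have hint := fun f hf => exists_limit_integral_esd hX hconv hβ Q hQ (f := f) hf
  obtain ⟨F, hF⟩ := exists_limit_of_tight
    (μ := fun n => ⟨esd (evalPoly (X (n + 1)) Q), hprob hQ n⟩) (htight hX hconv hQ) (fun f hf => by
      obtain ⟨c, hc⟩ := hint f hf
      exact ⟨c, (hc X hX hconv hQ).comp (tendsto_add_atTop_nat 1)⟩)
  have hF' : WeaklyConverges (fun n => esd (evalPoly (X (n + 1)) Q)) F :=
    ProbabilityMeasure.tendsto_iff_weaklyConverges.1 hF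
  have hp := hprob hQ
  refine ⟨F, inferInstance, fun k => ?_, fun X' hX' hconv' hQ' => ?_⟩
  · choose c hc using fun k => tendsto_ntr_evalPoly hX hconv (Q ^ k)
    have hc' : ∀ k, Tendsto (fun n => ∫ t, t ^ k ∂(esd (evalPoly (X (n + 1)) Q))) atTop
        (𝓝 (c k).re) := by
      intro k
      simp only [integral_esd_eq_re (hQ _), cfc_pow', ← map_pow]
      exact (Complex.continuous_re.tendsto _).comp ((hc k).comp (tendsto_add_atTop_nat 1))
    obtain ⟨h1, h2⟩ := integrable_and_integral_pow_eq_of_weaklyConverges hF'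
      (fun n k => integrable_esd (hQ _) _) hc' k
    refine ⟨h1, ?_⟩
    rw [h2]
    have hre : ((c k).re : ℂ) = c k := by
      refine tendsto_nhds_unique ((Complex.continuous_ofReal.tendsto _).comp (hc' k)) ?_
      simp only [Function.comp_def, ofReal_integral_esd (hQ _), cfc_pow', ← map_pow]
      exact (hc k).comp (tendsto_add_atTop_nat 1)
    rw [hre]
    simpa only [← map_pow] using hc k
  · have ht := htight (X := X') hX' hconv' hQ'
    have hp' := hprob (X := X') hQ'
    suffices h : WeaklyConverges (fun n => esd (evalPoly (X' (n + 1)) Q)) F from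
      fun f => (tendsto_add_atTop_iff_nat 1).1 (h f)
    refine weaklyConverges_of_tight ht fun f hf => ?_
    obtain ⟨c, hc⟩ := hint f hf
    have h1 := (hc X hX hconv hQ).comp (tendsto_add_atTop_nat 1)
    have h2 := hF' f
    rw [tendsto_nhds_unique h2 h1]
    exact (hc X' hX' hconv' hQ').comp (tendsto_add_atTop_nat 1)

end Limit

end

/-! ### Combinatorics of circuits: how many input indices are free. -/

section

/-! ### Circuits -/

section Circuits

variable {n p : ℕ}

/-- The input index at the step `t` of a path: the `(f t, f (t + 1))` entry of a Hankel matrix is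
the input variable of this index. -/
def inputIndex (f : Fin (p + 1) → Fin n) (t : Fin p) : ℤ :=
  (n : ℤ) - 1 - (f t.castSucc : ℕ) - (f t.succ : ℕ)

/-- The closed paths of length `p` in `Fin n`. -/
def circuits (n p : ℕ) : Finset (Fin (p + 1) → Fin n) :=
  Finset.univ.filter fun f => f 0 = f (Fin.last p)

lemma mem_circuits {f : Fin (p + 1) → Fin n} : f ∈ circuits n p ↔ f 0 = f (Fin.last p) := by
  simp [circuits]

lemma hankel_apply (a : ℤ → ℝ) (i k : Fin n) :
    hankel n a i k = (a ((n : ℤ) - 1 - (i : ℕ) - (k : ℕ)) : ℂ) := by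
  simp only [hankel, Matrix.mul_apply, backwardIdentity, toeplitz, Matrix.of_apply, ite_mul,
    one_mul, zero_mul, Finset.sum_ite_eq', Finset.mem_univ, if_true]
  congr 2
  rw [Fin.val_rev, Nat.cast_sub (by omega)]
  push_cast
  ring

lemma prod_ofFn_apply (M : Fin p → Matrix (Fin n) (Fin n) ℂ) (i k : Fin n) :
    (List.ofFn M).prod i k = ∑ f : Fin (p + 1) → Fin n,
      if f 0 = i ∧ f (Fin.last p) = k then ∏ t, M t (f t.castSucc) (f t.succ) else 0 := by
  induction p generalizing i with
  | zero =>
    rw [← (Equiv.funUnique (Fin 1) (Fin n)).symm.sum_comp]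
    simp [Matrix.one_apply, ite_and]
  | succ p ih =>
    rw [List.ofFn_succ, List.prod_cons, Matrix.mul_apply]
    simp only [ih]
    rw [← (Fin.consEquiv fun _ : Fin (p + 1 + 1) => Fin n).sum_comp, ← Finset.univ_product_univ,
      Finset.sum_product]
    have h1 : ∀ (a : Fin n) (g : Fin (p + 1) → Fin n),
        (if (Fin.consEquiv fun _ : Fin (p + 1 + 1) => Fin n) (a, g) 0 = i ∧
          (Fin.consEquiv fun _ : Fin (p + 1 + 1) => Fin n) (a, g) (Fin.last (p + 1)) = k
        then ∏ t, M t ((Fin.consEquiv fun _ : Fin (p + 1 + 1) => Fin n) (a, g) t.castSucc)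
          ((Fin.consEquiv fun _ : Fin (p + 1 + 1) => Fin n) (a, g) t.succ) else 0) =
        if a = i then (if g (Fin.last p) = k then M 0 a (g 0) *
          ∏ t : Fin p, M t.succ (g t.castSucc) (g t.succ) else 0) else 0 := by
      intro a g
      rw [Fin.prod_univ_succ]
      simp only [Fin.consEquiv_apply, Fin.cons_zero, ← Fin.succ_last, Fin.cons_succ,
        Fin.castSucc_zero, ← Fin.succ_castSucc, ite_and]
    simp only [h1]
    rw [Finset.sum_comm]
    simp only [Finset.sum_ite_eq', Finset.mem_univ, if_true]
    simp only [Finset.mul_sum]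
    rw [Finset.sum_comm]
    refine Finset.sum_congr rfl fun g _ => ?_
    simp [ite_and]

lemma trace_prod_ofFn (M : Fin p → Matrix (Fin n) (Fin n) ℂ) :
    (List.ofFn M).prod.trace = ∑ f ∈ circuits n p, ∏ t, M t (f t.castSucc) (f t.succ) := by
  simp only [Matrix.trace, Matrix.diag, prod_ofFn_apply]
  rw [Finset.sum_comm, circuits, Finset.sum_filter]
  refine Finset.sum_congr rfl fun f _ => ?_
  rw [Finset.sum_eq_single (f 0)]
  · simp [eq_comm]
  · intro b _ hb
    rw [if_neg fun h => hb h.1.symm]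
  · simp

/-- A Hankel index depends on the sum of consecutive vertices, so the sum telescopes after
alternating signs. -/
lemma sum_neg_one_pow_mul_add (g : Fin (p + 1) → ℤ) :
    ∑ t : Fin p, (-1) ^ (t : ℕ) * (g t.castSucc + g t.succ) =
      g 0 - (-1) ^ p * g (Fin.last p) := by
  induction p with
  | zero => simp
  | succ p ih =>
    rw [Fin.sum_univ_castSucc]
    have := ih fun t => g t.castSucc
    simp only [Fin.val_castSucc, Fin.succ_castSucc] at this ⊢
    rw [this]
    simp only [Fin.castSucc_zero, Fin.val_last, Fin.succ_last]
    ring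

/-- The alternating sum of the differences of the input indices of two circuits with the same
starting point vanishes. -/
lemma sum_neg_one_pow_mul_inputIndex_sub {f g : Fin (p + 1) → Fin n} (hf : f ∈ circuits n p)
    (hg : g ∈ circuits n p) (h0 : f 0 = g 0) :
    ∑ t : Fin p, (-1) ^ (t : ℕ) * (inputIndex f t - inputIndex g t) = 0 := by
  have h := sum_neg_one_pow_mul_add (p := p) fun t => ((g t : ℕ) : ℤ) - (f t : ℕ)
  rw [mem_circuits] at hf hg
  simp only [← hf, ← hg, h0, sub_self, mul_zero] at h
  rw [← h]
  refine Finset.sum_congr rfl fun t _ => ?_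
  simp only [inputIndex]
  ring

lemma eq_of_inputIndex_eq {f g : Fin (p + 1) → Fin n} (h0 : f 0 = g 0)
    (h : ∀ t, inputIndex f t = inputIndex g t) : f = g := by
  funext t
  induction t using Fin.induction with
  | zero => exact h0
  | succ t ih =>
    have := h t
    simp only [inputIndex, ih] at this
    apply Fin.ext
    omega

lemma abs_inputIndex_lt (f : Fin (p + 1) → Fin n) (t : Fin p) :
    -(n : ℤ) < inputIndex f t ∧ inputIndex f t < n := by
  unfold inputIndex
  omega

end Circuits

/-! ### Counting tuples of circuits -/

section Counting

variable {α : Type*} {n p : ℕ}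

/-- The input index of a tuple of paths at a position. -/
def tupleIndex (I : α → Fin (p + 1) → Fin n) (r : α × Fin p) : ℤ := inputIndex (I r.1) r.2

/-- The coincidences, up to sign, between the input indices of a tuple of paths. -/
def coincidences (I : α → Fin (p + 1) → Fin n) : α × Fin p → α × Fin p → Bool × Bool :=
  fun r s => (decide (tupleIndex I r = tupleIndex I s), decide (tupleIndex I r = -tupleIndex I s))

lemma coincidences_eq {I I' : α → Fin (p + 1) → Fin n} (h : coincidences I = coincidences I')
    (r s : α × Fin p) : (tupleIndex I r = tupleIndex I s ↔ tupleIndex I' r = tupleIndex I' s) ∧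
      (tupleIndex I r = -tupleIndex I s ↔ tupleIndex I' r = -tupleIndex I' s) := by
  have := congrFun (congrFun h r) s
  simpa [coincidences] using this

/-- Each starting point has `n` possible values; an input index lies strictly between `-n` and `n`,
so shifting by `n` encodes it in `Fin (2 * n)`. -/
lemma card_le_of_determined [Fintype α] [DecidableEq α]
    (S : Finset (α → Fin (p + 1) → Fin n)) (R : Finset (α × Fin p))
    (h : ∀ I ∈ S, ∀ I' ∈ S, (∀ a, I a 0 = I' a 0) →
      (∀ r ∈ R, tupleIndex I r = tupleIndex I' r) → I = I') :
    S.card ≤ n ^ Fintype.card α * (2 * n) ^ R.card := by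
  let enc : (α → Fin (p + 1) → Fin n) → (α → Fin n) × (R → Fin (2 * n)) := fun I =>
    (fun a => I a 0, fun r => ⟨(tupleIndex I r.1 + n).toNat, by
      have := abs_inputIndex_lt (I r.1.1) r.1.2
      unfold tupleIndex
      omega⟩)
  have := Finset.card_le_card_of_injOn (s := S) (t := Finset.univ) enc (by simp) (by
    intro I hI I' hI' he
    refine h I hI I' hI' (fun a => congrFun (congrArg Prod.fst he) a) fun r hr => ?_
    have h1 := congrFun (congrArg Prod.snd he) ⟨r, hr⟩
    simp only [enc, Fin.mk.injEq] at h1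
    have h2 := abs_inputIndex_lt (I r.1) r.2
    have h3 := abs_inputIndex_lt (I' r.1) r.2
    unfold tupleIndex at h1 ⊢
    omega)
  simpa using this

/-- A bound for the number of tuples of circuits such that, within each class of tuples with the
same coincidences, the input indices are determined by the starting points and at most `e` of
them. -/
lemma card_le_of_forall_coincidences [Fintype α] [DecidableEq α] (hn : 1 ≤ n)
    (S : Finset (α → Fin (p + 1) → Fin n)) (e : ℕ)
    (h : ∀ I₀ ∈ S, ∃ R : Finset (α × Fin p), R.card ≤ e ∧
      ∀ I ∈ S, ∀ I' ∈ S, coincidences I = coincidences I₀ → coincidences I' = coincidences I₀ →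
        (∀ a, I a 0 = I' a 0) → (∀ r ∈ R, tupleIndex I r = tupleIndex I' r) →
        ∀ r, tupleIndex I r = tupleIndex I' r) :
    S.card ≤ n ^ Fintype.card α * (2 * n) ^ e *
      Fintype.card (α × Fin p → α × Fin p → Bool × Bool) := by
  classical
  refine (Finset.card_le_mul_card_image (f := coincidences) S
    (n ^ Fintype.card α * (2 * n) ^ e) ?_).trans ?_
  · intro b hb
    obtain ⟨I₀, hI₀, rfl⟩ := Finset.mem_image.1 hb
    obtain ⟨R, hR, hdet⟩ := h I₀ hI₀
    refine (card_le_of_determined _ R ?_).trans ?_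
    · intro I hI I' hI' h0 hr
      rw [Finset.mem_filter] at hI hI'
      have := hdet I hI.1 I' hI'.1 hI.2 hI'.2 h0 hr
      funext a
      exact eq_of_inputIndex_eq (h0 a) fun t => this (a, t)
    · gcongr
      omega
  · gcongr
    exact Finset.card_le_univ _

lemma tupleIndex_eq_of_natAbs_eq {I₀ I I' : α → Fin (p + 1) → Fin n}
    (h : coincidences I = coincidences I₀) (h' : coincidences I' = coincidences I₀)
    {r s : α × Fin p} (hrs : (tupleIndex I₀ r).natAbs = (tupleIndex I₀ s).natAbs)
    (hs : tupleIndex I s = tupleIndex I' s) : tupleIndex I r = tupleIndex I' r := by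
  have h1 := coincidences_eq h r s
  have h2 := coincidences_eq h' r s
  rcases Int.natAbs_eq_natAbs_iff.1 hrs with h3 | h3
  · rw [h1.1.2 h3, h2.1.2 h3, hs]
  · rw [h1.2.2 h3, h2.2.2 h3, hs]

/-- The closing condition of a circuit determines the value of a block with nonzero coefficient
from the other values. -/
lemma tupleIndex_eq_of_sum_ne_zero {I₀ I I' : α → Fin (p + 1) → Fin n}
    (h : coincidences I = coincidences I₀) (h' : coincidences I' = coincidences I₀) {a : α}
    (hc : I a ∈ circuits n p) (hc' : I' a ∈ circuits n p) (h0 : I a 0 = I' a 0)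
    (t₀ : Fin p) (B : Finset (Fin p))
    (hB : ∀ t ∈ B, (tupleIndex I₀ (a, t)).natAbs = (tupleIndex I₀ (a, t₀)).natAbs)
    (hout : ∀ t ∉ B, tupleIndex I (a, t) = tupleIndex I' (a, t))
    (hne : ∑ t ∈ B, (-1 : ℤ) ^ (t : ℕ) *
      (if tupleIndex I₀ (a, t) = tupleIndex I₀ (a, t₀) then 1 else -1) ≠ 0) :
    tupleIndex I (a, t₀) = tupleIndex I' (a, t₀) := by
  have h1 := sum_neg_one_pow_mul_inputIndex_sub hc hc' h0
  have h2 : ∑ t : Fin p, (-1 : ℤ) ^ (t : ℕ) * (inputIndex (I a) t - inputIndex (I' a) t) =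
      (∑ t ∈ B, (-1 : ℤ) ^ (t : ℕ) *
        (if tupleIndex I₀ (a, t) = tupleIndex I₀ (a, t₀) then 1 else -1)) *
        (tupleIndex I (a, t₀) - tupleIndex I' (a, t₀)) := by
    rw [Finset.sum_mul, ← Finset.sum_subset (Finset.subset_univ B)]
    · refine Finset.sum_congr rfl fun t ht => ?_
      have h3 := coincidences_eq h (a, t) (a, t₀)
      have h4 := coincidences_eq h' (a, t) (a, t₀)
      change (-1 : ℤ) ^ (t : ℕ) * (tupleIndex I (a, t) - tupleIndex I' (a, t)) = _
      split_ifs with h5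
      · rw [h3.1.2 h5, h4.1.2 h5]; ring
      · have h6 := (Int.natAbs_eq_natAbs_iff.1 (hB t ht)).resolve_left h5
        rw [h3.2.2 h6, h4.2.2 h6]; ring
    · intro t _ ht
      have := hout t ht
      unfold tupleIndex at this
      rw [this, sub_self, mul_zero]
  rw [h1] at h2
  exact sub_eq_zero.1 ((mul_eq_zero.1 h2.symm).resolve_left hne)

lemma sum_sign_ne_zero_of_odd {κ : Type*} {B : Finset κ} (hB : Odd B.card) {g : κ → ℤ}
    (hg : ∀ t ∈ B, Odd (g t)) : ∑ t ∈ B, g t ≠ 0 := by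
  intro h
  have : Odd (∑ t ∈ B, g t) := by
    have h1 : Even (∑ t ∈ B, (g t - 1)) := by
      rw [even_iff_two_dvd]
      exact Finset.dvd_sum fun t ht => even_iff_two_dvd.1 ((hg t ht).sub_odd odd_one)
    have h2 : ∑ t ∈ B, g t = ∑ t ∈ B, (g t - 1) + (B.card : ℤ) := by simp
    rw [h2]
    exact h1.add_odd (by exact_mod_cast hB)
  rw [h] at this
  exact absurd this (by decide)

variable {m : ℕ}

/-- The site of a position: its colour together with the absolute value of its input index. -/
def site (c : α × Fin p → Fin m) (I : α → Fin (p + 1) → Fin n) (r : α × Fin p) : Fin m × ℕ :=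
  (c r, (tupleIndex I r).natAbs)

/-- The positions with a given site. -/
def siteFiber [Fintype α] (c : α × Fin p → Fin m) (I : α → Fin (p + 1) → Fin n) (σ : Fin m × ℕ) :
    Finset (α × Fin p) :=
  Finset.univ.filter fun r => site c I r = σ

lemma mem_siteFiber [Fintype α] {c : α × Fin p → Fin m}
    {I : α → Fin (p + 1) → Fin n} {σ : Fin m × ℕ}
    {r : α × Fin p} : r ∈ siteFiber c I σ ↔ site c I r = σ := by
  simp [siteFiber]

lemma natAbs_eq_of_site_eq {c : α × Fin p → Fin m} {I : α → Fin (p + 1) → Fin n}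
    {r s : α × Fin p} (h : site c I r = site c I s) :
    (tupleIndex I r).natAbs = (tupleIndex I s).natAbs := congrArg Prod.snd h

/-- Once the pattern of coincidences is fixed, one position per site determines the indices at all
positions of that site, including signs. -/
lemma exists_representatives [Fintype α] [DecidableEq α] (c : α × Fin p → Fin m)
    (I₀ : α → Fin (p + 1) → Fin n)
    (G : Finset (Fin m × ℕ)) (hG : G ⊆ Finset.univ.image (site c I₀)) :
    ∃ R : Finset (α × Fin p), R.card ≤ G.card ∧ ∀ I I' : α → Fin (p + 1) → Fin n,
      coincidences I = coincidences I₀ → coincidences I' = coincidences I₀ →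
      (∀ r ∈ R, tupleIndex I r = tupleIndex I' r) →
      ∀ r, site c I₀ r ∈ G → tupleIndex I r = tupleIndex I' r := by
  have h1 : ∀ σ : G, ∃ r, site c I₀ r = σ := fun σ => by
    simpa using hG σ.2
  choose rep hrep using h1
  refine ⟨G.attach.image rep, Finset.card_image_le.trans (by simp), fun I I' h h' hR r hr => ?_⟩
  refine tupleIndex_eq_of_natAbs_eq h h' (s := rep ⟨_, hr⟩) (natAbs_eq_of_site_eq (c := c) ?_)
    (hR _ (Finset.mem_image_of_mem _ (Finset.mem_attach _ _)))
  rw [hrep]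

lemma sum_card_siteFiber [Fintype α] (c : α × Fin p → Fin m) (I : α → Fin (p + 1) → Fin n) :
    ∑ σ ∈ Finset.univ.image (site c I), (siteFiber c I σ).card = Fintype.card α * p := by
  have := Finset.card_eq_sum_card_image (site c I) (Finset.univ : Finset (α × Fin p))
  simpa [siteFiber] using this.symm

/-- The total excess of multiplicities over two. It is small when there are nearly as many sites as
pairs of positions, and then it restricts the possible multiplicities. -/
lemma sum_card_siteFiber_sub_two [Fintype α] (c : α × Fin p → Fin m) (I : α → Fin (p + 1) → Fin n) :
    ∑ σ ∈ Finset.univ.image (site c I), ((siteFiber c I σ).card - 2 : ℤ) =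
      Fintype.card α * p - 2 * (Finset.univ.image (site c I)).card := by
  rw [Finset.sum_sub_distrib, ← Nat.cast_sum, sum_card_siteFiber]
  simp
  ring

/-- Tuples of four circuits in which every site occurs at least twice and every circuit shares a
site with another one: the input indices are determined by the starting points and `2 p - 2` of
them. -/
lemma exists_determining_of_connected (c : Fin 4 × Fin p → Fin m)
    (I₀ : Fin 4 → Fin (p + 1) → Fin n)
    (hM : ∀ r, ∃ r' ≠ r, site c I₀ r' = site c I₀ r)
    (hN : ∀ a, ∃ t, ∃ a' ≠ a, ∃ t', site c I₀ (a', t') = site c I₀ (a, t)) :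
    ∃ R : Finset (Fin 4 × Fin p), R.card ≤ 2 * p - 2 ∧
      ∀ I I' : Fin 4 → Fin (p + 1) → Fin n, (∀ a, I a ∈ circuits n p) →
        (∀ a, I' a ∈ circuits n p) → coincidences I = coincidences I₀ →
        coincidences I' = coincidences I₀ → (∀ a, I a 0 = I' a 0) →
        (∀ r ∈ R, tupleIndex I r = tupleIndex I' r) → ∀ r, tupleIndex I r = tupleIndex I' r := by
  set Im := Finset.univ.image (site c I₀) with hIm
  have hmem : ∀ r, site c I₀ r ∈ Im := fun r => Finset.mem_image_of_mem _ (Finset.mem_univ r)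
  have htwo : ∀ σ ∈ Im, (0 : ℤ) ≤ (siteFiber c I₀ σ).card - 2 := by
    intro σ hσ
    obtain ⟨r, -, rfl⟩ := Finset.mem_image.1 hσ
    obtain ⟨r', hne, hr'⟩ := hM r
    have : 1 < (siteFiber c I₀ (site c I₀ r)).card :=
      Finset.one_lt_card.2 ⟨r, mem_siteFiber.2 rfl, r', mem_siteFiber.2 hr', hne.symm⟩
    omega
  have hsum := sum_card_siteFiber_sub_two c I₀
  rw [← hIm, Fintype.card_fin] at hsum
  have hle : (0 : ℤ) ≤ (4 : ℕ) * p - 2 * Im.card := hsum ▸ Finset.sum_nonneg htwo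
  have hthird : ∀ a b : Fin 4, ∃ d : Fin 4, d ≠ a ∧ d ≠ b := by decide
  -- There are `4 p` positions and every site occurs at least twice, hence at most `2 p` sites. With
  -- `2 p - 1` of them, one closing condition has to remove a site; with `2 p`, two must be removed.
  rcases Nat.lt_or_ge Im.card (2 * p - 1) with hb | hb
  · obtain ⟨R, hR, hdet⟩ := exists_representatives c I₀ Im le_rfl
    exact ⟨R, by omega, fun I I' _ _ h h' _ hr r => hdet I I' h h' hr r (hmem r)⟩
  · -- a circuit with a site occurring an odd number of times
    rcases Nat.lt_or_ge Im.card (2 * p) with hb' | hb'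
    · obtain ⟨a, t₀, hodd⟩ : ∃ a t₀, Odd (Finset.univ.filter
          fun t => site c I₀ (a, t) = site c I₀ (a, t₀)).card := by
        -- Here the total excess is exactly `2`. If all multiplicities within single circuits were
        -- even, a site shared by two circuits would occur at least four times. The shared sites of
        -- `0` and of a circuit `d` outside `{0, b}` would then force an excess of at least `4`,
        -- whether they coincide or not.
        by_contra! hcon
        have heven : ∀ a t₀, 2 ≤ ((siteFiber c I₀ (site c I₀ (a, t₀))).filter
            fun r => r.1 = a).card := by
          intro a t₀
          have h1 : (Finset.univ.filter fun t => site c I₀ (a, t) = site c I₀ (a, t₀)).card =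
              ((siteFiber c I₀ (site c I₀ (a, t₀))).filter fun r => r.1 = a).card := by
            refine Finset.card_bij (fun t _ => (a, t)) ?_ ?_ ?_
            · intro t ht
              simpa [mem_siteFiber] using ht
            · intro t _ t' _ h
              simpa using h
            · rintro ⟨b, t⟩ ht
              simp only [Finset.mem_filter, mem_siteFiber] at ht
              obtain ⟨ht, rfl⟩ := ht
              exact ⟨t, by simpa using ht, rfl⟩
          rw [← h1]
          have h2 := Nat.not_odd_iff_even.1 (hcon a t₀)
          have h3 : 0 < (Finset.univ.filter
              fun t => site c I₀ (a, t) = site c I₀ (a, t₀)).card :=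
            Finset.card_pos.2 ⟨t₀, by simp⟩
          obtain ⟨k, hk⟩ := h2
          omega
        have hfour : ∀ a b : Fin 4, a ≠ b → ∀ t u, site c I₀ (b, u) = site c I₀ (a, t) →
            4 ≤ ((siteFiber c I₀ (site c I₀ (a, t))).filter fun r => r.1 = a ∨ r.1 = b).card := by
          intro a b hab t u h
          rw [Finset.filter_or, Finset.card_union_of_disjoint]
          · have h1 := heven a t
            have h2 := heven b u
            rw [h] at h2
            omega
          · rw [Finset.disjoint_filter]
            intro r _ h1 h2
            exact hab (h1.symm.trans h2)
        obtain ⟨t, b, hb, u, hbu⟩ := hN 0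
        obtain ⟨d, hd0, hdb⟩ := hthird 0 b
        obtain ⟨v, e, he, w, hew⟩ := hN d
        have h4 := hfour 0 b hb.symm t u hbu
        have h4' := hfour d e he.symm v w hew
        by_cases hσ : site c I₀ (d, v) = site c I₀ (0, t)
        · have h6 : 6 ≤ (siteFiber c I₀ (site c I₀ (0, t))).card := by
            have h2 := heven d v
            rw [hσ] at h2
            calc 6 ≤ ((siteFiber c I₀ (site c I₀ (0, t))).filter
                    fun r => r.1 = 0 ∨ r.1 = b).card +
                  ((siteFiber c I₀ (site c I₀ (0, t))).filter fun r => r.1 = d).card := by omega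
              _ = ((siteFiber c I₀ (site c I₀ (0, t))).filter
                    fun r => (r.1 = 0 ∨ r.1 = b) ∨ r.1 = d).card := by
                  rw [Finset.filter_or (fun r : Fin 4 × Fin p => r.1 = 0 ∨ r.1 = b),
                    Finset.card_union_of_disjoint]
                  rw [Finset.disjoint_filter]
                  rintro r _ (h1 | h1) h2
                  · exact hd0 (h2.symm.trans h1)
                  · exact hdb (h2.symm.trans h1)
              _ ≤ _ := Finset.card_filter_le _ _
          have := Finset.single_le_sum htwo (hmem (0, t))
          omega
        · have h1 := h4.trans (Finset.card_filter_le _ _)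
          have h2 := h4'.trans (Finset.card_filter_le _ _)
          have h3 := Finset.sum_le_sum_of_subset_of_nonneg
            (f := fun σ => ((siteFiber c I₀ σ).card - 2 : ℤ))
            (show {site c I₀ (d, v), site c I₀ (0, t)} ⊆ Im by
              intro σ hσ
              rw [Finset.mem_insert, Finset.mem_singleton] at hσ
              rcases hσ with rfl | rfl <;> exact hmem _)
            (fun σ hσ _ => htwo σ hσ)
          rw [Finset.sum_pair hσ] at h3
          omega
      obtain ⟨R, hR, hdet⟩ := exists_representatives c I₀ (Im.erase (site c I₀ (a, t₀)))
        (Finset.erase_subset _ _)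
      rw [Finset.card_erase_of_mem (hmem _)] at hR
      refine ⟨R, by omega, fun I I' hc hc' h h' h0 hr r => ?_⟩
      have hG := hdet I I' h h' hr
      by_cases hs : site c I₀ r = site c I₀ (a, t₀)
      · refine tupleIndex_eq_of_natAbs_eq h h' (natAbs_eq_of_site_eq hs) ?_
        refine tupleIndex_eq_of_sum_ne_zero h h' (hc a) (hc' a) (h0 a) t₀
          (Finset.univ.filter fun t => site c I₀ (a, t) = site c I₀ (a, t₀))
          (fun t ht => natAbs_eq_of_site_eq (Finset.mem_filter.1 ht).2)
          (fun t ht => hG _ (Finset.mem_erase.2 ⟨by simpa using ht, hmem _⟩))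
          (sum_sign_ne_zero_of_odd hodd fun t _ => ?_)
        refine (Odd.pow (by decide)).mul ?_
        split_ifs <;> decide
      · exact hG r (Finset.mem_erase.2 ⟨hs, hmem _⟩)
    · have hcard : ∀ σ ∈ Im, (siteFiber c I₀ σ).card = 2 := by
        intro σ hσ
        have := Finset.single_le_sum htwo hσ
        have h2 := htwo σ hσ
        omega
      have hpair : ∀ r s, r ≠ s → site c I₀ s = site c I₀ r → ∀ x, site c I₀ x = site c I₀ r →
          x = r ∨ x = s := by
        intro r s hrs h x hx
        have h1 : siteFiber c I₀ (site c I₀ r) = {r, s} := by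
          symm
          refine Finset.eq_of_subset_of_card_le ?_ ?_
          · intro y hy
            rw [Finset.mem_insert, Finset.mem_singleton] at hy
            rcases hy with rfl | rfl
            · exact mem_siteFiber.2 rfl
            · exact mem_siteFiber.2 h
          · rw [hcard _ (hmem r), Finset.card_pair hrs]
        have h2 := mem_siteFiber.2 hx
        rw [h1] at h2
        simpa using h2
      -- Every site now occurs exactly twice, so a shared site occurs once in each of its two
      -- circuits. Circuit `d` avoids the site of `(0, t)`, whose occurrences lie in `0` and `b`;
      -- hence closing `d` recovers the site of `(d, v)`, and closing `0` then recovers the other.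
      obtain ⟨t, b, hb0, u, hbu⟩ := hN 0
      obtain ⟨d, hd0, hdb⟩ := hthird 0 b
      obtain ⟨v, e, he, w, hew⟩ := hN d
      have hB := hpair (0, t) (b, u) (by simp [hb0.symm]) hbu
      have hB' := hpair (d, v) (e, w) (by simp [he.symm]) hew
      have hdB : ∀ y, site c I₀ (d, y) ≠ site c I₀ (0, t) := by
        intro y hy
        rcases hB _ hy with h | h
        · exact hd0 (congrArg Prod.fst h)
        · exact hdb (congrArg Prod.fst h)
      set G := (Im.erase (site c I₀ (0, t))).erase (site c I₀ (d, v)) with hGdef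
      obtain ⟨R, hR, hdet⟩ := exists_representatives c I₀ G
        ((Finset.erase_subset _ _).trans (Finset.erase_subset _ _))
      rw [hGdef, Finset.card_erase_of_mem (Finset.mem_erase.2 ⟨hdB v, hmem _⟩),
        Finset.card_erase_of_mem (hmem _)] at hR
      refine ⟨R, by omega, fun I I' hc hc' h h' h0 hr r => ?_⟩
      have hG := hdet I I' h h' hr
      have hsingle : ∀ (a : Fin 4) (t₀ : Fin p), (∑ y ∈ ({t₀} : Finset (Fin p)),
          (-1 : ℤ) ^ (y : ℕ) * (if tupleIndex I₀ (a, y) = tupleIndex I₀ (a, t₀) then 1 else -1)) ≠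
          0 := by
        intro a t₀
        simp
      have hd : tupleIndex I (d, v) = tupleIndex I' (d, v) := by
        refine tupleIndex_eq_of_sum_ne_zero h h' (hc d) (hc' d) (h0 d) v {v} (by simp) ?_
          (hsingle d v)
        intro y hy
        refine hG _ (Finset.mem_erase.2 ⟨fun hs => ?_, Finset.mem_erase.2 ⟨hdB y, hmem _⟩⟩)
        rcases hB' _ hs with h1 | h1
        · exact hy (by simpa using congrArg Prod.snd h1)
        · exact he (congrArg Prod.fst h1).symm
      have hG' : ∀ r, site c I₀ r ≠ site c I₀ (0, t) → tupleIndex I r = tupleIndex I' r := by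
        intro r hr
        by_cases hs : site c I₀ r = site c I₀ (d, v)
        · exact tupleIndex_eq_of_natAbs_eq h h' (natAbs_eq_of_site_eq hs) hd
        · exact hG r (Finset.mem_erase.2 ⟨hs, Finset.mem_erase.2 ⟨hr, hmem _⟩⟩)
      by_cases hs : site c I₀ r = site c I₀ (0, t)
      · refine tupleIndex_eq_of_natAbs_eq h h' (natAbs_eq_of_site_eq hs) ?_
        refine tupleIndex_eq_of_sum_ne_zero h h' (hc 0) (hc' 0) (h0 0) t {t} (by simp) ?_
          (hsingle 0 t)
        intro y hy
        refine hG' _ fun hs => ?_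
        rcases hB _ hs with h1 | h1
        · exact hy (by simpa using congrArg Prod.snd h1)
        · exact hb0 (congrArg Prod.fst h1).symm
      · exact hG' r hs

/-- The site of a step of a path. -/
def pathSite (τ : Fin p → Fin m) (f : Fin (p + 1) → Fin n) (t : Fin p) : Fin m × ℕ :=
  (τ t, (inputIndex f t).natAbs)

/-- The circuits whose contribution to the expected trace is either zero, because some site occurs
only once, or given by the pairing of the positions with equal sites. -/
def IsRegular (τ : Fin p → Fin m) (f : Fin (p + 1) → Fin n) : Prop :=
  (∃ t, ∀ t' ≠ t, pathSite τ f t' ≠ pathSite τ f t) ∨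
  ∀ t, (Finset.univ.filter fun t' => pathSite τ f t' = pathSite τ f t).card = 2 ∧
    inputIndex f t ≠ 0 ∧ ∀ s < t, pathSite τ f s = pathSite τ f t →
      inputIndex f t = if nu s = nu t then -inputIndex f s else inputIndex f s

lemma nu_eq_iff (s t : Fin p) : nu s = nu t ↔ (-1 : ℤ) ^ (s : ℕ) = (-1) ^ (t : ℕ) := by
  unfold nu
  rw [pow_succ, pow_succ, mul_neg_one, mul_neg_one, neg_inj]
  exact_mod_cast Iff.rfl

/-- Every site occurs at least twice, so there are at most `p / 2` sites. If there are fewer,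
representatives suffice. Otherwise all sites are double and irregularity is a zero index, which is
already known, or a pair with the wrong sign. The latter has coefficient `±2` in the closing
condition and is determined by the other sites. -/
lemma exists_determining_of_not_isRegular (τ : Fin p → Fin m) (f₀ : Fin (p + 1) → Fin n)
    (hf₀ : ¬ IsRegular τ f₀) :
    ∃ R : Finset (Unit × Fin p), R.card ≤ (p - 1) / 2 ∧
      ∀ I I' : Unit → Fin (p + 1) → Fin n, (∀ a, I a ∈ circuits n p) →
        (∀ a, I' a ∈ circuits n p) → coincidences I = coincidences (fun _ => f₀) →
        coincidences I' = coincidences (fun _ => f₀) → (∀ a, I a 0 = I' a 0) →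
        (∀ r ∈ R, tupleIndex I r = tupleIndex I' r) → ∀ r, tupleIndex I r = tupleIndex I' r := by
  set c : Unit × Fin p → Fin m := fun r => τ r.2 with hcdef
  set I₀ : Unit → Fin (p + 1) → Fin n := fun _ => f₀ with hI₀
  have hsite : ∀ t, site c I₀ ((), t) = pathSite τ f₀ t := fun t => rfl
  set Im := Finset.univ.image (site c I₀) with hIm
  have hmem : ∀ r, site c I₀ r ∈ Im := fun r => Finset.mem_image_of_mem _ (Finset.mem_univ r)
  have hfib : ∀ t, (siteFiber c I₀ (pathSite τ f₀ t)).card =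
      (Finset.univ.filter fun t' => pathSite τ f₀ t' = pathSite τ f₀ t).card := by
    intro t
    symm
    refine Finset.card_bij (fun t _ => ((), t)) ?_ ?_ ?_
    · intro t ht
      simpa [mem_siteFiber, hsite] using ht
    · intro t _ t' _ h
      simpa using h
    · rintro ⟨b, t⟩ ht
      rw [mem_siteFiber] at ht
      exact ⟨t, Finset.mem_filter.2 ⟨Finset.mem_univ _, ht⟩, rfl⟩
  unfold IsRegular at hf₀
  push Not at hf₀
  obtain ⟨hM, t₀, hbad⟩ := hf₀
  have htwo : ∀ σ ∈ Im, (0 : ℤ) ≤ (siteFiber c I₀ σ).card - 2 := by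
    intro σ hσ
    obtain ⟨⟨⟨⟩, t⟩, -, rfl⟩ := Finset.mem_image.1 hσ
    obtain ⟨t', hne, ht'⟩ := hM t
    have : 1 < (siteFiber c I₀ (site c I₀ ((), t))).card :=
      Finset.one_lt_card.2 ⟨((), t), mem_siteFiber.2 rfl, ((), t'), mem_siteFiber.2 ht',
        by simpa using hne.symm⟩
    exact sub_nonneg.2 (by exact_mod_cast this)
  have hsum := sum_card_siteFiber_sub_two c I₀
  rw [← hIm, Fintype.card_unit] at hsum
  have hle : (0 : ℤ) ≤ (1 : ℕ) * p - 2 * Im.card := hsum ▸ Finset.sum_nonneg htwo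
  have hp : 0 < p := Fin.pos t₀
  by_cases hlt : 2 * Im.card < p
  · obtain ⟨R, hR, hdet⟩ := exists_representatives c I₀ Im le_rfl
    exact ⟨R, by omega, fun I I' _ _ h h' _ hr r => hdet I I' h h' hr r (hmem r)⟩
  have hcard : ∀ σ ∈ Im, (siteFiber c I₀ σ).card = 2 := by
    intro σ hσ
    have := Finset.single_le_sum htwo hσ
    have h2 := htwo σ hσ
    omega
  have hIm0 : 0 < Im.card := Finset.card_pos.2 ⟨_, hmem ((), t₀)⟩
  obtain ⟨R, hR, hdet⟩ := exists_representatives c I₀ (Im.erase (site c I₀ ((), t₀)))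
    (Finset.erase_subset _ _)
  rw [Finset.card_erase_of_mem (hmem _)] at hR
  refine ⟨R, by omega, fun I I' hc hc' h h' h0 hr r => ?_⟩
  have hG := hdet I I' h h' hr
  by_cases hs : site c I₀ r = site c I₀ ((), t₀)
  swap
  · exact hG r (Finset.mem_erase.2 ⟨hs, hmem _⟩)
  refine tupleIndex_eq_of_natAbs_eq h h' (natAbs_eq_of_site_eq hs) ?_
  have hbad := hbad (by rw [← hfib]; exact hcard _ (hmem ((), t₀)))
  by_cases hz : inputIndex f₀ t₀ = 0
  -- A zero index is visible in the pattern as the coincidence of a position with its own negative.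
  · have h1 := (coincidences_eq h ((), t₀) ((), t₀)).2.2
      (by change inputIndex f₀ t₀ = -inputIndex f₀ t₀; omega)
    have h2 := (coincidences_eq h' ((), t₀) ((), t₀)).2.2
      (by change inputIndex f₀ t₀ = -inputIndex f₀ t₀; omega)
    omega
  · obtain ⟨u, hu, hsu, hne⟩ := hbad hz
    have hpair : ∀ x, pathSite τ f₀ x = pathSite τ f₀ t₀ → x = u ∨ x = t₀ := by
      intro x hx
      have h1 : siteFiber c I₀ (pathSite τ f₀ t₀) = {((), u), ((), t₀)} := by
        symm
        refine Finset.eq_of_subset_of_card_le ?_ ?_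
        · intro y hy
          rw [Finset.mem_insert, Finset.mem_singleton] at hy
          rcases hy with rfl | rfl
          · exact mem_siteFiber.2 hsu
          · exact mem_siteFiber.2 rfl
        · rw [show (siteFiber c I₀ (pathSite τ f₀ t₀)).card = 2 from hcard _ (hmem ((), t₀)),
            Finset.card_pair (by simpa using hu.ne)]
      have h2 : ((), x) ∈ siteFiber c I₀ (pathSite τ f₀ t₀) := mem_siteFiber.2 hx
      rw [h1] at h2
      simpa using h2
    refine tupleIndex_eq_of_sum_ne_zero h h' (hc ()) (hc' ()) (h0 ()) t₀ {u, t₀} ?_ ?_ ?_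
    · intro y hy
      rw [Finset.mem_insert, Finset.mem_singleton] at hy
      rcases hy with rfl | rfl
      · exact natAbs_eq_of_site_eq (c := c) hsu
      · rfl
    · intro y hy
      refine hG _ (Finset.mem_erase.2 ⟨fun hs => hy ?_, hmem _⟩)
      simpa using hpair y hs
    · rw [Finset.sum_pair hu.ne]
      simp only [if_true, mul_one]
      change (-1 : ℤ) ^ (u : ℕ) * (if inputIndex f₀ u = inputIndex f₀ t₀ then 1 else -1) +
        (-1) ^ (t₀ : ℕ) ≠ 0
      have habs : (inputIndex f₀ u).natAbs = (inputIndex f₀ t₀).natAbs :=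
        natAbs_eq_of_site_eq (c := c) (I := I₀) (r := ((), u)) (s := ((), t₀)) hsu
      simp only [nu_eq_iff] at hne
      rcases Int.natAbs_eq_natAbs_iff.1 habs with h5 | h5 <;>
      rcases neg_one_pow_eq_or ℤ (u : ℕ) with h6 | h6 <;>
      rcases neg_one_pow_eq_or ℤ (t₀ : ℕ) with h7 | h7 <;>
      rw [h6, h7] at hne ⊢ <;> simp at hne ⊢ <;> split_ifs <;> omega

/-- The number of irregular circuits is of lower order. -/
lemma card_not_isRegular_le (hn : 1 ≤ n) (τ : Fin p → Fin m)
    (S : Finset (Fin (p + 1) → Fin n))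
    (hS : ∀ f ∈ S, f ∈ circuits n p ∧ ¬ IsRegular τ f) :
    S.card ≤ n * (2 * n) ^ ((p - 1) / 2) *
      Fintype.card (Unit × Fin p → Unit × Fin p → Bool × Bool) := by
  have hinj : Function.Injective fun (f : Fin (p + 1) → Fin n) (_ : Unit) => f :=
    fun f g h => congrFun h ()
  have := card_le_of_forall_coincidences hn (S.map ⟨_, hinj⟩) ((p - 1) / 2) (by
    intro I₀ hI₀
    obtain ⟨f₀, hf₀, rfl⟩ := Finset.mem_map.1 hI₀
    obtain ⟨R, hR, hdet⟩ := exists_determining_of_not_isRegular τ f₀ (hS f₀ hf₀).2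
    refine ⟨R, hR, fun I hI I' hI' => hdet I I' ?_ ?_⟩
    · obtain ⟨f, hf, rfl⟩ := Finset.mem_map.1 hI
      exact fun _ => (hS f hf).1
    · obtain ⟨f, hf, rfl⟩ := Finset.mem_map.1 hI'
      exact fun _ => (hS f hf).1)
  simpa using this

end Counting

end

/-! ### Independence of sites and the fourth centred moment of the trace. -/

section

/-! ### Moments of products of independent blocks -/

section Independence

variable {Ω S ι : Type*} [mΩ : MeasurableSpace Ω] {P : Measure Ω} {𝓜 : S → MeasurableSpace Ω}

lemma integral_mul_of_disjoint (hle : ∀ s, 𝓜 s ≤ mΩ) (hind : iIndep 𝓜 P) {A B : Set S}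
    (hAB : Disjoint A B) {U V : Ω → ℝ} (hU : Measurable[⨆ s ∈ A, 𝓜 s] U)
    (hV : Measurable[⨆ s ∈ B, 𝓜 s] V) :
    ∫ ω, U ω * V ω ∂P = (∫ ω, U ω ∂P) * ∫ ω, V ω ∂P := by
  have hA : ⨆ s ∈ A, 𝓜 s ≤ mΩ := iSup₂_le fun s _ => hle s
  have hB : ⨆ s ∈ B, 𝓜 s ≤ mΩ := iSup₂_le fun s _ => hle s
  have h : IndepFun U V P := by
    rw [IndepFun_iff_Indep]
    exact indep_of_indep_of_le (indep_iSup_of_disjoint hle hind hAB) hU.comap_le hV.comap_le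
  exact h.integral_fun_mul_eq_mul_integral (hU.mono hA le_rfl).aestronglyMeasurable
    (hV.mono hB le_rfl).aestronglyMeasurable

lemma integral_prod_eq_prod_image [Fintype ι] [DecidableEq S] (hle : ∀ s, 𝓜 s ≤ mΩ)
    (hind : iIndep 𝓜 P) (s : ι → S) (X : ι → Ω → ℝ) (hX : ∀ r, Measurable[𝓜 (s r)] (X r)) :
    ∫ ω, ∏ r, X r ω ∂P =
      ∏ k ∈ Finset.univ.image s, ∫ ω, ∏ r ∈ Finset.univ.filter (s · = k), X r ω ∂P := by
  have hmeas : ∀ k, Measurable[𝓜 k] fun ω => ∏ r ∈ Finset.univ.filter (s · = k), X r ω := by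
    intro k
    refine @Finset.measurable_fun_prod _ _ _ _ _ _ (𝓜 k) _ _ ?_
    intro r hr
    rw [← (Finset.mem_filter.1 hr).2]
    exact hX r
  have h : iIndepFun (fun (k : Finset.univ.image s) ω =>
      ∏ r ∈ Finset.univ.filter (s · = k), X r ω) P := by
    refine iIndep_of_iIndep_of_le (hind.precomp Subtype.val_injective) fun k => ?_
    exact (hmeas k).comap_le
  have h2 := h.integral_fun_prod_eq_prod_integral
    fun k => ((hmeas k).mono (hle k) le_rfl).aestronglyMeasurable
  rw [← Finset.prod_coe_sort (Finset.univ.image s), ← h2]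
  congr 1
  funext ω
  rw [Finset.prod_coe_sort (Finset.univ.image s)
    fun k => ∏ r ∈ Finset.univ.filter (s · = k), X r ω]
  exact (Finset.prod_fiberwise_of_maps_to
    (fun r _ => Finset.mem_image_of_mem s (Finset.mem_univ r)) _).symm

lemma abs_prod_pow_le [Fintype ι] (X : ι → ℝ) (q : ℕ) :
    |∏ r, X r| ^ q ≤ 1 + ∑ r, |X r| ^ (q * Fintype.card ι) := by
  have hnn : 0 ≤ ∑ r, |X r| ^ (q * Fintype.card ι) := Finset.sum_nonneg fun r _ => by positivity
  cases isEmpty_or_nonempty ι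
  · simp
  obtain ⟨r, -, hr⟩ := Finset.exists_max_image Finset.univ (fun r => |X r|) Finset.univ_nonempty
  have h1 : |∏ r, X r| ≤ |X r| ^ Fintype.card ι := by
    rw [Finset.abs_prod]
    calc ∏ i, |X i| ≤ ∏ _i : ι, |X r| :=
          Finset.prod_le_prod (fun i _ => abs_nonneg _) fun i hi => hr i hi
      _ = _ := by simp
  calc |∏ r, X r| ^ q ≤ (|X r| ^ Fintype.card ι) ^ q := by gcongr
    _ = |X r| ^ (q * Fintype.card ι) := by rw [← pow_mul, mul_comm]
    _ ≤ ∑ r, |X r| ^ (q * Fintype.card ι) :=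
        Finset.single_le_sum (f := fun r => |X r| ^ (q * Fintype.card ι))
          (fun r _ => by positivity) (Finset.mem_univ r)
    _ ≤ _ := by linarith

lemma integrable_abs_prod_pow [IsProbabilityMeasure P] [Fintype ι] {X : ι → Ω → ℝ} {q : ℕ} {c : ℝ}
    (hX : ∀ r, Measurable (X r))
    (hc : ∀ r, Integrable (fun ω => |X r ω| ^ (q * Fintype.card ι)) P ∧
      ∫ ω, |X r ω| ^ (q * Fintype.card ι) ∂P ≤ c) :
    Integrable (fun ω => |∏ r, X r ω| ^ q) P ∧
      ∫ ω, |∏ r, X r ω| ^ q ∂P ≤ 1 + Fintype.card ι * c := by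
  have hint : Integrable (fun ω => 1 + ∑ r, |X r ω| ^ (q * Fintype.card ι)) P :=
    (integrable_const 1).add (integrable_finsetSum _ fun r _ => (hc r).1)
  have hint' : Integrable (fun ω => |∏ r, X r ω| ^ q) P := by
    refine hint.mono' (by fun_prop) (Eventually.of_forall fun ω => ?_)
    rw [Real.norm_of_nonneg (by positivity)]
    exact abs_prod_pow_le _ _
  refine ⟨hint', (integral_mono hint' hint fun ω => abs_prod_pow_le _ _).trans ?_⟩
  rw [integral_add (integrable_const 1) (integrable_finsetSum _ fun r _ => (hc r).1),
    integral_finsetSum _ fun r _ => (hc r).1]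
  have := Finset.sum_le_sum fun r (_ : r ∈ Finset.univ) => (hc r).2
  simp at this ⊢
  linarith

end Independence

/-! ### The sites of the input -/

section Sites

/-- The `σ`-algebra of the pair of input variables at a site. -/
abbrev siteAlgebra {Ω : Type*} {m : ℕ} (x : Fin m → ℕ → ℤ → Ω → ℝ) (n : ℕ) (s : Fin m × ℕ) :
    MeasurableSpace Ω :=
  MeasurableSpace.comap (fun ω => (x s.1 n s.2 ω, x s.1 n (-(s.2 : ℤ)) ω)) inferInstance

variable {Ω : Type*} [mΩ : MeasurableSpace Ω] {P : Measure Ω} {m : ℕ} {σ ρ₂ : ℝ}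
  {x : Fin m → ℕ → ℤ → Ω → ℝ}

lemma siteAlgebra_le (hx : ∀ i, PairCorrelatedInput P (x i) σ ρ₂) {n : ℕ} (hn : 1 ≤ n)
    (s : Fin m × ℕ) : siteAlgebra x n s ≤ mΩ :=
  (((hx s.1).measurable n hn _).prodMk ((hx s.1).measurable n hn _)).comap_le

/-- Variables with opposite indices may be dependent, so independence holds only for sites. It
combines independence of the colours with independence of the pairs within one colour. -/
lemma iIndep_siteAlgebra (hx : ∀ i, PairCorrelatedInput P (x i) σ ρ₂)
    (hindep : ∀ n, 1 ≤ n → iIndepFun (fun (i : Fin m) (ω : Ω) (j : ℤ) => x i n j ω) P)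
    {n : ℕ} (hn : 1 ≤ n) : iIndep (siteAlgebra x n) P := by
  refine iIndepFun_uncurry' (X := fun i (j : ℕ) ω => (x i n j ω, x i n (-(j : ℤ)) ω))
    (fun i j => ((hx i).measurable n hn _).prodMk ((hx i).measurable n hn _)) ?_
    fun i => (hx i).indep n hn
  exact (hindep n hn).comp (fun _ (y : ℤ → ℝ) (j : ℕ) => (y j, y (-(j : ℤ)))) fun _ => by fun_prop

end Sites

/-! ### Traces as sums over circuits -/

section Trace

variable {Ω : Type*} {m n p : ℕ}

/-- The product of the input variables along a path. -/
def pathProd (x : Fin m → ℕ → ℤ → Ω → ℝ) (n : ℕ) (τ : Fin p → Fin m) (f : Fin (p + 1) → Fin n)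
    (ω : Ω) : ℝ :=
  ∏ t, x (τ t) n (inputIndex f t) ω

/-- The normalized trace of a product of scaled Hankel matrices, as a sum over circuits. -/
def scaledTrace (x : Fin m → ℕ → ℤ → Ω → ℝ) (n : ℕ) (τ : Fin p → Fin m) (ω : Ω) : ℝ :=
  (n : ℝ)⁻¹ * (Real.sqrt n)⁻¹ ^ p * ∑ f ∈ circuits n p, pathProd x n τ f ω

lemma isHermitian_scaledHankel (a : ℤ → ℝ) : (scaledHankel n a).IsHermitian := by
  ext i j
  simp only [scaledHankel, Matrix.conjTranspose_apply, Matrix.smul_apply, hankel_apply, smul_eq_mul,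
    star_mul', RCLike.star_def, Complex.conj_ofReal]
  congr 3
  ring

lemma ntr_monomial_scaledHankel (x : Fin m → ℕ → ℤ → Ω → ℝ) (τ : Fin p → Fin m) (ε : Fin p → Bool)
    (ω : Ω) :
    ntr (monomial (fun i => scaledHankel n fun j => x i n j ω) τ ε) =
      (scaledTrace x n τ ω : ℂ) := by
  have h : ∀ t, starPow (scaledHankel n fun j => x (τ t) n j ω) (ε t) =
      scaledHankel n fun j => x (τ t) n j ω := by
    intro t
    unfold starPow
    split_ifs
    · exact isHermitian_scaledHankel _
    · rfl
  simp only [ntr, monomial, h, trace_prod_ofFn, scaledTrace, pathProd]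
  push_cast
  rw [mul_assoc]
  congr 1
  rw [Finset.mul_sum]
  refine Finset.sum_congr rfl fun f _ => ?_
  simp only [scaledHankel, Matrix.smul_apply, hankel_apply, smul_eq_mul, Finset.prod_mul_distrib,
    Finset.prod_const, Finset.card_univ, Fintype.card_fin]
  push_cast
  rfl

variable {x : Fin m → ℕ → ℤ → Ω → ℝ}

lemma measurable_siteAlgebra (n : ℕ) (i : Fin m) (j : ℤ) :
    Measurable[siteAlgebra x n (i, j.natAbs)] (x i n j) := by
  have h : Measurable[siteAlgebra x n (i, j.natAbs)]
      (fun ω => (x i n j.natAbs ω, x i n (-(j.natAbs : ℤ)) ω)) := comap_measurable _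
  rcases Int.natAbs_eq j with hj | hj
  · have := measurable_fst.comp h
    rw [congrArg (x i n) hj]
    exact this
  · have := measurable_snd.comp h
    rw [congrArg (x i n) hj]
    exact this

lemma measurable_iSup_siteAlgebra {A : Set (Fin m × ℕ)} {s : Fin m × ℕ} (hs : s ∈ A) {U : Ω → ℝ}
    (hU : Measurable[siteAlgebra x n s] U) : Measurable[⨆ s ∈ A, siteAlgebra x n s] U :=
  hU.mono (le_iSup₂ (f := fun s (_ : s ∈ A) => siteAlgebra x n s) s hs) le_rfl

lemma measurable_prod_siteAlgebra {A : Set (Fin m × ℕ)} {τ : Fin p → Fin m}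
    {f : Fin (p + 1) → Fin n} {B : Finset (Fin p)} (h : ∀ t ∈ B, pathSite τ f t ∈ A) :
    Measurable[⨆ s ∈ A, siteAlgebra x n s] fun ω => ∏ t ∈ B, x (τ t) n (inputIndex f t) ω := by
  refine @Finset.measurable_fun_prod _ _ _ _ _ _ (⨆ s ∈ A, siteAlgebra x n s) _ _ ?_
  exact fun t ht => measurable_iSup_siteAlgebra (h t ht) (measurable_siteAlgebra n _ _)

variable [mΩ : MeasurableSpace Ω] {P : Measure Ω} {σ ρ₂ : ℝ}

lemma exists_integral_abs_pathProd_pow_le [IsProbabilityMeasure P]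
    (hx : ∀ i, PairCorrelatedInput P (x i) σ ρ₂) (τ : Fin p → Fin m) (q : ℕ) :
    ∃ C : ℝ, 0 ≤ C ∧ ∀ n, 1 ≤ n → ∀ f : Fin (p + 1) → Fin n,
      Integrable (fun ω => |pathProd x n τ f ω| ^ q) P ∧
      ∫ ω, |pathProd x n τ f ω| ^ q ∂P ≤ C := by
  choose c hc using fun i => (hx i).moments (q * p)
  have hC : ∀ i, c i ≤ ∑ i, |c i| := fun i => (le_abs_self _).trans
    (Finset.single_le_sum (f := fun i => |c i|) (fun i _ => abs_nonneg _) (Finset.mem_univ i))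
  refine ⟨1 + p * ∑ i, |c i|, by positivity, fun n hn f => ?_⟩
  have := integrable_abs_prod_pow (P := P) (q := q) (c := ∑ i, |c i|)
    (X := fun t => x (τ t) n (inputIndex f t)) (fun t => (hx _).measurable n hn _) (fun t => by
      rw [Fintype.card_fin]
      exact ⟨(hc _ n hn _).1, (hc _ n hn _).2.trans (hC _)⟩)
  rwa [Fintype.card_fin] at this

lemma measurable_pathProd (hx : ∀ i, PairCorrelatedInput P (x i) σ ρ₂) (hn : 1 ≤ n)
    (τ : Fin p → Fin m) (f : Fin (p + 1) → Fin n) : Measurable (pathProd x n τ f) :=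
  Finset.measurable_fun_prod _ fun _ _ => (hx _).measurable n hn _

lemma integrable_pathProd [IsProbabilityMeasure P]
    (hx : ∀ i, PairCorrelatedInput P (x i) σ ρ₂) (hn : 1 ≤ n)
    (τ : Fin p → Fin m) (f : Fin (p + 1) → Fin n) : Integrable (pathProd x n τ f) P := by
  obtain ⟨C, -, hC⟩ := exists_integral_abs_pathProd_pow_le hx τ 1
  have := (hC n hn f).1
  simp only [pow_one] at this
  exact (integrable_norm_iff (measurable_pathProd hx hn τ f).aestronglyMeasurable).1 this

variable (hx : ∀ i, PairCorrelatedInput P (x i) σ ρ₂)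
  (hindep : ∀ n, 1 ≤ n → iIndepFun (fun (i : Fin m) (ω : Ω) (j : ℤ) => x i n j ω) P)
include hx hindep

lemma integral_mul_eq_zero_of_site_notMem (hn : 1 ≤ n) (i : Fin m) (j : ℤ) {A : Set (Fin m × ℕ)}
    (hA : (i, j.natAbs) ∉ A) {V : Ω → ℝ} (hV : Measurable[⨆ s ∈ A, siteAlgebra x n s] V) :
    ∫ ω, x i n j ω * V ω ∂P = 0 := by
  rw [integral_mul_of_disjoint (siteAlgebra_le hx hn) (iIndep_siteAlgebra hx hindep hn)
    (Set.disjoint_singleton_left.2 hA)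
    (measurable_iSup_siteAlgebra (Set.mem_singleton _) (measurable_siteAlgebra n i j)) hV,
    (hx i).mean_zero n hn, zero_mul]

lemma integral_pathProd_eq_zero (hn : 1 ≤ n) (τ : Fin p → Fin m) (f : Fin (p + 1) → Fin n)
    (t : Fin p) (ht : ∀ t' ≠ t, pathSite τ f t' ≠ pathSite τ f t) :
    ∫ ω, pathProd x n τ f ω ∂P = 0 := by
  have := integral_mul_eq_zero_of_site_notMem hx hindep hn (τ t) (inputIndex f t)
    (A := {pathSite τ f t}ᶜ) (by simp [pathSite])
    (measurable_prod_siteAlgebra (B := Finset.univ.erase t) (τ := τ) (f := f)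
      fun t' ht' => ht t' (Finset.ne_of_mem_erase ht'))
  rw [← this]
  congr 1
  funext ω
  exact (Finset.mul_prod_erase Finset.univ (fun t => x (τ t) n (inputIndex f t) ω)
    (Finset.mem_univ t)).symm

/-- A product of four centred path products has expectation zero, unless every site occurs at
least twice and every path shares a site with another one. -/
lemma integral_prod_centred_eq_zero [IsProbabilityMeasure P] (hn : 1 ≤ n) (τ : Fin p → Fin m)
    (I : Fin 4 → Fin (p + 1) → Fin n)
    (h : ¬ ((∀ r, ∃ r' ≠ r, site (fun r : Fin 4 × Fin p => τ r.2) I r' =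
        site (fun r : Fin 4 × Fin p => τ r.2) I r) ∧
      ∀ a, ∃ t, ∃ a' ≠ a, ∃ t', site (fun r : Fin 4 × Fin p => τ r.2) I (a', t') =
        site (fun r : Fin 4 × Fin p => τ r.2) I (a, t))) :
    ∫ ω, ∏ a, (pathProd x n τ (I a) ω - ∫ ω', pathProd x n τ (I a) ω' ∂P) ∂P = 0 := by
  have hsite : ∀ a t, site (fun r : Fin 4 × Fin p => τ r.2) I (a, t) = pathSite τ (I a) t :=
    fun a t => rfl
  have hmeas : ∀ (a : Fin 4) (A : Set (Fin m × ℕ)),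
      (∀ b ≠ a, ∀ t, pathSite τ (I b) t ∈ A) → Measurable[⨆ s ∈ A, siteAlgebra x n s]
        fun ω => ∏ b ∈ Finset.univ.erase a,
          (pathProd x n τ (I b) ω - ∫ ω', pathProd x n τ (I b) ω' ∂P) := by
    intro a A hA
    refine @Finset.measurable_fun_prod _ _ _ _ _ _ (⨆ s ∈ A, siteAlgebra x n s) _ _ ?_
    intro b hb
    exact (measurable_prod_siteAlgebra fun t _ => hA b (Finset.ne_of_mem_erase hb) t).sub_const _
  rw [not_and_or] at h
  push Not at h
  rcases h with ⟨⟨a, t⟩, h⟩ | ⟨a, h⟩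
  -- A site met only once: the centring constant of its path is zero, and the centred variable at
  -- that site splits off from everything else.
  · have h0 := integral_pathProd_eq_zero hx hindep hn τ (I a) t fun t' ht' =>
      h (a, t') (by simpa using ht')
    have h1 := integral_mul_eq_zero_of_site_notMem hx hindep hn (τ t) (inputIndex (I a) t)
      (A := {pathSite τ (I a) t}ᶜ) (by simp [pathSite])
      ((measurable_prod_siteAlgebra (B := Finset.univ.erase t) (τ := τ) (f := I a)
        fun t' ht' => h (a, t') (by simpa using Finset.ne_of_mem_erase ht')).mul
        (hmeas a _ fun b hb t' => h (b, t') (by simp [hb])))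
    rw [← h1]
    congr 1
    funext ω
    rw [← Finset.mul_prod_erase Finset.univ _ (Finset.mem_univ a), h0, sub_zero, Pi.mul_apply,
      ← mul_assoc]
    congr 1
    exact (Finset.mul_prod_erase Finset.univ (fun t => x (τ t) n (inputIndex (I a) t) ω)
      (Finset.mem_univ t)).symm
  -- A path sharing no site with the others: its centred product is independent of the remaining
  -- factors and has mean zero.
  · have hA : Disjoint (Set.range (pathSite τ (I a))) (Set.range (pathSite τ (I a)))ᶜ :=
      disjoint_compl_right
    have h1 := integral_mul_of_disjoint (siteAlgebra_le hx hn) (iIndep_siteAlgebra hx hindep hn) hA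
      ((measurable_prod_siteAlgebra (B := Finset.univ) (τ := τ) (f := I a)
        fun t _ => Set.mem_range_self t).sub_const (∫ ω', pathProd x n τ (I a) ω' ∂P))
      (hmeas a _ fun b hb t' => by
        rintro ⟨t, ht⟩
        exact h t b hb t' ht.symm)
    have h2 : ∫ ω, (pathProd x n τ (I a) ω - ∫ ω', pathProd x n τ (I a) ω' ∂P) ∂P = 0 := by
      rw [integral_sub (integrable_pathProd hx hn τ _) (integrable_const _)]
      simp
    change _ = (∫ ω, (pathProd x n τ (I a) ω - ∫ ω', pathProd x n τ (I a) ω' ∂P) ∂P) * _ at h1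
    rw [h2, zero_mul] at h1
    rw [← h1]
    congr 1
    funext ω
    exact (Finset.mul_prod_erase Finset.univ _ (Finset.mem_univ a)).symm

/-- The fourth centred moment of the normalized trace. -/
lemma exists_integral_centred_pow_four_le [IsProbabilityMeasure P] (τ : Fin p → Fin m) :
    ∃ C : ℝ, ∀ n : ℕ, 1 ≤ n →
      Integrable (fun ω => (scaledTrace x n τ ω - ∫ ω', scaledTrace x n τ ω' ∂P) ^ 4) P ∧
      ∫ ω, (scaledTrace x n τ ω - ∫ ω', scaledTrace x n τ ω' ∂P) ^ 4 ∂P ≤ C / (n : ℝ) ^ 2 := by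
  classical
  obtain ⟨C₁, hC₁, h₁⟩ := exists_integral_abs_pathProd_pow_le hx τ 1
  obtain ⟨C₄, hC₄, h₄⟩ := exists_integral_abs_pathProd_pow_le hx τ 4
  -- The factor `8` comes from `(u + v) ^ 4 ≤ 2 ^ 3 * (u ^ 4 + v ^ 4)`. Below, `K` bounds a product
  -- of four factors by one plus the sum of their fourth powers.
  set c : ℝ := 8 * (C₄ + C₁ ^ 4) with hc
  set K : ℝ := 1 + 4 * c with hK
  have hK0 : 0 ≤ K := by positivity
  set N := Fintype.card (Fin 4 × Fin p → Fin 4 × Fin p → Bool × Bool) with hN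
  refine ⟨K * 4 ^ p * N, fun n hn => ?_⟩
  have hn0 : (0 : ℝ) < n := by exact_mod_cast hn
  set W : (Fin (p + 1) → Fin n) → Ω → ℝ :=
    fun f ω => pathProd x n τ f ω - ∫ ω', pathProd x n τ f ω' ∂P with hW
  have hWm : ∀ f, Measurable (W f) := fun f => (measurable_pathProd hx hn τ f).sub_const _
  have hE : ∀ f, |∫ ω', pathProd x n τ f ω' ∂P| ≤ C₁ := fun f => by
    have := (h₁ n hn f).2
    simp only [pow_one] at this
    exact abs_integral_le_integral_abs.trans this
  have hW4 : ∀ f, Integrable (fun ω => |W f ω| ^ 4) P ∧ ∫ ω, |W f ω| ^ 4 ∂P ≤ c := by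
    intro f
    have hle : ∀ ω, |W f ω| ^ 4 ≤ 8 * (|pathProd x n τ f ω| ^ 4 + C₁ ^ 4) := by
      intro ω
      calc |W f ω| ^ 4 ≤ (|pathProd x n τ f ω| + |∫ ω', pathProd x n τ f ω' ∂P|) ^ 4 := by
            gcongr
            exact abs_sub _ _
        _ ≤ (|pathProd x n τ f ω| + C₁) ^ 4 := by
            gcongr
            exact hE f
        _ ≤ 2 ^ (4 - 1) * (|pathProd x n τ f ω| ^ 4 + C₁ ^ 4) :=
            add_pow_le (abs_nonneg _) hC₁ 4
        _ = _ := by norm_num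
    have hint : Integrable (fun ω => 8 * (|pathProd x n τ f ω| ^ 4 + C₁ ^ 4)) P :=
      ((h₄ n hn f).1.add (integrable_const _)).const_mul _
    have hint' : Integrable (fun ω => |W f ω| ^ 4) P := by
      refine hint.mono' ((hWm f).abs.pow_const 4).aestronglyMeasurable
        (Eventually.of_forall fun ω => ?_)
      rw [Real.norm_of_nonneg (by positivity)]
      exact hle ω
    refine ⟨hint', (integral_mono hint' hint hle).trans ?_⟩
    rw [integral_const_mul, integral_add (h₄ n hn f).1 (integrable_const _)]
    have := (h₄ n hn f).2
    simp only [integral_const, probReal_univ, one_smul, hc]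
    linarith
  have hprod : ∀ I : Fin 4 → Fin (p + 1) → Fin n, Integrable (fun ω => ∏ a, W (I a) ω) P ∧
      |∫ ω, ∏ a, W (I a) ω ∂P| ≤ K := by
    intro I
    have h := integrable_abs_prod_pow (P := P) (X := fun a => W (I a)) (q := 1) (c := c)
      (fun a => hWm _) (fun a => by simpa using hW4 (I a))
    simp only [pow_one, Fintype.card_fin] at h
    refine ⟨(integrable_norm_iff
      (Finset.measurable_fun_prod _ fun a _ => hWm (I a)).aestronglyMeasurable).1 h.1, ?_⟩
    refine abs_integral_le_integral_abs.trans (h.2.trans ?_)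
    norm_num [hK]
  set D := Fintype.piFinset fun _ : Fin 4 => circuits n p with hD
  have hpow : ∀ ω, (scaledTrace x n τ ω - ∫ ω', scaledTrace x n τ ω' ∂P) ^ 4 =
      ((n : ℝ)⁻¹ * (Real.sqrt n)⁻¹ ^ p) ^ 4 * ∑ I ∈ D, ∏ a, W (I a) ω := by
    intro ω
    have h1 : scaledTrace x n τ ω - ∫ ω', scaledTrace x n τ ω' ∂P =
        (n : ℝ)⁻¹ * (Real.sqrt n)⁻¹ ^ p * ∑ f ∈ circuits n p, W f ω := by
      simp only [scaledTrace, hW]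
      rw [integral_const_mul, integral_finsetSum _ fun f _ => integrable_pathProd hx hn τ f,
        Finset.sum_sub_distrib, mul_sub]
    rw [h1, mul_pow]
    congr 1
    rw [← Finset.prod_univ_sum (fun _ : Fin 4 => circuits n p) fun _ f => W f ω]
    simp
  have hint : Integrable (fun ω => ∑ I ∈ D, ∏ a, W (I a) ω) P :=
    integrable_finsetSum _ fun I _ => (hprod I).1
  simp only [hpow]
  refine ⟨hint.const_mul _, ?_⟩
  rw [integral_const_mul, integral_finsetSum _ fun I _ => (hprod I).1]
  set Conn : (Fin 4 → Fin (p + 1) → Fin n) → Prop := fun I =>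
    ((∀ r, ∃ r' ≠ r, site (fun r : Fin 4 × Fin p => τ r.2) I r' =
        site (fun r : Fin 4 × Fin p => τ r.2) I r) ∧
      ∀ a, ∃ t, ∃ a' ≠ a, ∃ t', site (fun r : Fin 4 × Fin p => τ r.2) I (a', t') =
        site (fun r : Fin 4 × Fin p => τ r.2) I (a, t)) with hConn
  have hsum : ∑ I ∈ D, ∫ ω, ∏ a, W (I a) ω ∂P ≤ (D.filter Conn).card * K := by
    rw [← nsmul_eq_mul]
    calc ∑ I ∈ D, ∫ ω, ∏ a, W (I a) ω ∂P = ∑ I ∈ D.filter Conn, ∫ ω, ∏ a, W (I a) ω ∂P := by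
          symm
          refine Finset.sum_subset (Finset.filter_subset _ _) fun I hI hI' => ?_
          refine integral_prod_centred_eq_zero hx hindep hn τ I fun h => hI' ?_
          exact Finset.mem_filter.2 ⟨hI, h⟩
      _ ≤ _ := Finset.sum_le_card_nsmul _ _ _ fun I _ => (le_abs_self _).trans (hprod I).2
  -- Multiplying by `n ^ 2` avoids the truncated exponent `2 * p - 2`; for `p = 0` no tuple is
  -- connected.
  have hcard : (D.filter Conn).card * n ^ 2 ≤ n ^ 4 * (2 * n) ^ (2 * p) * N := by
    rcases Nat.eq_zero_or_pos p with rfl | hp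
    · have : D.filter Conn = ∅ := by
        refine Finset.filter_eq_empty_iff.2 fun I _ h => ?_
        obtain ⟨t, -⟩ := h.2 0
        exact t.elim0
      simp [this]
    · have h1 := card_le_of_forall_coincidences hn (D.filter Conn) (2 * p - 2) (by
        intro I₀ hI₀
        obtain ⟨R, hR, hdet⟩ := exists_determining_of_connected (fun r : Fin 4 × Fin p => τ r.2) I₀
          (Finset.mem_filter.1 hI₀).2.1 (Finset.mem_filter.1 hI₀).2.2
        exact ⟨R, hR, fun I hI I' hI' => hdet I I'
          (Fintype.mem_piFinset.1 (Finset.mem_filter.1 hI).1)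
          (Fintype.mem_piFinset.1 (Finset.mem_filter.1 hI').1)⟩)
      rw [Fintype.card_fin] at h1
      calc (D.filter Conn).card * n ^ 2 ≤ (n ^ 4 * (2 * n) ^ (2 * p - 2) * N) * (2 * n) ^ 2 := by
            gcongr
            omega
        _ = n ^ 4 * ((2 * n) ^ (2 * p - 2) * (2 * n) ^ 2) * N := by ring
        _ = _ := by
            rw [← pow_add]
            congr 4
            omega
  have hcard' : ((D.filter Conn).card : ℝ) * n ^ 2 ≤ n ^ 4 * (2 * n) ^ (2 * p) * N := by
    exact_mod_cast hcard
  have hfac : ((n : ℝ)⁻¹ * (Real.sqrt n)⁻¹ ^ p) ^ 4 = ((n : ℝ) ^ 4 * (n : ℝ) ^ (2 * p))⁻¹ := by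
    have : (Real.sqrt n)⁻¹ ^ p = ((Real.sqrt n) ^ p)⁻¹ := inv_pow _ _
    rw [this, ← mul_inv, inv_pow, mul_pow, ← pow_mul, mul_comm p 4,
      show 4 * p = 2 * (2 * p) by ring, pow_mul (Real.sqrt n), Real.sq_sqrt hn0.le]
  rw [hfac]
  calc ((n : ℝ) ^ 4 * (n : ℝ) ^ (2 * p))⁻¹ * ∑ I ∈ D, ∫ ω, ∏ a, W (I a) ω ∂P
      ≤ ((n : ℝ) ^ 4 * (n : ℝ) ^ (2 * p))⁻¹ * ((D.filter Conn).card * K) := by gcongr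
    _ = ((n : ℝ) ^ 4 * (n : ℝ) ^ (2 * p))⁻¹ * (((D.filter Conn).card * n ^ 2) * K) / n ^ 2 := by
        field_simp
    _ ≤ ((n : ℝ) ^ 4 * (n : ℝ) ^ (2 * p))⁻¹ * ((n ^ 4 * (2 * n) ^ (2 * p) * N) * K) / n ^ 2 := by
        gcongr
    _ = K * 4 ^ p * N / n ^ 2 := by
        rw [mul_pow, pow_mul 2, show (2 : ℝ) ^ 2 = 4 by norm_num]
        field_simp

end Trace

/-- The fourth powers have summable expectations, so their sum is almost surely finite and its terms
tend to zero. -/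
lemma ae_tendsto_zero_of_integral_pow_four_le {Ω : Type*} [MeasurableSpace Ω] {P : Measure Ω}
    {Z : ℕ → Ω → ℝ} {C : ℝ}
    (h : ∀ n, 1 ≤ n → Integrable (fun ω => Z n ω ^ 4) P ∧ ∫ ω, Z n ω ^ 4 ∂P ≤ C / (n : ℝ) ^ 2) :
    ∀ᵐ ω ∂P, Tendsto (fun n => Z n ω) atTop (𝓝 0) := by
  have hnn : ∀ n ω, 0 ≤ Z n ω ^ 4 := fun n ω => by positivity
  have hC : 0 ≤ C := by
    have := (integral_nonneg (hnn 1)).trans (h 1 le_rfl).2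
    simpa using this
  have hsum : Summable fun n : ℕ => C / ((n + 1 : ℕ) : ℝ) ^ 2 := by
    have := (summable_nat_add_iff 1).2 (Real.summable_one_div_nat_pow.2 (one_lt_two))
    simpa [div_eq_mul_inv] using this.mul_left C
  have hfin : ∫⁻ ω, ∑' n, ENNReal.ofReal (Z (n + 1) ω ^ 4) ∂P ≠ ∞ := by
    rw [lintegral_tsum fun n =>
      (h (n + 1) (by omega)).1.aestronglyMeasurable.aemeasurable.ennreal_ofReal]
    refine ne_top_of_le_ne_top hsum.tsum_ofReal_ne_top (ENNReal.tsum_le_tsum fun n => ?_)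
    rw [← ofReal_integral_eq_lintegral_ofReal (h (n + 1) (by omega)).1
      (Eventually.of_forall (hnn _))]
    exact ENNReal.ofReal_le_ofReal (h (n + 1) (by omega)).2
  have hae := ae_lt_top' (AEMeasurable.tsum fun n =>
    (h (n + 1) (by omega)).1.aestronglyMeasurable.aemeasurable.ennreal_ofReal) hfin
  filter_upwards [hae] with ω hω
  have h1 := ENNReal.tendsto_atTop_zero_of_tsum_ne_top hω.ne
  have h2 : Tendsto (fun n => Z (n + 1) ω ^ 4) atTop (𝓝 0) := by
    have := (ENNReal.tendsto_toReal ENNReal.zero_ne_top).comp h1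
    simpa [Function.comp_def, ENNReal.toReal_ofReal (hnn _ _)] using this
  have h3 : Tendsto (fun n => |Z (n + 1) ω|) atTop (𝓝 0) := by
    have := (h2.sqrt).sqrt
    simp only [Real.sqrt_zero] at this
    refine this.congr fun n => ?_
    rw [show Z (n + 1) ω ^ 4 = (Z (n + 1) ω ^ 2) ^ 2 by ring, Real.sqrt_sq (by positivity),
      Real.sqrt_sq_eq_abs]
  exact (tendsto_add_atTop_iff_nat 1).1 ((tendsto_zero_iff_abs_tendsto_zero _).2 h3)

end

/-! ### Pair partitions and the expectation along a regular circuit. -/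

section

/-! ### Pair partitions -/

section PairPartitions

variable {p : ℕ} {π π' : Finpartition (Finset.univ : Finset (Fin p))} {r s t : Fin p}

lemma mem_pairPartitions : π ∈ pairPartitions p ↔ ∀ V ∈ π.parts, V.card = 2 := by
  simp [pairPartitions]

lemma card_part_eq_two (hπ : π ∈ pairPartitions p) (t : Fin p) : (π.part t).card = 2 :=
  mem_pairPartitions.1 hπ _ (π.part_mem.2 (Finset.mem_univ t))

lemma mem_earlier : r ∈ earlier π s ↔ π.part r = π.part s ∧ r < s := by
  rw [earlier, Finset.mem_filter,
    π.mem_part_iff_part_eq_part (Finset.mem_univ _) (Finset.mem_univ _)]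

lemma part_eq_pair (hπ : π ∈ pairPartitions p) (h : r ∈ earlier π s) : π.part s = {r, s} := by
  rw [mem_earlier] at h
  symm
  refine Finset.eq_of_subset_of_card_le ?_ ?_
  · intro y hy
    rw [Finset.mem_insert, Finset.mem_singleton] at hy
    rcases hy with rfl | rfl
    · exact h.1 ▸ π.mem_part (Finset.mem_univ _)
    · exact π.mem_part (Finset.mem_univ _)
  · rw [card_part_eq_two hπ, Finset.card_pair h.2.ne]

lemma earlier_eq_singleton (hπ : π ∈ pairPartitions p) (h : r ∈ earlier π s) :
    earlier π s = {r} := by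
  have hlt := (mem_earlier.1 h).2
  rw [earlier, part_eq_pair hπ h, Finset.filter_insert, if_pos hlt, Finset.filter_singleton,
    if_neg (lt_irrefl _)]
  rfl

lemma earlier_eq_empty (hπ : π ∈ pairPartitions p) (h : r ∈ earlier π s) : earlier π r = ∅ := by
  have hlt := (mem_earlier.1 h).2
  rw [earlier, (mem_earlier.1 h).1, part_eq_pair hπ h, Finset.filter_insert,
    if_neg (lt_irrefl _), Finset.filter_singleton, if_neg hlt.not_gt]

lemma exists_partner (hπ : π ∈ pairPartitions p) (t : Fin p) :
    ∃ u ≠ t, u ∈ earlier π t ∨ t ∈ earlier π u := by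
  obtain ⟨u, hu, hut⟩ := Finset.exists_mem_ne (one_lt_two.trans_eq (card_part_eq_two hπ t).symm) t
  rw [π.mem_part_iff_part_eq_part (Finset.mem_univ _) (Finset.mem_univ _)] at hu
  refine ⟨u, hut, ?_⟩
  rcases lt_or_gt_of_ne hut with h | h
  · exact Or.inl (mem_earlier.2 ⟨hu, h⟩)
  · exact Or.inr (mem_earlier.2 ⟨hu.symm, h⟩)

lemma eq_of_forall_part_eq (h : ∀ t, π.part t = π'.part t) : π = π' := by
  have himg : ∀ π : Finpartition (Finset.univ : Finset (Fin p)),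
      π.parts = Finset.univ.image π.part := by
    intro π
    ext V
    rw [Finset.mem_image]
    constructor
    · intro hV
      obtain ⟨t, ht⟩ := π.nonempty_of_mem_parts hV
      exact ⟨t, Finset.mem_univ _, π.part_eq_of_mem hV ht⟩
    · rintro ⟨t, -, rfl⟩
      exact π.part_mem.2 (Finset.mem_univ _)
  apply Finpartition.ext
  rw [himg, himg, funext h]

end PairPartitions

/-! ### The expected trace -/

section Mean

variable {m n p : ℕ}

/-- The circuits whose input indices are matched along a pair partition, with the signs that keep
the number of free indices maximal. -/
def IsPaired (π : Finpartition (Finset.univ : Finset (Fin p))) (f : Fin (p + 1) → Fin n) : Prop :=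
  ∀ s, ∀ r ∈ earlier π s,
    inputIndex f s = if nu r = nu s then -inputIndex f r else inputIndex f r

lemma natAbs_inputIndex_eq {π : Finpartition (Finset.univ : Finset (Fin p))}
    {f : Fin (p + 1) → Fin n} (h : IsPaired π f) {r s : Fin p} (hrs : r ∈ earlier π s) :
    (inputIndex f r).natAbs = (inputIndex f s).natAbs := by
  rw [h s r hrs]
  split_ifs <;> simp

lemma blockWeight_eq_zero {σ ρ₂ : ℝ} {τ : Fin p → Fin m}
    {π : Finpartition (Finset.univ : Finset (Fin p))} {r s : Fin p} (hrs : r ∈ earlier π s)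
    (h : τ r ≠ τ s) : blockWeight σ ρ₂ τ π = 0 :=
  Finset.prod_eq_zero (Finset.mem_univ s) (Finset.prod_eq_zero hrs (by simp [h]))

open scoped Classical in
/-- The partition of the positions according to their sites. -/
def sitePartition (τ : Fin p → Fin m) (f : Fin (p + 1) → Fin n) :
    Finpartition (Finset.univ : Finset (Fin p)) :=
  Finpartition.ofSetoid (Setoid.ker (pathSite τ f))

lemma mem_part_sitePartition {τ : Fin p → Fin m} {f : Fin (p + 1) → Fin n} {s t : Fin p} :
    t ∈ (sitePartition τ f).part s ↔ pathSite τ f t = pathSite τ f s := by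
  classical
  unfold sitePartition
  rw [Finpartition.mem_part_ofSetoid_iff_rel, Setoid.ker_def, eq_comm]

lemma part_sitePartition (τ : Fin p → Fin m) (f : Fin (p + 1) → Fin n) (s : Fin p) :
    (sitePartition τ f).part s = Finset.univ.filter fun t => pathSite τ f t = pathSite τ f s := by
  ext t
  simp [mem_part_sitePartition]

lemma mem_earlier_sitePartition {τ : Fin p → Fin m} {f : Fin (p + 1) → Fin n} {r s : Fin p} :
    r ∈ earlier (sitePartition τ f) s ↔ pathSite τ f r = pathSite τ f s ∧ r < s := by
  rw [earlier, Finset.mem_filter, mem_part_sitePartition]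

variable {Ω : Type*} [mΩ : MeasurableSpace Ω] {P : Measure Ω} {σ ρ₂ : ℝ}
  {x : Fin m → ℕ → ℤ → Ω → ℝ}

/-- Equal parity pairs opposite indices and yields `ρ₂`; opposite parity repeats the index and
yields the variance. The condition `j ≠ 0` is needed because the correlation is prescribed for
nonzero indices only. -/
lemma integral_mul_eq_theta (hx : ∀ i, PairCorrelatedInput P (x i) σ ρ₂) (hn : 1 ≤ n) (i : Fin m)
    {j k : ℤ} (hj : j ≠ 0) {r s : Fin p} (h : k = if nu r = nu s then -j else j) :
    ∫ ω, x i n j ω * x i n k ω ∂P = theta σ ρ₂ r s := by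
  unfold theta
  subst h
  split_ifs with h
  · rcases Int.natAbs_eq j with hj' | hj'
    · have := (hx i).correlation n hn j.natAbs (by omega)
      rw [← hj'] at this
      simp [this]
    · have := (hx i).correlation n hn j.natAbs (by omega)
      rw [show ((j.natAbs : ℕ) : ℤ) = -j by omega, neg_neg] at this
      simp_rw [mul_comm (x i n j _)]
      simp [this]
  · have := (hx i).variance n hn j
    simp_rw [← pow_two]
    simp [this]

/-- The expectation of the product along a regular circuit. -/
lemma integral_pathProd_of_isRegular (hx : ∀ i, PairCorrelatedInput P (x i) σ ρ₂)
    (hindep : ∀ n, 1 ≤ n → iIndepFun (fun (i : Fin m) (ω : Ω) (j : ℤ) => x i n j ω) P)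
    (hn : 1 ≤ n) (τ : Fin p → Fin m) (f : Fin (p + 1) → Fin n) (hf : IsRegular τ f)
    [DecidablePred fun π : Finpartition (Finset.univ : Finset (Fin p)) => IsPaired π f] :
    ∫ ω, pathProd x n τ f ω ∂P =
      ∑ π ∈ pairPartitions p, if IsPaired π f then blockWeight σ ρ₂ τ π else 0 := by
  rcases hf with ⟨t, ht⟩ | hf
  -- A matching partition joins `t` to a position with the same absolute index; as the site of `t`
  -- is unique, the colours differ and the weight vanishes.
  · rw [integral_pathProd_eq_zero hx hindep hn τ f t ht, eq_comm]
    refine Finset.sum_eq_zero fun π hπ => ?_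
    rw [ite_eq_right_iff]
    intro hpair
    obtain ⟨u, hut, hu | hu⟩ := exists_partner hπ t
    · refine blockWeight_eq_zero hu fun hτ => ht u hut ?_
      exact Prod.ext hτ (natAbs_inputIndex_eq hpair hu)
    · refine blockWeight_eq_zero hu fun hτ => ht u hut ?_
      exact Prod.ext hτ.symm (natAbs_inputIndex_eq hpair hu).symm
  · have hπ₀ : sitePartition τ f ∈ pairPartitions p := by
      rw [mem_pairPartitions]
      intro V hV
      obtain ⟨t, ht⟩ := (sitePartition τ f).nonempty_of_mem_parts hV
      rw [← (sitePartition τ f).part_eq_of_mem hV ht, part_sitePartition]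
      exact (hf t).1
    have hpair₀ : IsPaired (sitePartition τ f) f := by
      intro s r hr
      rw [mem_earlier_sitePartition] at hr
      exact (hf s).2.2 r hr.2 hr.1
    rw [Finset.sum_eq_single_of_mem _ hπ₀, if_pos hpair₀]
    · have h1 := integral_prod_eq_prod_image (siteAlgebra_le hx hn)
        (iIndep_siteAlgebra hx hindep hn) (pathSite τ f)
        (fun t => x (τ t) n (inputIndex f t)) fun t => measurable_siteAlgebra n _ _
      rw [show ∫ ω, pathProd x n τ f ω ∂P = ∫ ω, ∏ t, x (τ t) n (inputIndex f t) ω ∂P from rfl, h1]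
      unfold blockWeight
      rw [← Finset.prod_fiberwise_of_maps_to (g := pathSite τ f)
        fun r _ => Finset.mem_image_of_mem (pathSite τ f) (Finset.mem_univ r)]
      refine Finset.prod_congr rfl fun k hk => ?_
      obtain ⟨t, -, rfl⟩ := Finset.mem_image.1 hk
      obtain ⟨r, s, hrs⟩ : ∃ r s, r ∈ earlier (sitePartition τ f) s ∧
          pathSite τ f t = pathSite τ f s := by
        obtain ⟨u, -, hu | hu⟩ := exists_partner hπ₀ t
        · exact ⟨u, t, hu, rfl⟩
        · exact ⟨t, u, hu, (mem_earlier_sitePartition.1 hu).1⟩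
      obtain ⟨hrs, hts⟩ := hrs
      have hrs' := mem_earlier_sitePartition.1 hrs
      have hfib : Finset.univ.filter (fun y => pathSite τ f y = pathSite τ f t) = {r, s} := by
        rw [hts, ← part_sitePartition, part_eq_pair hπ₀ hrs]
      rw [hfib, Finset.prod_pair hrs'.2.ne, earlier_eq_empty hπ₀ hrs, earlier_eq_singleton hπ₀ hrs,
        Finset.prod_empty, one_mul, Finset.prod_singleton]
      have hτ : τ r = τ s := congrArg Prod.fst hrs'.1
      simp_rw [Finset.prod_pair hrs'.2.ne]
      rw [if_pos hτ, one_mul, ← hτ]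
      exact integral_mul_eq_theta hx hn (τ r) (hf r).2.1 (hpair₀ s r hrs)
    -- A matching partition of nonzero weight joins positions of equal site, so its blocks lie in
    -- those of the site partition and equal them by cardinality.
    · intro π hπ hne
      rw [ite_eq_right_iff]
      intro hpair
      by_contra hw
      refine hne (eq_of_forall_part_eq fun t => ?_)
      refine Finset.eq_of_subset_of_card_le ?_ ?_
      · intro u hu
        rw [mem_part_sitePartition]
        have hsite : ∀ r s, r ∈ earlier π s → pathSite τ f r = pathSite τ f s := by
          intro r s hrs
          refine Prod.ext ?_ (natAbs_inputIndex_eq hpair hrs)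
          by_contra hτ
          exact hw (blockWeight_eq_zero hrs hτ)
        rw [π.mem_part_iff_part_eq_part (Finset.mem_univ _) (Finset.mem_univ _)] at hu
        rcases lt_trichotomy u t with h | h | h
        · exact hsite u t (mem_earlier.2 ⟨hu, h⟩)
        · rw [h]
        · exact (hsite t u (mem_earlier.2 ⟨hu.symm, h⟩)).symm
      · rw [card_part_eq_two hπ, card_part_eq_two hπ₀]

end Mean

end

/-! ### Lattice point counting and the limit of the traces. -/

section

/-! ### Counting the circuits of a pair partition -/

section Lattice

variable {p : ℕ} {π : Finpartition (Finset.univ : Finset (Fin p))}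

/-- The region of the normalized paths of a pair partition; the first coordinate is the endpoint,
the others are the values of the blocks. -/
def pathRegion (π : Finpartition (Finset.univ : Finset (Fin p))) :
    Set (Unit ⊕ {V // V ∈ π.parts} → ℝ) :=
  {y | y (Sum.inl ()) ∈ Set.Icc (0 : ℝ) 1 ∧ (∀ V, y (Sum.inr V) ∈ Set.Icc (-1 : ℝ) 1) ∧
    ∀ t, y (Sum.inl ()) + ∑ l ∈ Finset.Ici t, nu l * eta π l * y (Sum.inr (blockOf π l)) ∈
      Set.Icc (0 : ℝ) 1}

lemma isClosed_pathRegion : IsClosed (pathRegion π) := by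
  simp only [pathRegion, Set.ofPred_and, Set.ofPred_forall]
  refine (isClosed_Icc.preimage (continuous_apply _)).inter
    ((isClosed_iInter fun V => isClosed_Icc.preimage (continuous_apply _)).inter
      (isClosed_iInter fun t => isClosed_Icc.preimage ?_))
  fun_prop

/-- Used to see that the boundary is a null set, as lattice point counting requires. -/
lemma convex_pathRegion : Convex ℝ (pathRegion π) := by
  simp only [pathRegion, Set.ofPred_and, Set.ofPred_forall]
  refine ((convex_Icc 0 1).linear_preimage (LinearMap.proj (R := ℝ) (Sum.inl ()))).inter
    ((convex_iInter fun V => (convex_Icc (-1) 1).linear_preimage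
      (LinearMap.proj (R := ℝ) (Sum.inr V))).inter (convex_iInter fun t => ?_))
  have := (convex_Icc (0 : ℝ) 1).linear_preimage
    (LinearMap.proj (R := ℝ) (φ := fun _ : Unit ⊕ {V // V ∈ π.parts} => ℝ) (Sum.inl ()) +
      ∑ l ∈ Finset.Ici t, (nu l * eta π l) • LinearMap.proj (R := ℝ)
        (φ := fun _ : Unit ⊕ {V // V ∈ π.parts} => ℝ) (Sum.inr (blockOf π l)))
  convert this using 1
  ext y
  simp [LinearMap.sum_apply]

lemma isBounded_pathRegion : Bornology.IsBounded (pathRegion π) := by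
  refine (Metric.isBounded_Icc (fun _ => (-1 : ℝ)) fun _ => 1).subset fun y hy => ?_
  refine ⟨fun i => ?_, fun i => ?_⟩ <;> rcases i with ⟨⟩ | V
  · exact le_trans (by norm_num) hy.1.1
  · exact (hy.2.1 V).1
  · exact hy.1.2
  · exact (hy.2.1 V).2

/-- The product of indicators is the indicator of the set cut out by the vertex constraints, and
Fubini's theorem on the box turns its volume into the iterated integral. -/
lemma volume_pathRegion : volume.real (pathRegion π) = blockIntegral π := by
  set E : Set (ℝ × ({V // V ∈ π.parts} → ℝ)) :=
    {y | ∀ t, y.1 + ∑ l ∈ Finset.Ici t, nu l * eta π l * y.2 (blockOf π l) ∈ Set.Icc (0 : ℝ) 1}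
    with hE
  have hEm : MeasurableSet E := by
    simp only [hE, Set.ofPred_forall]
    refine (isClosed_iInter fun t => isClosed_Icc.preimage ?_).measurableSet
    fun_prop
  have hmp : MeasurePreserving (fun y : Unit ⊕ {V // V ∈ π.parts} → ℝ =>
      (y (Sum.inl ()), fun V => y (Sum.inr V))) volume volume :=
    ((volume_preserving_funUnique Unit ℝ).prod
      (MeasurePreserving.id (volume : Measure ({V // V ∈ π.parts} → ℝ)))).comp
      (volume_measurePreserving_sumPiEquivProdPi fun _ : Unit ⊕ {V // V ∈ π.parts} => ℝ)
  have hBox : MeasurableSet (Set.Icc (0 : ℝ) 1 ×ˢ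
      (Set.Icc (fun _ => -1) (fun _ => 1) : Set ({V // V ∈ π.parts} → ℝ))) :=
    measurableSet_Icc.prod measurableSet_Icc
  have hpre : pathRegion π = (fun y : Unit ⊕ {V // V ∈ π.parts} → ℝ =>
      (y (Sum.inl ()), fun V => y (Sum.inr V))) ⁻¹' (E ∩ (Set.Icc (0 : ℝ) 1 ×ˢ
        (Set.Icc (fun _ => -1) (fun _ => 1) : Set ({V // V ∈ π.parts} → ℝ)))) := by
    ext y
    simp only [pathRegion, hE, Set.mem_ofPred_eq, Set.mem_preimage, Set.mem_inter_iff,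
      Set.mem_prod, Set.mem_Icc, Pi.le_def]
    constructor
    · rintro ⟨h1, h2, h3⟩
      exact ⟨h3, h1, fun V => (h2 V).1, fun V => (h2 V).2⟩
    · rintro ⟨h3, h1, h2, h4⟩
      exact ⟨h1, fun V => ⟨h2 V, h4 V⟩, h3⟩
  have hind : ∀ y : ℝ × ({V // V ∈ π.parts} → ℝ),
      ∏ t : Fin p, (Set.Icc (0 : ℝ) 1).indicator (fun _ => (1 : ℝ))
        (y.1 + ∑ l ∈ Finset.Ici t, nu l * eta π l * y.2 (blockOf π l)) =
      E.indicator (fun _ => (1 : ℝ)) y := by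
    intro y
    by_cases hy : y ∈ E
    · rw [Set.indicator_of_mem hy]
      exact Finset.prod_eq_one fun t _ => Set.indicator_of_mem (hy t) _
    · rw [Set.indicator_of_notMem hy]
      simp only [hE, Set.mem_ofPred_eq, not_forall] at hy
      obtain ⟨t, ht⟩ := hy
      exact Finset.prod_eq_zero (Finset.mem_univ t) (Set.indicator_of_notMem ht _)
  have hfin : (volume : Measure (ℝ × ({V // V ∈ π.parts} → ℝ))) (Set.Icc (0 : ℝ) 1 ×ˢ
      (Set.Icc (fun _ => -1) (fun _ => 1) : Set ({V // V ∈ π.parts} → ℝ))) ≠ ∞ :=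
    (isCompact_Icc.prod isCompact_Icc).measure_lt_top.ne
  have hint : IntegrableOn (E.indicator fun _ => (1 : ℝ)) (Set.Icc (0 : ℝ) 1 ×ˢ
      (Set.Icc (fun _ => -1) (fun _ => 1) : Set ({V // V ∈ π.parts} → ℝ)))
      ((volume : Measure ℝ).prod volume) :=
    (integrableOn_const (hs := hfin)).indicator hEm
  rw [hpre, measureReal_def, hmp.measure_preimage (hEm.inter hBox).nullMeasurableSet,
    ← measureReal_def]
  unfold blockIntegral
  have h := setIntegral_prod _ hint
  rw [← Measure.volume_eq_prod, integral_indicator_const _ hEm, measureReal_restrict_apply hEm] at h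
  simp only [smul_eq_mul, mul_one] at h
  rw [h]
  refine integral_congr_ae (Eventually.of_forall fun z₀ => ?_)
  refine integral_congr_ae (Eventually.of_forall fun z => ?_)
  exact (hind (z₀, z)).symm

/-- The value of `η_π` as an integer. -/
def etaInt (π : Finpartition (Finset.univ : Finset (Fin p))) (s : Fin p) : ℤ :=
  ∏ r ∈ earlier π s, if nu r = nu s then -1 else 1

lemma cast_etaInt (s : Fin p) : (etaInt π s : ℝ) = eta π s := by
  simp only [etaInt, eta]
  push_cast
  rfl

/-- The value of `ν` as an integer. -/
def nuInt (s : Fin p) : ℤ := (-1) ^ ((s : ℕ) + 1)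

lemma cast_nuInt (s : Fin p) : (nuInt s : ℝ) = nu s := by
  simp [nuInt, nu]

/-- The first element of a block. -/
def blockMin (V : {V // V ∈ π.parts}) : Fin p := V.1.min' (π.nonempty_of_mem_parts V.2)

lemma blockMin_of_earlier_eq_empty {l : Fin p} (h : earlier π l = ∅) :
    blockMin (blockOf π l) = l := by
  have hmem : l ∈ π.part l := π.mem_part (Finset.mem_univ l)
  refine le_antisymm (Finset.min'_le _ _ hmem) (Finset.le_min' _ _ _ fun y hy => ?_)
  by_contra hlt
  rw [not_le] at hlt
  have : y ∈ earlier π l := Finset.mem_filter.2 ⟨hy, hlt⟩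
  rw [h] at this
  exact Finset.notMem_empty _ this

lemma blockOf_eq_of_mem_earlier {r l : Fin p} (h : r ∈ earlier π l) :
    blockOf π r = blockOf π l :=
  Subtype.ext (mem_earlier.1 h).1

lemma blockMin_of_mem_earlier (hπ : π ∈ pairPartitions p) {r l : Fin p} (h : r ∈ earlier π l) :
    blockMin (blockOf π l) = r := by
  rw [← blockOf_eq_of_mem_earlier h]
  exact blockMin_of_earlier_eq_empty (earlier_eq_empty hπ h)

lemma blockOf_blockMin (V : {V // V ∈ π.parts}) : blockOf π (blockMin V) = V :=
  Subtype.ext (π.part_eq_of_mem V.2 (Finset.min'_mem _ _))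

lemma earlier_blockMin (V : {V // V ∈ π.parts}) : earlier π (blockMin V) = ∅ := by
  rw [earlier, Finset.filter_eq_empty_iff]
  intro y hy
  rw [not_lt]
  exact Finset.min'_le _ _ ((congrArg Subtype.val (blockOf_blockMin V)) ▸ hy)

lemma etaInt_of_earlier_eq_empty {l : Fin p} (h : earlier π l = ∅) : etaInt π l = 1 := by
  simp [etaInt, h]

lemma etaInt_of_mem_earlier (hπ : π ∈ pairPartitions p) {r l : Fin p} (h : r ∈ earlier π l) :
    etaInt π l = if nu r = nu l then -1 else 1 := by
  simp [etaInt, earlier_eq_singleton hπ h]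

lemma nuInt_mul_self (l : Fin p) : nuInt l * nuInt l = 1 := by
  unfold nuInt
  rw [← mul_pow]
  simp

lemma nuInt_eq_iff (r s : Fin p) : nu r = nu s ↔ nuInt r = nuInt s := by
  rw [← cast_nuInt, ← cast_nuInt]
  exact Int.cast_inj

/-- The sign `η` makes the two contributions of each block cancel, so a paired path closes for any
choice of block values. -/
lemma sum_nuInt_mul_etaInt_eq_zero (hπ : π ∈ pairPartitions p) (w : {V // V ∈ π.parts} → ℤ) :
    ∑ l, nuInt l * etaInt π l * w (blockOf π l) = 0 := by
  rw [← Finset.sum_fiberwise Finset.univ (blockOf π)]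
  refine Finset.sum_eq_zero fun V _ => ?_
  obtain ⟨r, s, hrs, hV⟩ : ∃ r s, r ∈ earlier π s ∧ blockOf π s = V := by
    obtain ⟨u, -, hu | hu⟩ := exists_partner hπ (blockMin V)
    · exact ⟨u, _, hu, blockOf_blockMin V⟩
    · exact ⟨_, u, hu, by rw [← blockOf_eq_of_mem_earlier hu, blockOf_blockMin]⟩
  have hfib : Finset.univ.filter (fun l => blockOf π l = V) = {r, s} := by
    rw [← part_eq_pair hπ hrs]
    ext l
    rw [π.mem_part_iff_part_eq_part (Finset.mem_univ _) (Finset.mem_univ _), ← hV]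
    simp [blockOf]
  rw [hfib, Finset.sum_pair (mem_earlier.1 hrs).2.ne, blockOf_eq_of_mem_earlier hrs,
    etaInt_of_earlier_eq_empty (earlier_eq_empty hπ hrs), etaInt_of_mem_earlier hπ hrs]
  simp only [nuInt_eq_iff]
  have h1 : nuInt r = 1 ∨ nuInt r = -1 := neg_one_pow_eq_or ℤ _
  have h2 : nuInt s = 1 ∨ nuInt s = -1 := neg_one_pow_eq_or ℤ _
  rcases h1 with h1 | h1 <;> rcases h2 with h2 | h2 <;> simp [h1, h2]

lemma two_mul_card_parts (hπ : π ∈ pairPartitions p) : 2 * π.parts.card = p := by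
  have := π.sum_card_parts
  rw [Finset.sum_congr rfl (mem_pairPartitions.1 hπ)] at this
  simp at this
  omega

lemma eq_last_add_sum (g : Fin (p + 1) → ℤ) (t : Fin (p + 1)) :
    g t = g (Fin.last p) + ∑ l : Fin p with t ≤ l.castSucc, (g l.castSucc - g l.succ) := by
  induction t using Fin.reverseInduction with
  | last =>
    rw [Finset.filter_false_of_mem fun l _ => not_le.2 (Fin.castSucc_lt_last l)]
    simp
  | cast i ih =>
    have : (Finset.univ.filter fun l : Fin p => i.castSucc ≤ l.castSucc) =
        insert i (Finset.univ.filter fun l : Fin p => i.succ ≤ l.castSucc) := by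
      ext l
      simp only [Finset.mem_filter, Finset.mem_univ, true_and, Finset.mem_insert,
        Fin.castSucc_le_castSucc_iff, Fin.succ_le_castSucc_iff]
      rw [le_iff_eq_or_lt, eq_comm]
    rw [this, Finset.sum_insert (by simp), add_left_comm, ← ih]
    ring

/-- The path `f` after the reflection of every second vertex. -/
def unfolded {n : ℕ} (f : Fin (p + 1) → Fin (n + 1)) (t : Fin (p + 1)) : ℤ :=
  if Even (t : ℕ) then (f t : ℕ) else n - (f t : ℕ)

/-- Reflecting every second vertex turns sums of consecutive vertices into differences, up to the
sign `ν`. The vertices thereby become partial sums of the block values. -/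
lemma unfolded_sub {n : ℕ} (f : Fin (p + 1) → Fin (n + 1)) (l : Fin p) :
    unfolded f l.castSucc - unfolded f l.succ = nuInt l * inputIndex f l := by
  unfold unfolded nuInt inputIndex
  simp only [Fin.val_castSucc, Fin.val_succ, Nat.even_add_one]
  rcases Nat.even_or_odd (l : ℕ) with h | h
  · rw [Odd.neg_one_pow h.add_one]
    simp only [h, if_true, not_true_eq_false, if_false]
    push_cast
    ring
  · rw [Even.neg_one_pow h.add_one]
    simp only [Nat.not_even_iff_odd.2 h, if_false, not_false_eq_true, if_true]
    push_cast
    ring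

/-- The integer coordinates of a path: its endpoint and the values of its blocks. -/
def pathCoord {n : ℕ} (π : Finpartition (Finset.univ : Finset (Fin p)))
    (f : Fin (p + 1) → Fin (n + 1)) : Unit ⊕ {V // V ∈ π.parts} → ℤ :=
  Sum.elim (fun _ => ((f (Fin.last p) : ℕ) : ℤ)) fun V => inputIndex f (blockMin V)

lemma inputIndex_eq_etaInt_mul {n : ℕ} (hπ : π ∈ pairPartitions p)
    {f : Fin (p + 1) → Fin (n + 1)} (hf : IsPaired π f) (l : Fin p) :
    inputIndex f l = etaInt π l * pathCoord π f (Sum.inr (blockOf π l)) := by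
  change _ = etaInt π l * inputIndex f (blockMin (blockOf π l))
  rcases Finset.eq_empty_or_nonempty (earlier π l) with h | ⟨r, h⟩
  · rw [blockMin_of_earlier_eq_empty h, etaInt_of_earlier_eq_empty h, one_mul]
  · rw [blockMin_of_mem_earlier hπ h, etaInt_of_mem_earlier hπ h, hf l r h]
    split_ifs <;> simp

lemma unfolded_eq_sum {n : ℕ} (hπ : π ∈ pairPartitions p)
    {f : Fin (p + 1) → Fin (n + 1)} (hf : IsPaired π f) (t : Fin p) :
    unfolded f t.castSucc = pathCoord π f (Sum.inl ()) +
      ∑ l ∈ Finset.Ici t, nuInt l * etaInt π l * pathCoord π f (Sum.inr (blockOf π l)) := by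
  rw [eq_last_add_sum (unfolded f)]
  congr 1
  · unfold unfolded
    rw [if_pos (by rw [Fin.val_last, ← two_mul_card_parts hπ]; exact even_two_mul _)]
    rfl
  · refine Finset.sum_congr ?_ fun l _ => ?_
    · ext l
      simp
    · rw [unfolded_sub, inputIndex_eq_etaInt_mul hπ hf, mul_assoc]

lemma unfolded_mem_Icc {n : ℕ} (f : Fin (p + 1) → Fin (n + 1)) (t : Fin (p + 1)) :
    unfolded f t ∈ Set.Icc (0 : ℤ) n := by
  unfold unfolded
  rw [Set.mem_Icc]
  split_ifs <;> omega

lemma pathCoord_injOn {n : ℕ} (hπ : π ∈ pairPartitions p) :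
    Set.InjOn (pathCoord (n := n) π) {f | f ∈ circuits (n + 1) p ∧ IsPaired π f} := by
  rintro f ⟨hfc, hf⟩ g ⟨hgc, hg⟩ h
  rw [mem_circuits] at hfc hgc
  refine eq_of_inputIndex_eq ?_ fun l => ?_
  · rw [hfc, hgc]
    have := congrFun h (Sum.inl ())
    simp only [pathCoord, Sum.elim_inl] at this
    exact Fin.ext (by exact_mod_cast this)
  · rw [inputIndex_eq_etaInt_mul hπ hf, inputIndex_eq_etaInt_mul hπ hg, h]

/-- The partial sums `U` of the prescribed coordinates are the vertices of the unfolded path;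
reflecting the odd ones back recovers `f`. The constraints in `h0` and `ht` say exactly that these
vertices lie in range. -/
lemma exists_pathCoord_eq {n : ℕ} (hπ : π ∈ pairPartitions p)
    (w : Unit ⊕ {V // V ∈ π.parts} → ℤ) (h0 : w (Sum.inl ()) ∈ Set.Icc (0 : ℤ) n)
    (ht : ∀ t, w (Sum.inl ()) + ∑ l ∈ Finset.Ici t,
      nuInt l * etaInt π l * w (Sum.inr (blockOf π l)) ∈ Set.Icc (0 : ℤ) n) :
    ∃ f : Fin (p + 1) → Fin (n + 1), (f ∈ circuits (n + 1) p ∧ IsPaired π f) ∧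
      pathCoord π f = w := by
  set U : Fin (p + 1) → ℤ := fun t => w (Sum.inl ()) + ∑ l : Fin p with t ≤ l.castSucc,
    nuInt l * etaInt π l * w (Sum.inr (blockOf π l)) with hU
  have hlast : U (Fin.last p) = w (Sum.inl ()) := by
    simp only [hU]
    rw [Finset.filter_false_of_mem fun l _ => not_le.2 (Fin.castSucc_lt_last l)]
    simp
  have hUmem : ∀ t, U t ∈ Set.Icc (0 : ℤ) n := by
    intro t
    induction t using Fin.lastCases with
    | last => rwa [hlast]
    | cast t =>
      convert ht t using 3
      ext l
      simp
  have hsub : ∀ l : Fin p, U l.castSucc - U l.succ =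
      nuInt l * (etaInt π l * w (Sum.inr (blockOf π l))) := by
    intro i
    have : (Finset.univ.filter fun l : Fin p => i.castSucc ≤ l.castSucc) =
        insert i (Finset.univ.filter fun l : Fin p => i.succ ≤ l.castSucc) := by
      ext l
      simp only [Finset.mem_filter, Finset.mem_univ, true_and, Finset.mem_insert,
        Fin.castSucc_le_castSucc_iff, Fin.succ_le_castSucc_iff]
      rw [le_iff_eq_or_lt, eq_comm]
    simp only [hU]
    rw [this, Finset.sum_insert (by simp)]
    ring
  have hzero : U 0 = U (Fin.last p) := by
    rw [hlast]
    simp only [hU, Fin.zero_le, Finset.filter_true]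
    rw [sum_nuInt_mul_etaInt_eq_zero hπ fun V => w (Sum.inr V), add_zero]
  set f : Fin (p + 1) → Fin (n + 1) := fun t =>
    ⟨(if Even (t : ℕ) then U t else n - U t).toNat, by
      have := hUmem t
      rw [Set.mem_Icc] at this
      split_ifs <;> omega⟩ with hf
  have hunf : ∀ t, unfolded f t = U t := by
    intro t
    have := hUmem t
    rw [Set.mem_Icc] at this
    simp only [unfolded, hf]
    split_ifs <;> omega
  have hidx : ∀ l, inputIndex f l = etaInt π l * w (Sum.inr (blockOf π l)) := by
    intro l
    have h1 := unfolded_sub f l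
    rw [hunf, hunf, hsub] at h1
    have h2 := nuInt_mul_self l
    calc inputIndex f l = nuInt l * nuInt l * inputIndex f l := by rw [h2, one_mul]
      _ = nuInt l * (nuInt l * (etaInt π l * w (Sum.inr (blockOf π l)))) := by rw [h1, mul_assoc]
      _ = _ := by rw [← mul_assoc, h2, one_mul]
  have hfl : ((f (Fin.last p) : ℕ) : ℤ) = w (Sum.inl ()) := by
    rw [← hlast, ← hunf, unfolded,
      if_pos (by rw [Fin.val_last, ← two_mul_card_parts hπ]; exact even_two_mul _)]
  refine ⟨f, ⟨?_, ?_⟩, ?_⟩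
  · rw [mem_circuits]
    apply Fin.ext
    have h1 : ((f 0 : ℕ) : ℤ) = U 0 := by
      rw [← hunf, unfolded, if_pos (by simp)]
    rw [hzero, hlast, ← hfl] at h1
    exact_mod_cast h1
  · intro s r hrs
    rw [hidx, hidx, blockOf_eq_of_mem_earlier hrs,
      etaInt_of_earlier_eq_empty (earlier_eq_empty hπ hrs), etaInt_of_mem_earlier hπ hrs]
    split_ifs <;> simp
  · funext i
    rcases i with ⟨⟩ | V
    · exact hfl
    · change inputIndex f (blockMin V) = _
      rw [hidx, blockOf_blockMin, etaInt_of_earlier_eq_empty (earlier_blockMin V), one_mul]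

-- The vertices of a path in `Fin (n + 1)` range over `0, …, n`, so division by `n` matches the path
-- constraints with the region exactly. Hence the size `n + 1` goes with the mesh `1 / n`.
open scoped Pointwise in
lemma card_pathRegion_inter {n : ℕ} (hn : n ≠ 0) (hπ : π ∈ pairPartitions p)
    [DecidablePred (IsPaired (n := n + 1) π)] :
    Nat.card ↑(pathRegion π ∩ (n : ℝ)⁻¹ •
      (Submodule.span ℤ (Set.range (Pi.basisFun ℝ (Unit ⊕ {V // V ∈ π.parts}))) :
        Set (Unit ⊕ {V // V ∈ π.parts} → ℝ))) =
      ((circuits (n + 1) p).filter (IsPaired π)).card := by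
  have : NeZero n := ⟨hn⟩
  have hn0 : (0 : ℝ) < n := by positivity
  set Φ : (Fin (p + 1) → Fin (n + 1)) → Unit ⊕ {V // V ∈ π.parts} → ℝ :=
    fun f i => (n : ℝ)⁻¹ * (pathCoord π f i : ℝ) with hΦ
  have hscale : ∀ (w : Unit ⊕ {V // V ∈ π.parts} → ℤ) (t : Fin p),
      (n : ℝ)⁻¹ * (w (Sum.inl ()) : ℝ) + ∑ l ∈ Finset.Ici t, nu l * eta π l *
        ((n : ℝ)⁻¹ * (w (Sum.inr (blockOf π l)) : ℝ)) =
      (n : ℝ)⁻¹ * ((w (Sum.inl ()) + ∑ l ∈ Finset.Ici t,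
        nuInt l * etaInt π l * w (Sum.inr (blockOf π l)) : ℤ) : ℝ) := by
    intro w t
    push_cast
    rw [mul_add, Finset.mul_sum]
    congr 1
    refine Finset.sum_congr rfl fun l _ => ?_
    rw [cast_nuInt, cast_etaInt]
    ring
  have hIcc : ∀ z : ℤ, (n : ℝ)⁻¹ * (z : ℝ) ∈ Set.Icc (0 : ℝ) 1 ↔ z ∈ Set.Icc (0 : ℤ) n := by
    intro z
    rw [Set.mem_Icc, Set.mem_Icc, inv_mul_le_one₀ hn0, mul_nonneg_iff_of_pos_left (inv_pos.2 hn0)]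
    exact_mod_cast Iff.rfl
  have hset : pathRegion π ∩ (n : ℝ)⁻¹ •
      (Submodule.span ℤ (Set.range (Pi.basisFun ℝ (Unit ⊕ {V // V ∈ π.parts}))) :
        Set (Unit ⊕ {V // V ∈ π.parts} → ℝ)) =
      Φ '' {f | f ∈ circuits (n + 1) p ∧ IsPaired π f} := by
    ext y
    rw [Set.mem_inter_iff, ← Submodule.coe_pointwise_smul, SetLike.mem_coe,
      BoxIntegral.unitPartition.mem_smul_span_iff]
    constructor
    · rintro ⟨hy, hL⟩
      choose w hw using hL
      have hyw : y = fun i => (n : ℝ)⁻¹ * (w i : ℝ) := by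
        funext i
        have := hw i
        simp only [eq_intCast] at this
        rw [this, inv_mul_cancel_left₀ hn0.ne']
      subst hyw
      obtain ⟨f, hf, hfw⟩ := exists_pathCoord_eq hπ w ((hIcc _).1 hy.1)
        fun t => (hIcc _).1 (by rw [← hscale]; exact hy.2.2 t)
      exact ⟨f, hf, by simp only [hΦ, hfw]⟩
    · rintro ⟨f, hf, rfl⟩
      refine ⟨⟨(hIcc _).2 ?_, fun V => ?_, fun t => ?_⟩, fun i => ⟨pathCoord π f i, ?_⟩⟩
      · simp only [pathCoord, Sum.elim_inl, Set.mem_Icc]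
        omega
      · have := abs_inputIndex_lt f (blockMin V)
        have h1 : -(n : ℝ) ≤ (inputIndex f (blockMin V) : ℝ) := by
          exact_mod_cast (by omega : -(n : ℤ) ≤ inputIndex f (blockMin V))
        have h2 : (inputIndex f (blockMin V) : ℝ) ≤ n := by
          exact_mod_cast (by omega : inputIndex f (blockMin V) ≤ (n : ℤ))
        change (n : ℝ)⁻¹ * (inputIndex f (blockMin V) : ℝ) ∈ _
        rw [Set.mem_Icc, inv_mul_le_one₀ hn0, ← div_eq_inv_mul, le_div_iff₀ hn0]
        exact ⟨by linarith, h2⟩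
      · simp only [hΦ]
        rw [hscale, hIcc, ← unfolded_eq_sum hπ hf.2]
        exact unfolded_mem_Icc _ _
      · simp only [hΦ, eq_intCast]
        rw [mul_inv_cancel_left₀ hn0.ne']
  have hinj : Set.InjOn Φ {f | f ∈ circuits (n + 1) p ∧ IsPaired π f} := by
    intro f hf g hg h
    refine pathCoord_injOn hπ hf hg (funext fun i => ?_)
    have := congrFun h i
    simp only [hΦ] at this
    exact_mod_cast mul_left_cancel₀ (inv_ne_zero hn0.ne') this
  rw [Nat.card_coe_set_eq, hset, hinj.ncard_image, ← Set.ncard_coe_finset]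
  congr 1
  ext f
  simp

-- The number of lattice points of mesh `1 / n` is asymptotic to the volume times `n ^ (k + 1)` with
-- `p = 2 k`. The factor `(n / (n + 1)) ^ (k + 1)` adjusts for the normalization by the matrix size.
open scoped Classical in
lemma tendsto_card_isPaired (hπ : π ∈ pairPartitions p) :
    Tendsto (fun n : ℕ => (n : ℝ)⁻¹ * (Real.sqrt n)⁻¹ ^ p *
      (((circuits n p).filter (IsPaired π)).card : ℝ)) atTop (𝓝 (blockIntegral π)) := by
  have h1 := tendsto_card_div_pow_atTop_volume (pathRegion π) isBounded_pathRegion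
    isClosed_pathRegion.measurableSet (convex_pathRegion.addHaar_frontier volume)
  rw [volume_pathRegion] at h1
  have h2 : Tendsto (fun n : ℕ => ((n : ℝ) / ((n + 1 : ℕ) : ℝ)) ^ (π.parts.card + 1)) atTop
      (𝓝 (1 ^ (π.parts.card + 1))) := by
    refine Tendsto.pow ?_ _
    simpa using tendsto_natCast_div_add_atTop (1 : ℝ)
  have h3 := h2.mul h1
  rw [one_pow, one_mul] at h3
  refine (tendsto_add_atTop_iff_nat 1).1 (h3.congr' ?_)
  filter_upwards [eventually_ne_atTop 0] with n hn
  rw [card_pathRegion_inter hn hπ, Fintype.card_sum, Fintype.card_unit, Fintype.card_coe,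
    add_comm 1]
  have hn0 : (n : ℝ) ≠ 0 := by exact_mod_cast hn
  have hn1 : ((n + 1 : ℕ) : ℝ) ≠ 0 := by positivity
  have hs : (Real.sqrt ((n + 1 : ℕ) : ℝ))⁻¹ ^ p = (((n + 1 : ℕ) : ℝ) ^ π.parts.card)⁻¹ := by
    have hp := two_mul_card_parts hπ
    calc (Real.sqrt ((n + 1 : ℕ) : ℝ))⁻¹ ^ p
        = (Real.sqrt ((n + 1 : ℕ) : ℝ))⁻¹ ^ (2 * π.parts.card) := by rw [hp]
      _ = _ := by rw [inv_pow, pow_mul, Real.sq_sqrt (Nat.cast_nonneg _)]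
  rw [hs, div_pow]
  field_simp
  ring

end Lattice

/-! ### Convergence of the traces -/

section TraceLimit

variable {m p : ℕ} {Ω : Type*} [mΩ : MeasurableSpace Ω] {P : Measure Ω} [IsProbabilityMeasure P]
  {σ ρ₂ : ℝ} {x : Fin m → ℕ → ℤ → Ω → ℝ}
  (hx : ∀ i, PairCorrelatedInput P (x i) σ ρ₂)
  (hindep : ∀ n, 1 ≤ n → iIndepFun (fun (i : Fin m) (ω : Ω) (j : ℤ) => x i n j ω) P)
include hx hindep

theorem tendsto_integral_scaledTrace (τ : Fin p → Fin m) :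
    Tendsto (fun n => ∫ ω, scaledTrace x n τ ω ∂P) atTop (𝓝 (limitMoment σ ρ₂ τ)) := by
  classical
  obtain ⟨C₁, hC₁, h₁⟩ := exists_integral_abs_pathProd_pow_le hx τ 1
  set K : ℝ := C₁ + ∑ π ∈ pairPartitions p, |blockWeight σ ρ₂ τ π| with hK
  have hK0 : 0 ≤ K := add_nonneg hC₁ (Finset.sum_nonneg fun π _ => abs_nonneg _)
  set N := Fintype.card (Unit × Fin p → Unit × Fin p → Bool × Bool) with hN
  set κ : ℕ → ℝ := fun n => (n : ℝ)⁻¹ * (Real.sqrt n)⁻¹ ^ p with hκ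
  have hκ0 : ∀ n, 0 ≤ κ n := fun n => by positivity
  set main : (n : ℕ) → (Fin (p + 1) → Fin n) → ℝ := fun n f =>
    ∑ π ∈ pairPartitions p, if IsPaired π f then blockWeight σ ρ₂ τ π else 0 with hmain
  have hlim : Tendsto (fun n => κ n * ∑ f ∈ circuits n p, main n f) atTop
      (𝓝 (limitMoment σ ρ₂ τ)) := by
    have : ∀ n, κ n * ∑ f ∈ circuits n p, main n f = ∑ π ∈ pairPartitions p,
        blockWeight σ ρ₂ τ π * (κ n * (((circuits n p).filter (IsPaired π)).card : ℝ)) := by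
      intro n
      simp only [hmain]
      rw [Finset.sum_comm, Finset.mul_sum]
      refine Finset.sum_congr rfl fun π _ => ?_
      rw [← Finset.sum_filter, Finset.sum_const, nsmul_eq_mul]
      ring
    simp only [this]
    exact tendsto_finsetSum _ fun π hπ => (tendsto_card_isPaired hπ).const_mul _
  have herr : ∀ n : ℕ, 1 ≤ n → |∫ ω, scaledTrace x n τ ω ∂P - κ n * ∑ f ∈ circuits n p, main n f| ≤
      K * 2 ^ p * N * (Real.sqrt n)⁻¹ := by
    intro n hn
    have hn0 : (0 : ℝ) < n := by exact_mod_cast hn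
    have hs1 : 1 ≤ Real.sqrt n := Real.one_le_sqrt.2 (by exact_mod_cast hn)
    have hs0 : 0 < Real.sqrt n := by linarith
    -- The error comes from irregular circuits only. There are `O(n ^ (1 + (p - 1) / 2))` of them
    -- against a normalization of order `n ^ (1 + p / 2)`, so it is `O(n ^ (-1 / 2))`.
    set Irr := (circuits n p).filter fun f => ¬ IsRegular τ f with hIrr
    have hD : ∫ ω, scaledTrace x n τ ω ∂P - κ n * ∑ f ∈ circuits n p, main n f =
        κ n * ∑ f ∈ Irr, (∫ ω, pathProd x n τ f ω ∂P - main n f) := by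
      have h2 : ∫ ω, scaledTrace x n τ ω ∂P =
          κ n * ∑ f ∈ circuits n p, ∫ ω, pathProd x n τ f ω ∂P := by
        simp only [scaledTrace]
        rw [integral_const_mul, integral_finsetSum _ fun f _ => integrable_pathProd hx hn τ f]
      rw [h2, ← mul_sub, ← Finset.sum_sub_distrib]
      congr 1
      symm
      refine Finset.sum_subset (Finset.filter_subset _ _) fun f hf hf' => ?_
      have hreg : IsRegular τ f := by
        by_contra hreg
        exact hf' (Finset.mem_filter.2 ⟨hf, hreg⟩)
      rw [integral_pathProd_of_isRegular hx hindep hn τ f hreg, sub_self]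
    have hbound : ∀ f : Fin (p + 1) → Fin n, |∫ ω, pathProd x n τ f ω ∂P - main n f| ≤ K := by
      intro f
      refine (abs_sub _ _).trans (add_le_add ?_ ?_)
      · have := (h₁ n hn f).2
        simp only [pow_one] at this
        exact abs_integral_le_integral_abs.trans this
      · refine (Finset.abs_sum_le_sum_abs _ _).trans (Finset.sum_le_sum fun π _ => ?_)
        split_ifs
        · exact le_rfl
        · simp
    have hcard : (Irr.card : ℝ) * Real.sqrt n ≤ n * (2 ^ p * Real.sqrt n ^ p) * N := by
      rcases Nat.eq_zero_or_pos p with rfl | hp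
      · have : Irr = ∅ := Finset.filter_eq_empty_iff.2 fun f _ h => h (Or.inr fun t => t.elim0)
        rw [this, Finset.card_empty, Nat.cast_zero, zero_mul]
        positivity
      · have h2 := card_not_isRegular_le hn τ Irr fun f hf => Finset.mem_filter.1 hf
        have h3 : (Irr.card : ℝ) ≤ n * (2 * n) ^ ((p - 1) / 2) * N := by exact_mod_cast h2
        have h4 : (2 * (n : ℝ)) ^ ((p - 1) / 2) * Real.sqrt n ≤ 2 ^ p * Real.sqrt n ^ p := by
          calc (2 * (n : ℝ)) ^ ((p - 1) / 2) * Real.sqrt n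
              = 2 ^ ((p - 1) / 2) * Real.sqrt n ^ (2 * ((p - 1) / 2) + 1) := by
                rw [mul_pow, pow_succ, pow_mul, Real.sq_sqrt hn0.le]
                ring
            _ ≤ 2 ^ p * Real.sqrt n ^ p := by
                gcongr
                · norm_num
                · omega
                · omega
        calc (Irr.card : ℝ) * Real.sqrt n
            ≤ (n * (2 * n) ^ ((p - 1) / 2) * N) * Real.sqrt n := by gcongr
          _ = n * ((2 * n) ^ ((p - 1) / 2) * Real.sqrt n) * N := by ring
          _ ≤ _ := by gcongr
    rw [hD, abs_mul, abs_of_nonneg (hκ0 n)]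
    calc κ n * |∑ f ∈ Irr, (∫ ω, pathProd x n τ f ω ∂P - main n f)|
        ≤ κ n * (Irr.card * K) := by
          refine mul_le_mul_of_nonneg_left ?_ (hκ0 n)
          refine (Finset.abs_sum_le_sum_abs _ _).trans ?_
          rw [← nsmul_eq_mul]
          exact Finset.sum_le_card_nsmul _ _ _ fun f _ => hbound f
      _ = κ n * ((Irr.card * Real.sqrt n) * K) * (Real.sqrt n)⁻¹ := by
          field_simp
      _ ≤ κ n * ((n * (2 ^ p * Real.sqrt n ^ p) * N) * K) * (Real.sqrt n)⁻¹ := by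
          have := hκ0 n
          gcongr
      _ = K * 2 ^ p * N * (Real.sqrt n)⁻¹ := by
          simp only [hκ, inv_pow]
          field_simp
  have hz : Tendsto (fun n => ∫ ω, scaledTrace x n τ ω ∂P - κ n * ∑ f ∈ circuits n p, main n f)
      atTop (𝓝 0) := by
    refine squeeze_zero_norm' (a := fun n : ℕ => K * 2 ^ p * N * (Real.sqrt n)⁻¹) ?_ ?_
    · filter_upwards [eventually_ge_atTop 1] with n hn
      exact herr n hn
    · have : Tendsto (fun n : ℕ => (Real.sqrt n)⁻¹) atTop (𝓝 0) :=
        tendsto_inv_atTop_zero.comp (Real.tendsto_sqrt_atTop.comp tendsto_natCast_atTop_atTop)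
      simpa using this.const_mul (K * 2 ^ p * N)
  simpa using hz.add hlim

theorem ae_tendsto_scaledTrace (τ : Fin p → Fin m) :
    ∀ᵐ ω ∂P, Tendsto (fun n => scaledTrace x n τ ω) atTop (𝓝 (limitMoment σ ρ₂ τ)) := by
  obtain ⟨C, hC⟩ := exists_integral_centred_pow_four_le hx hindep τ
  filter_upwards [ae_tendsto_zero_of_integral_pow_four_le hC] with ω hω
  simpa using hω.add (tendsto_integral_scaledTrace hx hindep τ)

end TraceLimit

end

/-! ### Growth of the limit moments and comparison with Gaussian moments. -/

section

/-! ### Growth of the limit moments -/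

section Growth

variable {m p : ℕ} {π : Finpartition (Finset.univ : Finset (Fin p))}

lemma part_eq_pair_max (hπ : π ∈ pairPartitions p) {t : Fin p} (ht : earlier π t = ∅) :
    π.part t = {t, (π.part t).max' ⟨t, π.mem_part (Finset.mem_univ t)⟩} := by
  obtain ⟨u, -, hu | hu⟩ := exists_partner hπ t
  · rw [ht] at hu
    exact absurd hu (Finset.notMem_empty _)
  · have h := mem_earlier.1 hu
    have hmax : u ≤ (π.part t).max' ⟨t, π.mem_part (Finset.mem_univ t)⟩ := by
      refine Finset.le_max' _ _ ?_
      rw [h.1]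
      exact π.mem_part (Finset.mem_univ u)
    symm
    refine Finset.eq_of_subset_of_card_le ?_ ?_
    · intro y hy
      rw [Finset.mem_insert, Finset.mem_singleton] at hy
      rcases hy with rfl | rfl
      · exact π.mem_part (Finset.mem_univ _)
      · exact Finset.max'_mem _ _
    · rw [card_part_eq_two hπ, Finset.card_pair (h.2.trans_le hmax).ne]

/-- A pairing is determined by the set of first elements of its blocks, at most `2 ^ p` choices, and
the partner of each of these at most `p / 2` elements. -/
lemma card_pairPartitions_le (p : ℕ) : (pairPartitions p).card ≤ p ^ (p / 2) * 2 ^ p := by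
  classical
  set firsts : Finpartition (Finset.univ : Finset (Fin p)) → Finset (Fin p) :=
    fun π => Finset.univ.filter fun t => earlier π t = ∅ with hfirsts
  have hmem : ∀ {π t}, t ∈ firsts π ↔ earlier π t = ∅ := by
    intro π t
    simp [hfirsts]
  refine (Finset.card_le_mul_card_image (f := firsts) _ (p ^ (p / 2)) ?_).trans ?_
  · intro S hS
    obtain ⟨π₀, hπ₀, rfl⟩ := Finset.mem_image.1 hS
    have hcard : (firsts π₀).card ≤ p / 2 := by
      have h1 : (firsts π₀).card ≤ (Finset.univ : Finset {V // V ∈ π₀.parts}).card :=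
        Finset.card_le_card_of_injOn (blockOf π₀) (by simp) fun s hs t ht h => by
          rw [← blockMin_of_earlier_eq_empty (hmem.1 hs), h,
            blockMin_of_earlier_eq_empty (hmem.1 ht)]
      rw [Finset.card_univ, Fintype.card_coe] at h1
      have h2 := two_mul_card_parts hπ₀
      omega
    have h3 : ((pairPartitions p).filter fun π => firsts π = firsts π₀).card ≤
        (Finset.univ : Finset (firsts π₀ → Fin p)).card := by
      refine Finset.card_le_card_of_injOn (fun π (t : firsts π₀) =>
        (π.part t.1).max' ⟨t.1, π.mem_part (Finset.mem_univ _)⟩) (by simp) ?_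
      intro π hπ π' hπ' h
      rw [Finset.mem_coe, Finset.mem_filter] at hπ hπ'
      have hfirst : ∀ t, earlier π t = ∅ → π.part t = π'.part t := by
        intro t ht
        have ht0 : t ∈ firsts π₀ := hπ.2 ▸ hmem.2 ht
        have ht' : earlier π' t = ∅ := hmem.1 (hπ'.2 ▸ ht0)
        have := congrFun h ⟨t, ht0⟩
        simp only at this
        rw [part_eq_pair_max hπ.1 ht, part_eq_pair_max hπ'.1 ht', this]
      refine eq_of_forall_part_eq fun t => ?_
      rcases Finset.eq_empty_or_nonempty (earlier π t) with ht | ⟨r, hr⟩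
      · exact hfirst t ht
      · have h1 := hfirst r (earlier_eq_empty hπ.1 hr)
        have h2 := (mem_earlier.1 hr).1
        have h3 : t ∈ π'.part r := by
          rw [← h1, h2]
          exact π.mem_part (Finset.mem_univ _)
        rw [π'.mem_part_iff_part_eq_part (Finset.mem_univ _) (Finset.mem_univ _)] at h3
        rw [h3, ← h1, h2]
    refine h3.trans ?_
    rw [Finset.card_univ, Fintype.card_fun, Fintype.card_fin, Fintype.card_coe]
    rcases Nat.eq_zero_or_pos p with rfl | hp
    · have : (firsts π₀).card = 0 := by omega
      simp [this]
    · exact Nat.pow_le_pow_right hp hcard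
  · gcongr
    refine (Finset.card_le_univ _).trans ?_
    simp

lemma abs_blockWeight_le (σ ρ₂ : ℝ) (τ : Fin p → Fin m) (hπ : π ∈ pairPartitions p) :
    |blockWeight σ ρ₂ τ π| ≤ (1 + σ ^ 2 + |ρ₂|) ^ p := by
  have hM : 1 ≤ 1 + σ ^ 2 + |ρ₂| := by
    have := sq_nonneg σ
    have := abs_nonneg ρ₂
    linarith
  have hθ : ∀ r s : Fin p, |(if τ r = τ s then 1 else 0) * theta σ ρ₂ r s| ≤
      1 + σ ^ 2 + |ρ₂| := by
    intro r s
    unfold theta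
    have h1 := sq_nonneg σ
    have h2 := abs_nonneg ρ₂
    split_ifs <;> simp <;> linarith
  unfold blockWeight
  rw [Finset.abs_prod]
  calc ∏ s, |∏ r ∈ earlier π s, (if τ r = τ s then 1 else 0) * theta σ ρ₂ r s|
      ≤ ∏ _s : Fin p, (1 + σ ^ 2 + |ρ₂|) := by
        refine Finset.prod_le_prod (fun _ _ => abs_nonneg _) fun s _ => ?_
        rcases Finset.eq_empty_or_nonempty (earlier π s) with h | ⟨r, h⟩
        · simpa [h] using hM
        · rw [earlier_eq_singleton hπ h, Finset.prod_singleton]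
          exact hθ r s
    _ = _ := by simp

lemma abs_blockIntegral_le (hπ : π ∈ pairPartitions p) : |blockIntegral π| ≤ 2 * 2 ^ p := by
  rw [← volume_pathRegion, abs_of_nonneg measureReal_nonneg]
  have hsub : pathRegion π ⊆ Set.Icc (fun _ => (-1 : ℝ)) fun _ => 1 := by
    intro y hy
    refine ⟨fun i => ?_, fun i => ?_⟩ <;> rcases i with ⟨⟩ | V
    · exact le_trans (by norm_num) hy.1.1
    · exact (hy.2.1 V).1
    · exact hy.1.2
    · exact (hy.2.1 V).2
  refine (measureReal_mono hsub isCompact_Icc.measure_lt_top.ne).trans ?_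
  rw [measureReal_def, Real.volume_Icc_pi_toReal (fun _ => by norm_num)]
  have := two_mul_card_parts hπ
  simp only [sub_neg_eq_add, Finset.prod_const, Finset.card_univ, Fintype.card_sum,
    Fintype.card_unit, Fintype.card_coe, pow_add, pow_one]
  norm_num
  exact pow_le_pow_right₀ (by norm_num) (by omega)

/-- The growth of the limit moments. -/
lemma exists_abs_limitMoment_le (σ ρ₂ : ℝ) : ∃ C : ℝ, 1 ≤ C ∧ ∀ {m p : ℕ} (τ : Fin p → Fin m),
    |limitMoment σ ρ₂ τ| ≤ 2 * (C * Real.sqrt p) ^ p := by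
  set M : ℝ := 1 + σ ^ 2 + |ρ₂| with hM
  have hM1 : 1 ≤ M := by
    have := sq_nonneg σ
    have := abs_nonneg ρ₂
    linarith
  refine ⟨4 * M, by linarith, fun {m p} τ => ?_⟩
  unfold limitMoment
  rcases Finset.eq_empty_or_nonempty (pairPartitions p) with h0 | ⟨π₀, hπ₀⟩
  · rw [h0, Finset.sum_empty, abs_zero]
    positivity
  have hp : p / 2 * 2 = p := by
    have := two_mul_card_parts hπ₀
    omega
  have hcard : ((pairPartitions p).card : ℝ) ≤ Real.sqrt p ^ p * 2 ^ p := by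
    have h1 : ((pairPartitions p).card : ℝ) ≤ (p : ℝ) ^ (p / 2) * 2 ^ p := by
      exact_mod_cast card_pairPartitions_le p
    have h2 : (p : ℝ) ^ (p / 2) = Real.sqrt p ^ p := by
      calc (p : ℝ) ^ (p / 2) = Real.sqrt p ^ (2 * (p / 2)) := by
            rw [pow_mul, Real.sq_sqrt (Nat.cast_nonneg p)]
        _ = Real.sqrt p ^ p := by rw [mul_comm, hp]
    rwa [h2] at h1
  calc |∑ π ∈ pairPartitions p, blockWeight σ ρ₂ τ π * blockIntegral π|
      ≤ ∑ π ∈ pairPartitions p, |blockWeight σ ρ₂ τ π * blockIntegral π| :=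
        Finset.abs_sum_le_sum_abs _ _
    _ ≤ (pairPartitions p).card • (M ^ p * (2 * 2 ^ p)) := by
        refine Finset.sum_le_card_nsmul _ _ _ fun π hπ => ?_
        rw [abs_mul]
        gcongr
        · exact abs_blockWeight_le σ ρ₂ τ hπ
        · exact abs_blockIntegral_le hπ
    _ ≤ (Real.sqrt p ^ p * 2 ^ p) * (M ^ p * (2 * 2 ^ p)) := by
        rw [nsmul_eq_mul]
        gcongr
    _ = 2 * (4 * M * Real.sqrt p) ^ p := by
        rw [mul_pow, mul_pow, show (4 : ℝ) = 2 * 2 by norm_num, mul_pow]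
        ring

-- Since `N ^ N ≤ e ^ N * N !`, one factorial absorbs the moment growth and the other beats the
-- remaining geometric factor. This supplies the hypothesis of `polyApprox_cos`.
open scoped Nat in
lemma tendsto_growth_bound (C s : ℝ) :
    Tendsto (fun N : ℕ => s ^ N / (N ! : ℝ) ^ 2 * (2 * (C * Real.sqrt ((2 * N : ℕ) : ℝ)) ^ (2 * N)))
      atTop (𝓝 0) := by
  have h := (FloorSemiring.tendsto_pow_div_factorial_atTop (|s| * (2 * C ^ 2) * Real.exp 1)).const_mul
    2
  rw [mul_zero] at h
  refine squeeze_zero_norm (fun N => ?_) h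
  have hfac : (0 : ℝ) < N ! := by positivity
  have h1 : (N : ℝ) ^ N ≤ Real.exp 1 ^ N * N ! := by
    have := Real.pow_div_factorial_le_exp (N : ℝ) (Nat.cast_nonneg N) N
    rw [div_le_iff₀ hfac] at this
    rwa [← Real.exp_nat_mul, mul_one]
  have h2 : (C * Real.sqrt ((2 * N : ℕ) : ℝ)) ^ (2 * N) = (2 * C ^ 2) ^ N * (N : ℝ) ^ N := by
    rw [pow_mul, mul_pow, Real.sq_sqrt (Nat.cast_nonneg _), ← mul_pow]
    congr 1
    push_cast
    ring
  rw [h2, norm_mul, norm_div, norm_pow, norm_pow, Real.norm_eq_abs, Real.norm_of_nonneg hfac.le,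
    Real.norm_of_nonneg (by positivity)]
  calc |s| ^ N / (N ! : ℝ) ^ 2 * (2 * ((2 * C ^ 2) ^ N * (N : ℝ) ^ N))
      ≤ |s| ^ N / (N ! : ℝ) ^ 2 * (2 * ((2 * C ^ 2) ^ N * (Real.exp 1 ^ N * N !))) := by gcongr
    _ = 2 * ((|s| * (2 * C ^ 2) * Real.exp 1) ^ N / N !) := by
        simp only [mul_pow]
        field_simp

end Growth

/-! ### Gaussian moments -/

section Gaussian

lemma integrable_abs_pow_gaussianReal (v : ℝ≥0) (q : ℕ) :
    Integrable (fun t : ℝ => |t| ^ q) (gaussianReal 0 v) := by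
  have := (memLp_id_gaussianReal (μ := 0) (v := v) q).integrable_norm_pow'
  simpa using this

/-- Only the interval `[√q, √q + 1]` is kept, where `|t| ^ q ≥ √q ^ q` and the density is bounded
below because `(√q + 1) ^ 2 ≤ 2 (q + 1)`. -/
lemma le_integral_abs_pow_gaussianReal (q : ℕ) :
    (Real.sqrt (2 * Real.pi))⁻¹ * Real.exp (-(q + 1)) * Real.sqrt q ^ q ≤
      ∫ t, |t| ^ q ∂(gaussianReal 0 1) := by
  set I := Set.Icc (Real.sqrt q) (Real.sqrt q + 1) with hI
  set c := (Real.sqrt (2 * Real.pi))⁻¹ * Real.exp (-(q + 1)) with hc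
  have hsq : Real.sqrt q ^ 2 = q := Real.sq_sqrt (Nat.cast_nonneg q)
  have hpdf : ∀ t ∈ I, c ≤ gaussianPDFReal 0 1 t := by
    intro t ht
    simp only [gaussianPDFReal, hc, NNReal.coe_one, mul_one, sub_zero]
    gcongr
    have h0 := Real.sqrt_nonneg (q : ℝ)
    nlinarith [ht.1, ht.2, sq_nonneg (Real.sqrt q - 1)]
  have hmeas : c ≤ (gaussianReal 0 1).real I := by
    rw [measureReal_def, gaussianReal_apply_eq_integral 0 one_ne_zero, ENNReal.toReal_ofReal
      (setIntegral_nonneg measurableSet_Icc fun t _ => gaussianPDFReal_nonneg _ _ _)]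
    have h := setIntegral_mono_on (μ := volume) (s := I) (f := fun _ => c)
      (integrableOn_const (hs := isCompact_Icc.measure_lt_top.ne))
      (integrable_gaussianPDFReal 0 1).integrableOn measurableSet_Icc hpdf
    simpa [hI] using h
  calc c * Real.sqrt q ^ q ≤ (gaussianReal 0 1).real I * Real.sqrt q ^ q := by gcongr
    _ = ∫ _t in I, Real.sqrt q ^ q ∂(gaussianReal 0 1) := by simp
    _ ≤ ∫ t in I, |t| ^ q ∂(gaussianReal 0 1) := by
        refine setIntegral_mono_on (integrableOn_const (hs := measure_ne_top _ _))
          (integrable_abs_pow_gaussianReal 1 q).integrableOn measurableSet_Icc fun t ht => ?_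
        gcongr
        exact ht.1.trans (le_abs_self t)
    _ ≤ ∫ t, |t| ^ q ∂(gaussianReal 0 1) :=
        setIntegral_le_integral (integrable_abs_pow_gaussianReal 1 q)
          (Eventually.of_forall fun t => by positivity)

/-- The absolute moments of a centred Gaussian variable of large variance dominate
`(D √q) ^ q`. -/
lemma exists_le_integral_abs_pow_gaussianReal (D : ℝ) (hD : 0 ≤ D) :
    ∃ v : ℝ≥0, ∀ q : ℕ, 1 ≤ q → (D * Real.sqrt q) ^ q ≤ ∫ t, |t| ^ q ∂(gaussianReal 0 v) := by
  -- For `q ≥ 1` the prefactor of the standard Gaussian bound is at least `c ^ q`, as `q + 1 ≤ 2 q`.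
  -- Rescaling the variable by `D / c` then gives the constant `D`.
  set c : ℝ := (Real.sqrt (2 * Real.pi))⁻¹ * Real.exp (-2) with hc
  have hc0 : 0 < c := by positivity
  have hπ : 1 ≤ Real.sqrt (2 * Real.pi) :=
    Real.one_le_sqrt.2 (by linarith [Real.pi_gt_three])
  have hlow : ∀ q : ℕ, 1 ≤ q → (c * Real.sqrt q) ^ q ≤ ∫ t, |t| ^ q ∂(gaussianReal 0 1) := by
    intro q hq
    refine le_trans ?_ (le_integral_abs_pow_gaussianReal q)
    rw [mul_pow, hc, mul_pow, ← Real.exp_nat_mul]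
    gcongr
    · exact pow_le_of_le_one (by positivity) (inv_le_one_of_one_le₀ hπ) (by omega)
    · have : (1 : ℝ) ≤ q := by exact_mod_cast hq
      linarith
  set s : ℝ := D / c with hs
  have hs0 : 0 ≤ s := by positivity
  refine ⟨.mk (s ^ 2) (sq_nonneg _) * 1, fun q hq => ?_⟩
  have hmap := gaussianReal_map_const_mul (μ := 0) (v := 1) s
  rw [mul_zero] at hmap
  rw [← hmap, integral_map (by fun_prop) (by fun_prop)]
  simp_rw [abs_mul, mul_pow]
  rw [integral_const_mul, abs_of_nonneg hs0]
  calc D ^ q * Real.sqrt q ^ q = s ^ q * (c * Real.sqrt q) ^ q := by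
        rw [← mul_pow, ← mul_pow, hs, ← mul_assoc, div_mul_cancel₀ _ hc0.ne']
    _ ≤ _ := by
        gcongr
        exact hlow q hq

end Gaussian

/-! ### Moments of polynomials -/

section PolynomialMoments

variable {m : ℕ}

lemma evalPoly_eq_sum {A : Type*} [Ring A] [Algebra ℂ A] [Star A] (a : Fin m → A)
    (Q : FreeAlgebra ℂ (Fin m × Bool)) :
    evalPoly a Q = ∑ w ∈ (FreeAlgebra.equivMonoidAlgebraFreeMonoid Q).coeff.support,
      (FreeAlgebra.equivMonoidAlgebraFreeMonoid Q).coeff w •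
        FreeMonoid.lift (fun l : Fin m × Bool => starPow (a l.1) l.2) w := by
  have h : evalPoly a = (MonoidAlgebra.lift ℂ A (FreeMonoid (Fin m × Bool))
      (FreeMonoid.lift fun l : Fin m × Bool => starPow (a l.1) l.2)).comp
      (FreeAlgebra.equivMonoidAlgebraFreeMonoid (R := ℂ) (X := Fin m × Bool)).toAlgHom := by
    apply FreeAlgebra.hom_ext
    funext l
    simp [evalPoly, FreeAlgebra.equivMonoidAlgebraFreeMonoid]
  rw [h]
  change MonoidAlgebra.lift ℂ A (FreeMonoid (Fin m × Bool)) _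
    (FreeAlgebra.equivMonoidAlgebraFreeMonoid Q) = _
  rw [MonoidAlgebra.lift_apply]
  rfl

/-- `K` is the sum of the absolute values of the coefficients. Carrying a prefix word through the
induction means that only one factor of the power is expanded at a time. -/
lemma exists_norm_map_evalPoly_pow_le {A : Type*} [Ring A] [Algebra ℂ A] [Star A] (a : Fin m → A)
    (φ : A →ₗ[ℂ] ℂ) {b : ℕ → ℝ} (hb : Monotone b)
    (h : ∀ w : FreeMonoid (Fin m × Bool),
      ‖φ (FreeMonoid.lift (fun l : Fin m × Bool => starPow (a l.1) l.2) w)‖ ≤ b w.length)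
    (Q : FreeAlgebra ℂ (Fin m × Bool)) {d : ℕ} (hd : polyDegree Q ≤ d) :
    ∃ K : ℝ, 0 ≤ K ∧ ∀ k, ‖φ (evalPoly a Q ^ k)‖ ≤ K ^ k * b (d * k) := by
  set c := (FreeAlgebra.equivMonoidAlgebraFreeMonoid Q).coeff with hc
  set K : ℝ := ∑ w ∈ c.support, ‖c w‖ with hK
  have hK0 : 0 ≤ K := Finset.sum_nonneg fun w _ => norm_nonneg _
  have key : ∀ k (u : FreeMonoid (Fin m × Bool)),
      ‖φ (FreeMonoid.lift (fun l : Fin m × Bool => starPow (a l.1) l.2) u * evalPoly a Q ^ k)‖ ≤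
        K ^ k * b (u.length + d * k) := by
    intro k
    induction k with
    | zero =>
      intro u
      simpa using h u
    | succ k ih =>
      intro u
      have hexp : FreeMonoid.lift (fun l : Fin m × Bool => starPow (a l.1) l.2) u *
          evalPoly a Q ^ (k + 1) = ∑ w ∈ c.support, c w •
            (FreeMonoid.lift (fun l : Fin m × Bool => starPow (a l.1) l.2) (u * w) *
              evalPoly a Q ^ k) := by
        rw [pow_succ', ← mul_assoc, evalPoly_eq_sum a Q, Finset.mul_sum, Finset.sum_mul]
        refine Finset.sum_congr rfl fun w _ => ?_
        rw [map_mul, mul_smul_comm, smul_mul_assoc]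
      rw [hexp, map_sum]
      calc ‖∑ w ∈ c.support, φ (c w •
            (FreeMonoid.lift (fun l : Fin m × Bool => starPow (a l.1) l.2) (u * w) *
              evalPoly a Q ^ k))‖
          ≤ ∑ w ∈ c.support, ‖c w‖ * (K ^ k * b (u.length + d * (k + 1))) := by
            refine norm_sum_le_of_le _ fun w hw => ?_
            rw [map_smul, norm_smul]
            refine mul_le_mul_of_nonneg_left ((ih (u * w)).trans ?_) (norm_nonneg _)
            refine mul_le_mul_of_nonneg_left (hb ?_) (pow_nonneg hK0 k)
            have hw' : w.length ≤ d := (Finset.le_sup (f := FreeMonoid.length) hw).trans hd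
            rw [FreeMonoid.length_mul]
            ring_nf
            omega
        _ = K ^ (k + 1) * b (u.length + d * (k + 1)) := by
            rw [← Finset.sum_mul, ← hK]
            ring
  refine ⟨K, hK0, fun k => ?_⟩
  simpa using key k 1

end PolynomialMoments

end

/-! ### The limit state, reflection, and moments of words. -/

section

/-! ### The limit state -/

section LimitState

variable {m : ℕ} {β : List (Fin m) → ℂ}

lemma map_word {A B : Type*} [Monoid A] [Monoid B] (g : A →* B) (a : Fin m → A)
    (w : List (Fin m)) : g (word a w) = word (fun i => g (a i)) w := by
  simp [word, map_list_prod, Function.comp_def]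

lemma word_neg {A : Type*} [Ring A] [Algebra ℂ A] (a : Fin m → A) (w : List (Fin m)) :
    word (fun i => -a i) w = ((-1 : ℂ) ^ w.length) • word a w := by
  induction w with
  | nil => simp [word]
  | cons i w ih =>
    rw [word_cons, word_cons, ih, List.length_cons, pow_succ, mul_smul_comm, neg_mul, smul_neg,
      mul_neg_one, neg_smul]

lemma evalPoly_word {A : Type*} [Ring A] [Algebra ℂ A] [Star A] (a : Fin m → A)
    (w : List (Fin m)) :
    evalPoly a (word (fun i => FreeAlgebra.ι ℂ (i, false)) w) = word a w := by
  have := map_word (evalPoly a : FreeAlgebra ℂ (Fin m × Bool) →* A)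
    (fun i => FreeAlgebra.ι ℂ (i, false)) w
  simpa [evalPoly_ι, starPow] using this

lemma monomial_eq_word {A : Type*} [Monoid A] [Star A] {p : ℕ} (a : Fin m → A)
    (ha : ∀ i, star (a i) = a i) (τ : Fin p → Fin m) (ε : Fin p → Bool) :
    monomial a τ ε = word a (List.ofFn τ) := by
  have h : ∀ i b, starPow (a i) b = a i := fun i b => by
    unfold starPow
    split_ifs <;> simp [ha]
  simp only [monomial, word, h, List.map_ofFn]
  rfl

/-- A tuple of sequences of Hermitian matrices whose word moments converge has a limit in a
`*`-probability space. -/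
theorem exists_limit_state {X : (n : ℕ) → Fin m → Matrix (Fin n) (Fin n) ℂ}
    (hX : ∀ n k, (X n k).IsHermitian)
    (hconv : ∀ w, Tendsto (fun n => ntr (word (X n) w)) atTop (𝓝 (β w))) :
    ∃ (A : Type) (_ : Ring A) (_ : StarRing A) (_ : Algebra ℂ A) (_ : StarModule ℂ A)
      (φ : State A) (a : Fin m → A), (∀ i, star (a i) = a i) ∧
      ∀ Q, Tendsto (fun n => ntr (evalPoly (X n) Q)) atTop (𝓝 (φ.toLinearMap (evalPoly a Q))) := by
  set s : Fin m → (n : ℕ) → Matrix (Fin n) (Fin n) ℂ := fun i n => X n i with hs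
  -- The algebra lives in the product of all matrix algebras. Its elements are polynomials in the
  -- given sequences, so their normalized traces converge; positivity of the limit is inherited from
  -- finite `n`.
  set A := StarAlgebra.adjoin ℂ (Set.range s) with hA
  have heval : ∀ Q n, evalPoly s Q n = evalPoly (X n) Q := by
    intro Q n
    have : (Pi.evalAlgHom ℂ (fun n => Matrix (Fin n) (Fin n) ℂ) n).comp (evalPoly s) =
        evalPoly (X n) := by
      apply FreeAlgebra.hom_ext
      funext l
      simp only [Function.comp_apply, AlgHom.comp_apply, evalPoly_ι, Pi.evalAlgHom_apply, starPow]
      split_ifs <;> rfl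
    exact congrArg (fun g => g Q) this
  have hpoly : ∀ b ∈ A, ∃ Q, b = evalPoly s Q := by
    intro b hb
    induction hb using StarAlgebra.adjoin_induction with
    | mem y hy =>
      obtain ⟨i, rfl⟩ := hy
      exact ⟨FreeAlgebra.ι ℂ (i, false), by simp [evalPoly_ι, starPow]⟩
    | algebraMap r => exact ⟨algebraMap ℂ _ r, by rw [AlgHom.commutes]⟩
    | add y z _ _ hy hz =>
      obtain ⟨Q, rfl⟩ := hy
      obtain ⟨R, rfl⟩ := hz
      exact ⟨Q + R, (map_add _ _ _).symm⟩
    | mul y z _ _ hy hz =>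
      obtain ⟨Q, rfl⟩ := hy
      obtain ⟨R, rfl⟩ := hz
      exact ⟨Q * R, (map_mul _ _ _).symm⟩
    | star y _ hy =>
      obtain ⟨Q, rfl⟩ := hy
      obtain ⟨Q', hQ'⟩ := exists_star_evalPoly_eq Q
      exact ⟨Q', hQ' s⟩
  have hlim : ∀ b : A, ∃ c, Tendsto (fun n => ntr (b.1 n)) atTop (𝓝 c) := by
    rintro ⟨b, hb⟩
    obtain ⟨Q, rfl⟩ := hpoly b hb
    simp only [heval]
    exact tendsto_ntr_evalPoly hX hconv Q
  choose L hL using hlim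
  let φ : State A :=
    { toLinearMap :=
        { toFun := L
          map_add' := fun b c => tendsto_nhds_unique (hL (b + c))
            (((hL b).add (hL c)).congr fun n => (ntr_add _ _).symm)
          map_smul' := fun r b => tendsto_nhds_unique (hL (r • b))
            (((hL b).const_mul r).congr fun n => (ntr_smul _ _).symm) }
      map_one := by
        refine tendsto_nhds_unique (hL 1) (tendsto_const_nhds.congr' ?_)
        filter_upwards [eventually_ne_atTop 0] with n hn
        change 1 = ntr (1 : Matrix (Fin n) (Fin n) ℂ)
        rw [ntr, Matrix.trace_one, Fintype.card_fin,
          inv_mul_cancel₀ (by exact_mod_cast hn : (n : ℂ) ≠ 0)]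
      nonneg := fun b => by
        refine ge_of_tendsto' (hL (b * star b)) fun n => ?_
        change 0 ≤ ntr (b.1 n * (b.1 n).conjTranspose)
        rw [← ofReal_hsq]
        exact_mod_cast hsq_nonneg _ }
  let a : Fin m → A := fun i => ⟨s i, StarAlgebra.subset_adjoin ℂ _ ⟨i, rfl⟩⟩
  have hcoe : ∀ Q, ((evalPoly a Q : A) : (n : ℕ) → Matrix (Fin n) (Fin n) ℂ) = evalPoly s Q := by
    intro Q
    have : (A.subtype : A →⋆ₐ[ℂ] _).toAlgHom.comp (evalPoly a) = evalPoly s := by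
      apply FreeAlgebra.hom_ext
      funext l
      simp only [Function.comp_apply, AlgHom.comp_apply, evalPoly_ι, starPow]
      split_ifs <;> rfl
    exact congrArg (fun g => g Q) this
  refine ⟨A, inferInstance, inferInstance, inferInstance, inferInstance, φ, a, fun i => ?_,
    fun Q => ?_⟩
  · apply Subtype.ext
    funext n
    exact hX n i
  · refine (hL (evalPoly a Q)).congr fun n => ?_
    rw [hcoe, heval]

end LimitState

/-! ### Reflection of spectral distributions -/

section Reflection

lemma integral_esd_neg {n : ℕ} {A : Matrix (Fin n) (Fin n) ℂ} (hA : A.IsHermitian) (f : ℝ → ℝ) :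
    ∫ t, f t ∂(esd (-A)) = ∫ t, f (-t) ∂(esd A) := by
  have h1 : -A = cfc (fun t : ℝ => -t) A := by
    have h := smul_cfc hA (-1) fun t => t
    rw [cfc_id'] at h
    rw [hA.cfc_eq]
    simpa using h
  have h2 : esd (-A) = (n : ℝ≥0∞)⁻¹ • ∑ i, Measure.dirac (-hA.eigenvalues i) := by
    rw [esd, h1, hA.charpoly_cfc_eq, Polynomial.roots_prod _ _
      (Finset.prod_ne_zero_iff.2 fun i _ => Polynomial.X_sub_C_ne_zero _)]
    simp [Finset.sum, Function.comp_def]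
  rw [h2, integral_smul_measure, integral_finsetSum_measure, integral_esd hA]
  · simp
  · intro i _
    exact integrable_dirac (by simp)

/-- The spectral distribution of `-B n` is the reflection of that of `B n`, and weak limits are
unique. -/
lemma map_neg_eq_of_weaklyConverges {B : (n : ℕ) → Matrix (Fin n) (Fin n) ℂ}
    (hB : ∀ n, (B n).IsHermitian) {F : Measure ℝ} [IsProbabilityMeasure F]
    (h : WeaklyConverges (fun n => esd (B n)) F) (h' : WeaklyConverges (fun n => esd (-B n)) F) :
    F.map (fun t => -t) = F := by
  have : IsProbabilityMeasure (F.map fun t => -t) := 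
    Measure.isProbabilityMeasure_map measurable_neg.aemeasurable
  refine ext_of_forall_integral_eq_of_IsFiniteMeasure fun f => ?_
  rw [integral_map measurable_neg.aemeasurable f.continuous.aestronglyMeasurable]
  refine tendsto_nhds_unique (h (f.compContinuous ⟨fun t => -t, continuous_neg⟩)) ?_
  refine (h' f).congr fun n => ?_
  exact integral_esd_neg (hB n) f

end Reflection

section Measurability

variable {Ω : Type*} [MeasurableSpace Ω] {m n : ℕ}

lemma measurable_evalPoly {X : Ω → Fin m → Matrix (Fin n) (Fin n) ℂ}
    (hX : ∀ k i j, Measurable fun ω => X ω k i j) (Q : FreeAlgebra ℂ (Fin m × Bool))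
    (i j : Fin n) : Measurable fun ω => evalPoly (X ω) Q i j := by
  induction Q using FreeAlgebra.induction generalizing i j with
  | grade0 r =>
    simp only [AlgHom.commutes]
    exact measurable_const
  | grade1 l =>
    simp only [evalPoly_ι, starPow]
    split_ifs
    · exact Complex.continuous_conj.measurable.comp (hX l.1 j i)
    · exact hX l.1 i j
  | mul a b ha hb =>
    simp only [map_mul]
    exact measurable_matrix_mul ha hb i j
  | add a b ha hb =>
    simp only [map_add]
    exact (ha i j).add (hb i j)

/-- Almost sure weak convergence of the spectral distributions implies weak convergence of their
expectations. -/
lemma weaklyConverges_expectedESD {P : Measure Ω} [IsProbabilityMeasure P]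
    {B : (n : ℕ) → Ω → Matrix (Fin n) (Fin n) ℂ}
    (hB : ∀ n i j, Measurable fun ω => B n ω i j) (hH : ∀ n ω, (B n ω).IsHermitian)
    {F : Measure ℝ} (h : ∀ᵐ ω ∂P, WeaklyConverges (fun n => esd (B n ω)) F) :
    WeaklyConverges (fun n => expectedESD P (B n)) F := by
  intro f
  have h1 : Tendsto (fun n => ∫ ω, ∫ t, f t ∂(esd (B n ω)) ∂P) atTop
      (𝓝 (∫ _ω, ∫ t, f t ∂F ∂P)) := by
    refine tendsto_integral_filter_of_dominated_convergence (fun _ => ‖f‖) ?_ ?_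
      (integrable_const _) ?_
    · exact Eventually.of_forall fun n =>
        (measurable_integral_esd (hB n) (hH n) f.continuous).aestronglyMeasurable
    · filter_upwards [eventually_ne_atTop 0] with n hn
      refine Eventually.of_forall fun ω => ?_
      have := isProbabilityMeasure_esd hn (hH n ω)
      exact f.norm_integral_le_norm _
    · filter_upwards [h] with ω hω
      exact hω f
  rw [integral_const, probReal_univ, one_smul] at h1
  refine h1.congr' ?_
  filter_upwards [eventually_ne_atTop 0] with n hn
  exact (integral_expectedESD hn (hB n) (hH n) f).symm

end Measurability

/-! ### The limit moments of words -/

section LimitWord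

variable {m : ℕ} {σ ρ₂ : ℝ}

/-- The limit moment of a word. -/
def limitWord (σ ρ₂ : ℝ) (w : List (Fin m)) : ℂ := (limitMoment σ ρ₂ w.get : ℂ)

lemma limitMoment_congr {p p' : ℕ} (h : p = p') {τ : Fin p → Fin m} {τ' : Fin p' → Fin m}
    (hτ : ∀ i, τ i = τ' (Fin.cast h i)) : limitMoment σ ρ₂ τ = limitMoment σ ρ₂ τ' := by
  subst h
  congr 1
  exact funext hτ

lemma limitWord_ofFn {p : ℕ} (τ : Fin p → Fin m) :
    limitWord σ ρ₂ (List.ofFn τ) = limitMoment σ ρ₂ τ := by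
  unfold limitWord
  rw [limitMoment_congr (τ' := τ) List.length_ofFn fun i => by rw [List.get_ofFn]]

lemma limitWord_replicate (k : ℕ) (i : Fin m) :
    limitWord σ ρ₂ (List.replicate k i) = limitMoment σ ρ₂ fun _ : Fin k => i := by
  rw [← limitWord_ofFn, List.ofFn_const]

lemma limitWord_eq_zero_of_odd {w : List (Fin m)} (hw : Odd w.length) :
    limitWord σ ρ₂ w = 0 := by
  have : pairPartitions w.length = ∅ := by
    rw [Finset.eq_empty_iff_forall_notMem]
    intro π hπ
    rw [← two_mul_card_parts hπ] at hw
    exact absurd hw (by simp)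
  simp [limitWord, limitMoment, this]

lemma exists_norm_limitWord_le (σ ρ₂ : ℝ) : ∃ C : ℝ, 1 ≤ C ∧ ∀ w : List (Fin m),
    ‖limitWord σ ρ₂ w‖ ≤ 2 * (C * Real.sqrt w.length) ^ w.length := by
  obtain ⟨C, hC, h⟩ := exists_abs_limitMoment_le σ ρ₂
  refine ⟨C, hC, fun w => ?_⟩
  rw [limitWord, Complex.norm_real]
  exact h _

open scoped Nat in
lemma tendsto_growth_limitWord (σ ρ₂ : ℝ) (k : Fin m) (s : ℝ) :
    Tendsto (fun N : ℕ => s ^ N / (N ! : ℝ) ^ 2 * ‖limitWord σ ρ₂ (List.replicate (2 * N) k)‖)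
      atTop (𝓝 0) := by
  obtain ⟨C, -, h⟩ := exists_norm_limitWord_le (m := m) σ ρ₂
  have h0 := tendsto_growth_bound C |s|
  refine squeeze_zero_norm (fun N => ?_) h0
  rw [norm_mul, norm_norm, norm_div, norm_pow, norm_pow, Real.norm_eq_abs,
    Real.norm_of_nonneg (Nat.cast_nonneg _)]
  gcongr
  simpa using h (List.replicate (2 * N) k)

/-- Words in a power of a polynomial may be shorter than the degree allows; monotonicity lets the
maximal length bound them all. -/
lemma monotone_growth {C : ℝ} (hC : 1 ≤ C) :
    Monotone fun l : ℕ => 2 * (C * Real.sqrt l) ^ l := by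
  intro k l hkl
  have hone : ∀ l : ℕ, 1 ≤ l → 1 ≤ C * Real.sqrt l := fun l hl =>
    one_le_mul_of_one_le_of_one_le hC (Real.one_le_sqrt.2 (by exact_mod_cast hl))
  refine mul_le_mul_of_nonneg_left ?_ zero_le_two
  rcases Nat.eq_zero_or_pos k with rfl | hk
  · rw [pow_zero]
    rcases Nat.eq_zero_or_pos l with rfl | hl
    · simp
    · exact one_le_pow₀ (hone l hl)
  · calc (C * Real.sqrt k) ^ k ≤ (C * Real.sqrt l) ^ k := by gcongr
      _ ≤ (C * Real.sqrt l) ^ l := pow_le_pow_right₀ (hone l (hk.trans_le hkl)) hkl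

/-- The moments of a polynomial are dominated by the moments of a Gaussian variable. -/
lemma exists_norm_map_evalPoly_pow_le_gaussian {A : Type*} [Ring A] [Algebra ℂ A] [Star A]
    {a : Fin m → A} (ha : ∀ i, star (a i) = a i) (φ : A →ₗ[ℂ] ℂ)
    (hφ : ∀ w, φ (word a w) = limitWord σ ρ₂ w) (Q : FreeAlgebra ℂ (Fin m × Bool)) :
    ∃ v : ℝ≥0, ∀ k : ℕ, 1 ≤ k → ‖φ (evalPoly a Q ^ k)‖ ≤
      ∫ t, |t| ^ (max 1 (polyDegree Q) * k) ∂(gaussianReal 0 v) := by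
  obtain ⟨C, hC, hw⟩ := exists_norm_limitWord_le (m := m) σ ρ₂
  obtain ⟨K, hK, hbound⟩ := exists_norm_map_evalPoly_pow_le a φ (monotone_growth hC) (fun w => by
    have h1 : FreeMonoid.lift (fun l : Fin m × Bool => starPow (a l.1) l.2) w =
        word a (w.toList.map Prod.fst) := by
      rw [FreeMonoid.lift_apply, word, List.map_map]
      congr 1
      refine List.map_congr_left fun l _ => ?_
      unfold starPow
      split_ifs <;> simp [ha]
    have h2 := hw (w.toList.map Prod.fst)
    rw [List.length_map] at h2
    rw [h1, hφ]
    exact h2) Q (le_max_right 1 (polyDegree Q))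
  obtain ⟨v, hv⟩ := exists_le_integral_abs_pow_gaussianReal (2 * (1 + K) * C) (by positivity)
  refine ⟨v, fun k hk => ?_⟩
  set q := max 1 (polyDegree Q) * k with hq
  have hkq : k ≤ q := Nat.le_mul_of_pos_left k (by omega)
  refine (hbound k).trans (le_trans ?_ (hv q (hk.trans hkq)))
  -- The constant `2` is absorbed into `2 ^ q`, which needs `q ≥ 1` and hence `k ≥ 1`.
  calc K ^ k * (2 * (C * Real.sqrt q) ^ q)
      ≤ (1 + K) ^ q * (2 ^ q * (C * Real.sqrt q) ^ q) := by
        gcongr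
        · calc K ^ k ≤ (1 + K) ^ k := by gcongr; linarith
            _ ≤ (1 + K) ^ q := pow_le_pow_right₀ (by linarith) hkq
        · exact le_self_pow₀ (by norm_num) (by omega)
    _ = (2 * (1 + K) * C * Real.sqrt q) ^ q := by
        simp only [mul_pow]
        ring

lemma measurable_scaledHankel {Ω : Type*} [MeasurableSpace Ω] {P : Measure Ω}
    {x : Fin m → ℕ → ℤ → Ω → ℝ} (hx : ∀ i, PairCorrelatedInput P (x i) σ ρ₂) {n : ℕ}
    (k : Fin m) (i j : Fin n) : Measurable fun ω => scaledHankel n (fun l => x k n l ω) i j := by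
  simp only [scaledHankel, Matrix.smul_apply, hankel_apply, smul_eq_mul]
  exact (Complex.measurable_ofReal.comp
    ((hx k).measurable n (by have := i.2; omega) _)).const_mul _

variable {Ω : Type*} [MeasurableSpace Ω] {P : Measure Ω} [IsProbabilityMeasure P]
  {x : Fin m → ℕ → ℤ → Ω → ℝ}

lemma ae_tendsto_ntr_word (hx : ∀ i, PairCorrelatedInput P (x i) σ ρ₂)
    (hindep : ∀ n, 1 ≤ n → iIndepFun (fun (i : Fin m) (ω : Ω) (j : ℤ) => x i n j ω) P) :
    ∀ᵐ ω ∂P, ∀ w, Tendsto (fun n => ntr (word (fun i => scaledHankel n fun j => x i n j ω) w))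
      atTop (𝓝 (limitWord σ ρ₂ w)) := by
  -- There are countably many words, so one null set serves all of them.
  rw [ae_all_iff]
  intro w
  filter_upwards [ae_tendsto_scaledTrace hx hindep w.get] with ω hω
  refine ((Complex.continuous_ofReal.tendsto _).comp hω).congr fun n => ?_
  have h := monomial_eq_word (fun i => scaledHankel n fun j => x i n j ω)
    (fun i => isHermitian_scaledHankel _) w.get fun _ => false
  rw [List.ofFn_get] at h
  rw [← h, ntr_monomial_scaledHankel]
  rfl

lemma tendsto_expectedTrace {p : ℕ} (hx : ∀ i, PairCorrelatedInput P (x i) σ ρ₂)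
    (hindep : ∀ n, 1 ≤ n → iIndepFun (fun (i : Fin m) (ω : Ω) (j : ℤ) => x i n j ω) P)
    (τ : Fin p → Fin m) (ε : Fin p → Bool) :
    Tendsto (fun n => expectedTrace P fun ω =>
      monomial (fun i => scaledHankel n fun j => x i n j ω) τ ε) atTop
      (𝓝 (limitMoment σ ρ₂ τ : ℂ)) := by
  refine ((Complex.continuous_ofReal.tendsto _).comp
    (tendsto_integral_scaledTrace hx hindep τ)).congr fun n => ?_
  rw [expectedTrace, ← integral_const_mul, Function.comp_apply, ← integral_complex_ofReal]
  simp only [← ntr_monomial_scaledHankel x τ ε]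
  rfl

end LimitWord

end

end HankelLSD

end

/-! ### The theorem. -/

open HankelLSD

theorem corollary3p9 {Ω : Type*} [MeasurableSpace Ω] (P : Measure Ω) [IsProbabilityMeasure P]
    (m : ℕ) (σ ρ₂ : ℝ) (x : Fin m → ℕ → ℤ → Ω → ℝ)
    (hx : ∀ i, HankelLSD.PairCorrelatedInput P (x i) σ ρ₂)
    (hindep : ∀ n, 1 ≤ n → iIndepFun (fun (i : Fin m) (ω : Ω) (j : ℤ) => x i n j ω) P)
    (H : (n : ℕ) → Ω → Fin m → Matrix (Fin n) (Fin n) ℂ)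
    (hH : ∀ n ω i, H n ω i = HankelLSD.scaledHankel n fun j => x i n j ω) :
    ∃ (A : Type) (_ : Ring A) (_ : StarRing A) (_ : Algebra ℂ A) (_ : StarModule ℂ A)
      (φ : HankelLSD.State A) (a : Fin m → A),
      -- (a) joint convergence in `*`-distribution, with the limit moments
      HankelLSD.ConvergesInStarDist P H φ a ∧
      (∀ (p : ℕ) (τ : Fin p → Fin m) (ε : Fin p → Bool),
        φ.toLinearMap (HankelLSD.monomial a τ ε) = (HankelLSD.limitMoment σ ρ₂ τ : ℂ)) ∧
      -- (b) limiting spectral distribution of self-adjoint polynomials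
      (∀ Q : FreeAlgebra ℂ (Fin m × Bool),
        (∀ n ω, (HankelLSD.evalPoly (H n ω) Q).IsHermitian) →
        ∃ F : Measure ℝ, IsProbabilityMeasure F ∧
          HankelLSD.WeaklyConverges
            (fun n => HankelLSD.expectedESD P fun ω => HankelLSD.evalPoly (H n ω) Q) F ∧
          (∀ᵐ ω ∂P, HankelLSD.WeaklyConverges
            (fun n => HankelLSD.esd (HankelLSD.evalPoly (H n ω) Q)) F) ∧
          (∀ k : ℕ, Integrable (fun t : ℝ => t ^ k) F ∧
            ((∫ t, t ^ k ∂F : ℝ) : ℂ) = φ.toLinearMap (HankelLSD.evalPoly a Q ^ k)) ∧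
          ∃ v : ℝ≥0, ∀ k : ℕ,
            |∫ t, t ^ k ∂F| ≤ ∫ t, |t| ^ (max 1 (HankelLSD.polyDegree Q) * k) ∂(gaussianReal 0 v)) ∧
      -- (b) limiting spectral distribution of each scaled Hankel matrix
      (∀ i : Fin m, ∃ F : Measure ℝ, IsProbabilityMeasure F ∧ F.map (fun t => -t) = F ∧
        (∀ᵐ ω ∂P, HankelLSD.WeaklyConverges (fun n => HankelLSD.esd (H n ω i)) F) ∧
        ∀ k : ℕ, Integrable (fun t : ℝ => t ^ k) F ∧
          ∫ t, t ^ k ∂F = HankelLSD.limitMoment σ ρ₂ (fun _ : Fin k => i)) := by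
  have hH' : ∀ n ω, H n ω = fun i => scaledHankel n fun j => x i n j ω :=
    fun n ω => funext (hH n ω)
  have hherm : ∀ n ω i, (H n ω i).IsHermitian := fun n ω i => by
    rw [hH]
    exact isHermitian_scaledHankel _
  have hae : ∀ᵐ ω ∂P, ∀ w, Tendsto (fun n => ntr (word (H n ω) w)) atTop
      (𝓝 (limitWord σ ρ₂ w)) := by
    simp only [hH']
    exact ae_tendsto_ntr_word hx hindep
  -- One good outcome suffices to build the state and the measures `F`: both are governed by the
  -- deterministic limit moments, and the universality in `exists_limit_spectral_distribution`
  -- carries `F` to almost every outcome.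
  obtain ⟨ω₀, hω₀⟩ := hae.exists
  have hmeas : ∀ (Q : FreeAlgebra ℂ (Fin m × Bool)) n i j,
      Measurable fun ω => evalPoly (H n ω) Q i j := fun Q n i j => by
    refine measurable_evalPoly (fun k i j => ?_) Q i j
    simp only [hH]
    exact measurable_scaledHankel hx k i j
  obtain ⟨A, _, _, _, _, φ, a, ha, hφ⟩ := exists_limit_state (fun n => hherm n ω₀) hω₀
  have hword : ∀ w, φ.toLinearMap (word a w) = limitWord σ ρ₂ w := by
    intro w
    have h := hφ (word (fun i => FreeAlgebra.ι ℂ (i, false)) w)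
    simp only [evalPoly_word] at h
    exact tendsto_nhds_unique h (hω₀ w)
  have hmon : ∀ (p : ℕ) (τ : Fin p → Fin m) (ε : Fin p → Bool),
      φ.toLinearMap (HankelLSD.monomial a τ ε) = (limitMoment σ ρ₂ τ : ℂ) := fun p τ ε => by
    rw [monomial_eq_word a ha, hword, limitWord_ofFn]
  have hlim := fun (Q : FreeAlgebra ℂ (Fin m × Bool))
      (hQ : ∀ n ω, (evalPoly (H n ω) Q).IsHermitian) =>
    exists_limit_spectral_distribution (fun n => hherm n ω₀) hω₀ (tendsto_growth_limitWord σ ρ₂) Q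
      fun n => hQ n ω₀
  refine ⟨A, _, _, _, _, φ, a, fun p τ ε => ?_, hmon, fun Q hQ => ?_, fun i => ?_⟩
  · rw [hmon]
    simp only [hH']
    exact tendsto_expectedTrace hx hindep τ ε
  · obtain ⟨F, hF, hmom, huniv⟩ := hlim Q hQ
    have hweak : ∀ᵐ ω ∂P, WeaklyConverges (fun n => esd (evalPoly (H n ω) Q)) F := by
      filter_upwards [hae] with ω hω
      exact huniv (fun n => H n ω) (fun n => hherm n ω) hω fun n => hQ n ω
    have hint : ∀ k, ((∫ t, t ^ k ∂F : ℝ) : ℂ) = φ.toLinearMap (evalPoly a Q ^ k) := by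
      intro k
      have h := hφ (Q ^ k)
      simp only [map_pow] at h
      exact tendsto_nhds_unique (hmom k).2 h
    refine ⟨F, hF, weaklyConverges_expectedESD (hmeas Q) hQ hweak, hweak,
      fun k => ⟨(hmom k).1, hint k⟩, ?_⟩
    obtain ⟨v, hv⟩ := exists_norm_map_evalPoly_pow_le_gaussian ha φ.toLinearMap hword Q
    refine ⟨v, fun k => ?_⟩
    rcases Nat.eq_zero_or_pos k with rfl | hk
    · simp
    · rw [← Real.norm_eq_abs, ← Complex.norm_real, hint]
      exact hv k hk
  · have heval : ∀ {B : Type} [Ring B] [Algebra ℂ B] [Star B] (b : Fin m → B),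
        evalPoly b (FreeAlgebra.ι ℂ (i, false)) = b i := fun b => by
      rw [evalPoly_ι]
      rfl
    obtain ⟨F, hF, hmom, huniv⟩ := hlim (FreeAlgebra.ι ℂ (i, false)) fun n ω => by
      rw [heval]
      exact hherm n ω i
    simp only [heval] at hmom huniv
    have hweak : ∀ᵐ ω ∂P, WeaklyConverges (fun n => esd (H n ω i)) F := by
      filter_upwards [hae] with ω hω
      exact huniv (fun n => H n ω) (fun n => hherm n ω) hω fun n => hherm n ω i
    refine ⟨F, hF, ?_, hweak, fun k => ⟨(hmom k).1, ?_⟩⟩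
    -- Words of odd length have limit moment zero, so the negated matrices have the same limit
    -- moments and therefore the same limit distribution `F`.
    · refine map_neg_eq_of_weaklyConverges (fun n => hherm n ω₀ i)
        (huniv (fun n => H n ω₀) (fun n => hherm n ω₀) hω₀ fun n => hherm n ω₀ i)
        (huniv (fun n k => -H n ω₀ k) (fun n k => (hherm n ω₀ k).neg) (fun w => ?_)
          fun n => (hherm n ω₀ i).neg)
      have hneg := (hω₀ w).const_mul ((-1) ^ w.length)
      have hβ : (-1) ^ w.length * limitWord σ ρ₂ w = limitWord σ ρ₂ w := by
        rcases Nat.even_or_odd w.length with h | h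
        · rw [h.neg_one_pow, one_mul]
        · rw [limitWord_eq_zero_of_odd h, mul_zero]
      rw [hβ] at hneg
      refine hneg.congr fun n => ?_
      rw [word_neg, ntr_smul]
    · have h := hω₀ (List.replicate k i)
      simp only [word_replicate] at h
      have h2 := tendsto_nhds_unique (hmom k).2 h
      rw [limitWord_replicate] at h2
      exact_mod_cast h2
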